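/- **Setting.** Let $\Gamma\subset\mathbb R^2$ be a convex closed curve (the boundary of a compact convex set with nonempty interior), oriented counterclockwise, and let $U(\Gamma)$ be the unbounded component of $\mathbb R^2\setminus\Gamma$. For $\theta\in S^1=\mathbb R/2\pi\mathbb Z$ put $u_\theta=(\cos\theta,\sin\theta)$ and $n_\theta=(-\sin\theta,\cos\theta)$, let $\mathcal L_\theta$ be the supporting line $\{z: z\cdot u_\theta=\max_{w\in\Gamma}w\cdot u_\theta\}$ of $\Gamma$, and let $\alpha(\theta)$ be the point of $\mathcal L_\theta\cap\Gamma$ that is furthest in the direction $n_\theta$. The arclength function $s(\theta)$ is the (signed) length along $\Gamma$ from $\alpha(0)$ to $\alpha(\theta)$, regarded as a function of $\theta\in\mathbb R$, and $\rho=ds/d\theta$, wherever it exists, is the radius of curvature. The dual billiards map $\Phi_\Gamma$ on $U(\Gamma)$ sends $z$ to $2\alpha(\theta)-z$, where $\theta\in S^1$ is the unique angle for which $\alpha(\theta)-z$ is a positive multiple of $n_\theta$. An invariant circle of $\Phi_\Gamma$ is a set $\Omega\subset U(\Gamma)$ with $\Phi_\Gamma(\Omega)=\Omega$ that is the image of an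 injective continuous map $S^1\to U(\Gamma)$; it is homotopically nontrivial if this map is not homotopic in $U(\Gamma)$ to a constant map. **Theorem 4.3.** Let $\Gamma$ be a convex closed curve whose arclength function $s$ is Lipschitz, and let $J\subset S^1$ be an open interval. Suppose that either (a) $s$ is $C^1$ on $J$, $\rho>0$ at both endpoints of $J$ (it suffices that the one-sided derivatives of $s$ there, taken from inside $J$, exist and are positive), and $\rho(\hat\theta)=0$ for some $\hat\theta\in J$; or (b) there is $\hat\theta\in J$ such that $s$ is $C^1$ on $J\setminus\{\hat\theta\}$, $\rho>0$ on $J\setminus\{\hat\theta\}$, and $\rho$ has a jump discontinuity at $\hat\theta$, that is, the limits of $\rho(\theta)$ as $\theta\to\hat\theta^-$ and as $\theta\to\hat\theta^+$ exist, are finite and are different. Then there is an open neighbourhood $N$ of $\Gamma$ in $\mathbb R^2$ such that no homotopically nontrivial invariant circle of $\Phi_\Gamma$ is contained in $N$. -/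

import Mathlib

/-! Convex closed curves in the plane `ℂ = ℝ²`, their arclength as a function of the direction of
the outward normal, and the dual billiards map on the exterior. -/

namespace DualBilliards

/-- A convex closed curve: the boundary of a compact convex set with nonempty interior. -/
def IsConvexCurve (Γ : Set ℂ) : Prop :=
  ∃ K : Set ℂ, IsCompact K ∧ Convex ℝ K ∧ (interior K).Nonempty ∧ Γ = frontier K

/-- `U(Γ)`: the (union of the) unbounded component(s) of the complement of `Γ`. -/
def exteriorRegion (Γ : Set ℂ) : Set ℂ :=
  {z | z ∉ Γ ∧ ¬ Bornology.IsBounded (connectedComponentIn Γᶜ z)}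

/-- The unit vector `u_θ = (cos θ, sin θ)`. -/
noncomputable def unitVec (θ : ℝ) : ℂ := ⟨Real.cos θ, Real.sin θ⟩

/-- The unit vector `n_θ = (-sin θ, cos θ)`. -/
noncomputable def dirVec (θ : ℝ) : ℂ := ⟨-Real.sin θ, Real.cos θ⟩

/-- The height (support) function `p(θ) = max {z · u_θ : z ∈ Γ}`. -/
noncomputable def height (Γ : Set ℂ) (θ : ℝ) : ℝ :=
  sSup ((fun z : ℂ => inner ℝ z (unitVec θ)) '' Γ)

/-- The intersection of `Γ` with its supporting line `{z : z · u_θ = p(θ)}`. -/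
def supportFace (Γ : Set ℂ) (θ : ℝ) : Set ℂ :=
  {z ∈ Γ | inner ℝ z (unitVec θ) = height Γ θ}

/-- The point of tangency `α(θ)`: the point of the supporting line `{z : z · u_θ = p(θ)}` that is
the point of `supportFace Γ θ` furthest in the direction `n_θ` (its counterclockwise endpoint, if
it is a segment), written in the orthonormal basis `u_θ, n_θ`. -/
noncomputable def tangencyPoint (Γ : Set ℂ) (θ : ℝ) : ℂ :=
  height Γ θ • unitVec θ +
    sSup ((fun z : ℂ => inner ℝ z (dirVec θ)) '' supportFace Γ θ) • dirVec θ

/-- The arclength function `s(θ)`, lifted to `ℝ`: the signed length along `Γ` from `α(0)` to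
`α(θ)`, as the supremum of the lengths of inscribed polygonal lines. -/
noncomputable def arclength (Γ : Set ℂ) (θ : ℝ) : ℝ :=
  variationOnFromTo (tangencyPoint Γ) Set.univ 0 θ

/-- The radius of curvature `ρ = ds/dθ` (meaningful where `s` is differentiable). -/
noncomputable def radiusOfCurvature (Γ : Set ℂ) : ℝ → ℝ := deriv (arclength Γ)

/-- `z` lies on the supporting line in direction `n_θ`, strictly before the point of tangency. -/
def IsTangentAngle (Γ : Set ℂ) (z : ℂ) (θ : ℝ) : Prop :=
  ∃ r : ℝ, 0 < r ∧ tangencyPoint Γ θ - z = r • dirVec θ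

/-- The dual billiards map: `z` is reflected in the point of tangency `α(θ)` of the oriented
supporting line through `z`. For `z` in the exterior, `θ` exists and is unique modulo `2π`. -/
noncomputable def dualBilliardsMap (Γ : Set ℂ) (z : ℂ) : ℂ :=
  2 * tangencyPoint Γ (Classical.epsilon (IsTangentAngle Γ z)) - z

/-- `Ω` is a homotopically nontrivial circle in `U`: the image of an injective continuous map from
the circle to `U` that is not homotopic in `U` to a constant map. -/
def IsEssentialCircle (U Ω : Set ℂ) : Prop :=
  ∃ c : C(Circle, U), Function.Injective c ∧ Ω = Set.range (fun t => (c t : ℂ)) ∧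
    ¬ c.Nullhomotopic

end DualBilliards

/-! The curve `α` of points of tangency is Lipschitz, because the arclength is. An exterior point can
be written as `α θ - r n_θ` with `r > 0`; the coordinates `w = r e^{iθ}` turn the exterior into
the punctured plane, and collapsing the convex body to the origin gives a continuous map
(`IsSupportCurve.continuous_collapse`). In these coordinates the dual billiards map becomes a
homeomorphism of the plane (`IsSupportCurve.billiardHomeo`) which fixes the origin, preserves area
(`IsSupportCurve.volume_billiardHomeo_preimage`) and twists: on a ray from the origin the argument
of the image increases with the radius (`IsSupportCurve.billiardHomeo_twist`).

An invariant circle near the curve that is not contractible in the exterior encloses the origin in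
these coordinates, since otherwise it would carry a continuous logarithm. By a theorem of Birkhoff
the component `V` of the origin in its complement is star-shaped
(`IsInnerDomain.subset_starKernel`). If it were not, the part of `V` that is not visible from the
origin would contain pockets, cut off from `V` by radial segments. The pockets are pairwise
disjoint or equal, so there is one of largest area. The twist implies that the homeomorphism or
its inverse, depending on the side of the pocket, maps this pocket into some pocket, and area
preservation implies that it maps onto it up to a null set; then a radial segment is mapped into a
radial segment, contrary to the twist. So `V` is given by a radius function `R`. For `θ < φ < θ +
π` let `fore θ φ` and `back θ φ` be the distances from the intersection of the tangent lines at
`θ` and `φ` to `α θ` and `α φ`. Invariance of `V` means that `fore θ φ < R θ ↔ back θ φ < R φ`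
(`IsInvariantRadius`).

It remains to bound such functions `R` from below at a single angle `θ₀` by a constant that
depends on the curve only; this is a contradiction if the circle is close enough to the curve. If
the curvature radius vanishes at `θ₀`, at least from one side, let `p` and `q` be the neighbours
of `θ₀` in the orbit of the boundary point over `θ₀`. For `φ` slightly beyond `θ₀` the invariance
gives `fore φ q < back p φ`. On the other hand, as `α φ - α θ₀ = o(φ - θ₀)`, turning the tangent
line at `θ₀` about the point `α θ₀` shows that `fore φ q - back p φ` is, up to `o(φ - θ₀)`, a
positive multiple of `sin (q - p) (φ - θ₀)`; and `q - p < π` if `R θ₀` is small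
(`exists_le_of_right_deriv_zero`). If the curvature radius jumps from `l > 0` to `r > 0` at `θ₀`,
with `l ≠ r`, then for small `R θ₀` the curve looks like a circle on each side of `θ₀`, and orbits
that interlace on the boundary of `V` show that `R` is nearly constant near `θ₀`
(`IsInvariantRadius.radius_left`). But the tangent lines at `θ₀ - R θ₀ / l` and `θ₀ + R θ₀ / r`
meet in a point whose two tangent lengths differ from `R θ₀` by fixed factors, one in each
direction (`exists_le_of_jump`). A jump from or to `0` is covered by the first case. -/

namespace DualBilliards

open Set Filter Topology MeasureTheory

/-! ### Winding numbers and crossings -/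

section

/-- On a set at positive distance from a connected set `Ω`, the quotient `(z - p) / (z - q)` has a
continuous logarithm whenever `p, q ∈ Ω`: join `p` to `q` by short steps inside `Ω`. -/
theorem exists_log_div {Ω A : Set ℂ} (hΩ : IsPreconnected Ω) {d : ℝ} (hd : 0 < d)
    (hA : ∀ z ∈ A, ∀ q ∈ Ω, d ≤ dist z q) {p q : ℂ} (hp : p ∈ Ω) (hq : q ∈ Ω) :
    ∃ L : ℂ → ℂ, ContinuousOn L A ∧ ∀ z ∈ A, Complex.exp (L z) = (z - p) / (z - q) := by
  have hne : ∀ z ∈ A, ∀ q ∈ Ω, z - q ≠ 0 := fun z hz q hq h0 => by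
    have := hA z hz q hq
    rw [dist_eq_norm, h0, norm_zero] at this
    linarith
  refine hΩ.induction₂ (fun p q => ∃ L : ℂ → ℂ, ContinuousOn L A ∧
    ∀ z ∈ A, Complex.exp (L z) = (z - p) / (z - q)) ?_ ?_ ?_ hp hq
  · intro p hp
    filter_upwards [self_mem_nhdsWithin, mem_nhdsWithin_of_mem_nhds (Metric.ball_mem_nhds p hd)]
      with q hq hpq
    have hslit : ∀ z ∈ A, (z - p) / (z - q) ∈ Complex.slitPlane := by
      intro z hz
      have h0 := hne z hz q hq
      have : (z - p) / (z - q) = 1 + (q - p) / (z - q) := by field_simp; ring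
      rw [this]
      apply Complex.mem_slitPlane_of_norm_lt_one
      rw [norm_div, div_lt_one (norm_pos_iff.2 h0)]
      have h1 := hA z hz q hq
      rw [dist_eq_norm] at h1
      rw [Metric.mem_ball, dist_eq_norm] at hpq
      linarith
    refine ⟨fun z => Complex.log ((z - p) / (z - q)), ?_, fun z hz => ?_⟩
    · refine ContinuousOn.clog ?_ hslit
      exact ContinuousOn.div (by fun_prop) (by fun_prop) (fun z hz => hne z hz q hq)
    · exact Complex.exp_log (Complex.slitPlane_ne_zero (hslit z hz))
  · rintro x y z hx hy hz ⟨L, hL, hL'⟩ ⟨M, hM, hM'⟩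
    refine ⟨fun w => L w + M w, hL.add hM, fun w hw => ?_⟩
    rw [Complex.exp_add, hL' w hw, hM' w hw]
    have := hne w hw y hy
    field_simp
  · rintro x y hx hy ⟨L, hL, hL'⟩
    refine ⟨fun w => - L w, hL.neg, fun w hw => ?_⟩
    rw [Complex.exp_neg, hL' w hw, inv_div]

/-- The cross product `w × z` in the plane: positive iff `z` is counterclockwise from `w`. -/
def cross (w z : ℂ) : ℝ := w.re * z.im - w.im * z.re

theorem continuous_cross (w : ℂ) : Continuous (cross w) := by
  unfold cross; fun_prop

/-- Two continuous logarithms of the same function differ by a constant on a connected set. -/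
theorem log_sub_log_const {S : Set ℂ} (hS : IsPreconnected S) {L M : ℂ → ℂ}
    (hL : ContinuousOn L S) (hM : ContinuousOn M S)
    (h : ∀ z ∈ S, Complex.exp (L z) = Complex.exp (M z)) {a b : ℂ} (ha : a ∈ S) (hb : b ∈ S) :
    L a - M a = L b - M b := by
  have key : ∀ z ∈ S, ∃ n : ℤ, L z - M z = n * (2 * Real.pi * Complex.I) := fun z hz => by
    obtain ⟨n, hn⟩ := Complex.exp_eq_exp_iff_exists_int.1 (h z hz)
    exact ⟨n, by rw [hn]; ring⟩
  have hne : (2 * Real.pi * Complex.I : ℂ) ≠ 0 := Complex.two_pi_I_ne_zero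
  have h2 := hS.constant_of_mapsTo (T := range (Int.cast : ℤ → ℂ))
    (f := fun z => (L z - M z) / (2 * Real.pi * Complex.I)) ?_ ?_ ?_ ha hb
  · exact (div_left_inj' hne).1 h2
  · exact (Complex.isClosedEmbedding_intCast.isEmbedding).isDiscrete_range
  · exact (hL.sub hM).div_const _
  · intro z hz
    obtain ⟨n, hn⟩ := key z hz
    exact ⟨n, by simp only [hn]; field_simp⟩

/-- A connected open set in the complement of a connected closed set `Ω` cannot touch a radial
segment with endpoints in `Ω` from both sides: otherwise a closed curve disjoint from `Ω` would
cross the segment exactly once, and the continuous logarithm of `(z - p) / (z - q)` along the curve,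
`p` and `q` being the endpoints, would have a jump of `2πi`. -/
theorem false_of_crossing {Ω B : Set ℂ} (hΩ : IsPreconnected Ω) (hΩc : IsClosed Ω) (hB : IsOpen B)
    (hBc : IsPreconnected B) (hBΩ : B ⊆ Ωᶜ) {x : ℂ} {s t : ℝ} (hs : s < 1) (ht : 1 < t)
    (hsx : (s : ℂ) * x ∈ Ω) (htx : (t : ℂ) * x ∈ Ω) (hseg : ∀ r ∈ Icc s t, (r : ℂ) * x ∉ B)
    {a b : ℂ} (ha : a ∈ B) (hb : b ∈ B) (hax : segment ℝ x a ⊆ Ωᶜ) (hbx : segment ℝ x b ⊆ Ωᶜ)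
    (hxa : 0 < cross x a) (hxb : cross x b < 0) : False := by
  have hpath : IsPathConnected B := (hB.isConnected_iff_isPathConnected).1 ⟨⟨a, ha⟩, hBc⟩
  obtain ⟨γ, hγ⟩ := hpath.joinedIn a ha b hb
  set P : Set ℂ := range γ with hP
  have hPB : P ⊆ B := by rintro _ ⟨u, rfl⟩; exact hγ u
  have hPpre : IsPreconnected P := isPreconnected_range γ.continuous
  set p : ℂ := s * x
  set q : ℂ := t * x
  set A : Set ℂ := segment ℝ x a ∪ P ∪ segment ℝ x b with hAdef
  have hAcomp : IsCompact A := by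
    have hseg : ∀ y : ℂ, IsCompact (segment ℝ x y) := fun y => by
      rw [segment_eq_image_lineMap]
      exact isCompact_Icc.image (by fun_prop)
    exact ((hseg a).union (isCompact_range γ.continuous)).union (hseg b)
  have hAΩ : Disjoint A Ω := by
    rw [Set.disjoint_iff]
    rintro z ⟨(hz | hz) | hz, hzΩ⟩
    exacts [hax hz hzΩ, hBΩ (hPB hz) hzΩ, hbx hz hzΩ]
  obtain ⟨d, hd, hdis⟩ := Metric.exists_pos_forall_lt_edist hAcomp hΩc hAΩ
  obtain ⟨L, hL, hL'⟩ := exists_log_div hΩ (A := A) (d := d) (by exact_mod_cast hd)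
    (fun z hz q hq => by
      have := hdis z hz q hq
      rw [edist_nndist] at this
      have h2 : d < nndist z q := by exact_mod_cast this
      exact (show (d : ℝ) < nndist z q from by exact_mod_cast h2).le) hsx htx
  set g : ℂ → ℂ := fun z => (z - p) / (z - q) with hg
  -- the half-open segments
  set e : ℂ → ℝ → ℂ := fun y r => x + r * (y - x) with he
  have hmem : ∀ y r, r ∈ Icc (0 : ℝ) 1 → e y r ∈ segment ℝ x y := fun y r hr => by
    rw [segment_eq_image']
    exact ⟨r, hr, by simp [he]⟩
  have hS : ∀ y, IsPreconnected (e y '' Ioc 0 1) := fun y =>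
    isPreconnected_Ioc.image _ (by fun_prop)
  set A' : Set ℂ := e a '' Ioc 0 1 ∪ P ∪ e b '' Ioc 0 1 with hA'def
  have hA'A : A' ⊆ A := by
    rintro z ((⟨r, hr, rfl⟩ | hz) | ⟨r, hr, rfl⟩)
    · exact Or.inl (Or.inl (hmem a r ⟨hr.1.le, hr.2⟩))
    · exact Or.inl (Or.inr hz)
    · exact Or.inr (hmem b r ⟨hr.1.le, hr.2⟩)
  have hA'pre : IsPreconnected A' := by
    refine IsPreconnected.union b ?_ ?_ (IsPreconnected.union a ?_ ?_ (hS a) hPpre) (hS b)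
    · exact Or.inr ⟨1, γ.target⟩
    · exact ⟨1, by simp, by simp [he]⟩
    · exact ⟨1, by simp, by simp [he]⟩
    · exact ⟨0, γ.source⟩
  have hcr : ∀ y r, cross x (e y r) = r * cross x y := fun y r => by
    simp [cross, he]; ring
  have hx0 : x ≠ 0 := fun h => by simp [h, cross] at hxa
  have hne : ∀ z ∈ A, z - q ≠ 0 := fun z hz h0 => by
    rw [sub_eq_zero] at h0
    exact Set.disjoint_left.1 hAΩ hz (h0 ▸ htx)
  have hnep : ∀ z ∈ A, z - p ≠ 0 := fun z hz h0 => by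
    rw [sub_eq_zero] at h0
    exact Set.disjoint_left.1 hAΩ hz (h0 ▸ hsx)
  have hgc : ContinuousOn g A := ContinuousOn.div (by fun_prop) (by fun_prop) hne
  -- the imaginary part of `g` has the opposite sign of the cross product with `x`
  have hgim : ∀ z, (g z).im = (s - t) * cross x z / Complex.normSq (z - q) := fun z => by
    simp only [hg, Complex.div_im, p, q, cross]
    simp
    ring
  have hgslit : ∀ z ∈ A', g z ∈ Complex.slitPlane := by
    have hside : ∀ y, cross x y ≠ 0 → ∀ r ∈ Ioc (0 : ℝ) 1, e y r ∈ A →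
        g (e y r) ∈ Complex.slitPlane := by
      intro y hy r hr hA
      refine Or.inr ?_
      rw [hgim, hcr]
      have := Complex.normSq_pos.2 (hne _ hA)
      have h1 : s - t ≠ 0 := by linarith
      have h2 := hr.1.ne'
      positivity
    rintro z ((⟨r, hr, rfl⟩ | hz) | ⟨r, hr, rfl⟩)
    · exact hside a hxa.ne' r hr (hA'A (Or.inl (Or.inl ⟨r, hr, rfl⟩)))
    · by_contra hcon
      have hzA : z ∈ A := Or.inl (Or.inr hz)
      rw [Complex.mem_slitPlane_iff_not_le_zero, not_not, Complex.le_def] at hcon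
      -- then `z` would lie on the segment from `p` to `q`
      set c : ℝ := -(g z).re with hcdef
      have hc0 : 0 ≤ c := by have := hcon.1; simp at this; linarith
      have hgz : g z = -(c : ℂ) := by
        apply Complex.ext
        · simp [hcdef]
        · simpa using hcon.2
      have hz1 : z - p = -(c : ℂ) * (z - q) := by
        rw [← hgz, hg]
        simp only
        rw [div_mul_cancel₀ _ (hne z hzA)]
      have hc1 : (1 + c : ℂ) ≠ 0 := by
        have : (1 + c : ℝ) ≠ 0 := by linarith
        exact_mod_cast this
      have hz2 : z = (((s + c * t) / (1 + c) : ℝ) : ℂ) * x := by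
        push_cast
        field_simp
        simp only [p, q] at hz1
        linear_combination hz1
      refine hseg ((s + c * t) / (1 + c)) ⟨?_, ?_⟩ (hz2 ▸ hPB hz)
      · rw [le_div_iff₀ (by linarith)]; nlinarith
      · rw [div_le_iff₀ (by linarith)]; nlinarith
    · exact hside b hxb.ne r hr (hA'A (Or.inr ⟨r, hr, rfl⟩))
  have hconst : ∀ u ∈ A', ∀ v ∈ A',
      L u - Complex.log (g u) = L v - Complex.log (g v) := fun u hu v hv =>
    log_sub_log_const hA'pre (M := fun z => Complex.log (g z)) (hL.mono hA'A)
      ((hgc.mono hA'A).clog hgslit) (fun z hz => by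
        rw [hL' z (hA'A hz), Complex.exp_log (Complex.slitPlane_ne_zero (hgslit z hz))]) hu hv
  have hxA : x ∈ A := Or.inl (Or.inl (left_mem_segment ℝ x a))
  have hgx : g x = (((1 - s) / (1 - t) : ℝ) : ℂ) := by
    have h1 : (1 - t : ℂ) ≠ 0 := by
      have : (1 - t : ℝ) ≠ 0 := by linarith
      exact_mod_cast this
    have h2 := hne x hxA
    simp only [hg, p, q] at h2 ⊢
    push_cast
    field_simp
  have hgxre : (g x).re < 0 := by
    rw [hgx, Complex.ofReal_re]
    exact div_neg_of_pos_of_neg (by linarith) (by linarith)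
  have hgxim : (g x).im = 0 := by rw [hgx, Complex.ofReal_im]
  -- approach `x` along the two segments
  have hlim : ∀ y, segment ℝ x y ⊆ A → Tendsto (e y) (𝓝[>] 0) (𝓝[A] x) := by
    intro y hy
    refine tendsto_nhdsWithin_iff.2 ⟨?_, ?_⟩
    · have : ContinuousAt (e y) 0 := by fun_prop
      have h2 := this.tendsto
      simp only [he, Complex.ofReal_zero, zero_mul, add_zero] at h2
      exact h2.mono_left nhdsWithin_le_nhds
    · filter_upwards [Ioo_mem_nhdsGT (zero_lt_one' ℝ)] with r hr
      exact hy (hmem y r ⟨hr.1.le, hr.2.le⟩)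
  have hAa : segment ℝ x a ⊆ A := fun z hz => Or.inl (Or.inl hz)
  have hAb : segment ℝ x b ⊆ A := fun z hz => Or.inr hz
  have hla : Tendsto (fun r => L (e a r) - Complex.log (g (e a r))) (𝓝[>] 0)
      (𝓝 (L x - (Real.log ‖g x‖ - Real.pi * Complex.I))) := by
    refine (Tendsto.comp (hL x hxA) (hlim a hAa)).sub ?_
    refine (Complex.tendsto_log_nhdsWithin_im_neg_of_re_neg_of_im_zero hgxre hgxim).comp ?_
    refine tendsto_nhdsWithin_iff.2 ⟨Tendsto.comp (hgc x hxA) (hlim a hAa), ?_⟩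
    filter_upwards [Ioo_mem_nhdsGT (zero_lt_one' ℝ)] with r hr
    rw [hgim, hcr]
    have h3 := Complex.normSq_pos.2 (hne _ (hAa (hmem a r ⟨hr.1.le, hr.2.le⟩)))
    have h4 : (s - t) * (r * cross x a) < 0 :=
      mul_neg_of_neg_of_pos (by linarith) (mul_pos hr.1 hxa)
    exact div_neg_of_neg_of_pos h4 h3
  have hlb : Tendsto (fun r => L (e b r) - Complex.log (g (e b r))) (𝓝[>] 0)
      (𝓝 (L x - (Real.log ‖g x‖ + Real.pi * Complex.I))) := by
    refine (Tendsto.comp (hL x hxA) (hlim b hAb)).sub ?_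
    refine (Complex.tendsto_log_nhdsWithin_im_nonneg_of_re_neg_of_im_zero hgxre hgxim).comp ?_
    refine tendsto_nhdsWithin_iff.2 ⟨Tendsto.comp (hgc x hxA) (hlim b hAb), ?_⟩
    filter_upwards [self_mem_nhdsWithin] with r hr
    rw [hgim, hcr]
    have h2 : (0 : ℝ) < r := hr
    have h3 := Complex.normSq_nonneg (e b r - q)
    exact div_nonneg (mul_nonneg_of_nonpos_of_nonpos (by linarith)
      (mul_nonpos_of_nonneg_of_nonpos h2.le hxb.le)) h3
  have heq : (fun r => L (e a r) - Complex.log (g (e a r))) =ᶠ[𝓝[>] 0]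
      fun r => L (e b r) - Complex.log (g (e b r)) := by
    filter_upwards [Ioo_mem_nhdsGT (zero_lt_one' ℝ)] with r hr
    exact hconst _ (Or.inl (Or.inl ⟨r, ⟨hr.1, hr.2.le⟩, rfl⟩)) _ (Or.inr ⟨r, ⟨hr.1, hr.2.le⟩, rfl⟩)
  have := tendsto_nhds_unique (hla.congr' heq) hlb
  have h2 : (2 * Real.pi * Complex.I : ℂ) = 0 := by linear_combination this
  exact Complex.two_pi_I_ne_zero h2

end

/-! ### Inner domains and pockets -/

section

/-- A bounded connected open neighbourhood `V` of the origin whose frontier lies in a closed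
connected set `Ω` disjoint from `V`. -/
structure IsInnerDomain (Ω V : Set ℂ) : Prop where
  preconnected_bdry : IsPreconnected Ω
  closed_bdry : IsClosed Ω
  isOpen : IsOpen V
  preconnected : IsPreconnected V
  zero_mem : (0 : ℂ) ∈ V
  subset_compl : V ⊆ Ωᶜ
  frontier_subset : frontier V ⊆ Ω
  bounded : Bornology.IsBounded V

/-- The points of `V` that are visible from the origin inside `V`. -/
def starKernel (V : Set ℂ) : Set ℂ := {z | ∀ t ∈ Icc (0 : ℝ) 1, (t : ℂ) * z ∈ V}

theorem starKernel_subset (V : Set ℂ) : starKernel V ⊆ V := fun z hz => by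
  simpa using hz 1 (by simp)

theorem mul_mem_starKernel {V : Set ℂ} {z : ℂ} (hz : z ∈ starKernel V) {t : ℝ}
    (ht : t ∈ Icc (0 : ℝ) 1) : (t : ℂ) * z ∈ starKernel V := fun r hr => by
  have := hz (r * t) ⟨mul_nonneg hr.1 ht.1, mul_le_one₀ hr.2 ht.1 ht.2⟩
  rwa [Complex.ofReal_mul, mul_assoc] at this

theorem isOpen_starKernel {V : Set ℂ} (hV : IsOpen V) : IsOpen (starKernel V) := by
  rw [isOpen_iff_eventually]
  intro z hz
  refine isCompact_Icc.eventually_forall_of_forall_eventually ?_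
  intro t ht
  have : Continuous fun w : ℂ × ℝ => (w.2 : ℂ) * w.1 := by fun_prop
  exact this.continuousAt.eventually_mem (hV.mem_nhds (hz t ht))

theorem zero_mem_starKernel {V : Set ℂ} (h : (0 : ℂ) ∈ V) : (0 : ℂ) ∈ starKernel V :=
  fun t _ => by simpa using h

theorem isPreconnected_starKernel (V : Set ℂ) :
    IsPreconnected (starKernel V) := by
  refine isPreconnected_of_forall 0 fun z hz => ⟨(fun t : ℝ => (t : ℂ) * z) '' Icc 0 1, ?_,
    ⟨0, by simp, by simp⟩, ⟨1, by simp, by simp⟩, isPreconnected_Icc.image _ (by fun_prop)⟩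
  rintro _ ⟨t, ht, rfl⟩
  exact mul_mem_starKernel hz ht

theorem cross_smul_left (r : ℝ) (w z : ℂ) : cross ((r : ℂ) * w) z = r * cross w z := by
  simp [cross]; ring

theorem cross_smul_right (r : ℝ) (w z : ℂ) : cross w ((r : ℂ) * z) = r * cross w z := by
  simp [cross]; ring

theorem cross_swap (w z : ℂ) : cross z w = - cross w z := by
  simp [cross]; ring

theorem exists_smul_of_cross_eq_zero {x z : ℂ} (hx : x ≠ 0) (h : cross x z = 0) :
    ∃ r : ℝ, z = (r : ℂ) * x ∧ ‖z - x‖ = |r - 1| * ‖x‖ := by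
  have hn : Complex.normSq x ≠ 0 := (Complex.normSq_pos.2 hx).ne'
  have hz : z = (((x.re * z.re + x.im * z.im) / Complex.normSq x : ℝ) : ℂ) * x := by
    rw [Complex.normSq_apply] at hn ⊢
    unfold cross at h
    apply Complex.ext
    · rw [Complex.re_ofReal_mul, eq_comm, div_mul_eq_mul_div, div_eq_iff hn]
      linear_combination x.im * h
    · rw [Complex.im_ofReal_mul, eq_comm, div_mul_eq_mul_div, div_eq_iff hn]
      linear_combination -x.re * h
  refine ⟨_, hz, ?_⟩
  set r : ℝ := (x.re * z.re + x.im * z.im) / Complex.normSq x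
  rw [hz, show (r : ℂ) * x - x = ((r - 1 : ℝ) : ℂ) * x by push_cast; ring, norm_mul,
    Complex.norm_real, Real.norm_eq_abs]

theorem convex_side (σ : ℝ) (x : ℂ) : Convex ℝ {z | 0 < σ * cross x z} := by
  intro a ha b hb u v hu hv huv
  have h1 : 0 < σ * cross x a := ha
  have h2 : 0 < σ * cross x b := hb
  show 0 < σ * cross x (u • a + v • b)
  have : σ * cross x (u • a + v • b) = u * (σ * cross x a) + v * (σ * cross x b) := by
    simp [cross]; ring
  rw [this]
  rcases hu.eq_or_lt with rfl | hu
  · have : v = 1 := by linarith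
    subst this; linarith
  · nlinarith [mul_pos hu h1, mul_nonneg hv h2.le]

variable {Ω V : Set ℂ}

/-- A point of `V` outside the star kernel lies on a radial segment of `V` both of whose endpoints
are in `Ω`. -/
theorem IsInnerDomain.exists_fence (h : IsInnerDomain Ω V) {x : ℂ} (hx : x ∈ V)
    (hxK : x ∉ starKernel V) : ∃ s t : ℝ, 0 < s ∧ s < 1 ∧ 1 < t ∧ (s : ℂ) * x ∈ Ω ∧
      (t : ℂ) * x ∈ Ω ∧ ∀ r ∈ Ioo s t, (r : ℂ) * x ∈ V := by
  have hx0 : x ≠ 0 := fun h0 => hxK (h0 ▸ zero_mem_starKernel h.zero_mem)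
  have hcont : Continuous fun r : ℝ => (r : ℂ) * x := by fun_prop
  have hfr : ∀ {y : ℂ}, y ∈ closure V → y ∉ V → y ∈ Ω := fun h1 h2 =>
    h.frontier_subset ⟨h1, by rwa [h.isOpen.interior_eq]⟩
  -- lower end
  have hlow : ∃ s : ℝ, 0 < s ∧ s < 1 ∧ (s : ℂ) * x ∈ Ω ∧ ∀ r ∈ Ioc s 1, (r : ℂ) * x ∈ V := by
    simp only [starKernel, mem_ofPred_eq, not_forall] at hxK
    obtain ⟨r₀, hr₀, hr₀V⟩ := hxK
    set E : Set ℝ := Icc 0 1 ∩ (fun r : ℝ => (r : ℂ) * x) ⁻¹' Vᶜ with hE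
    have hEc : IsCompact E := isCompact_Icc.inter_right (h.isOpen.isClosed_compl.preimage hcont)
    have hEne : E.Nonempty := ⟨r₀, hr₀, hr₀V⟩
    obtain ⟨s, hsE, hsmax⟩ := hEc.exists_isGreatest hEne
    have hs1 : s < 1 := lt_of_le_of_ne hsE.1.2 fun h1 => hsE.2 (by simpa [h1] using hx)
    have hs0 : 0 < s := lt_of_le_of_ne hsE.1.1 fun h1 => hsE.2 (by simpa [← h1] using h.zero_mem)
    have hab : ∀ r ∈ Ioc s 1, (r : ℂ) * x ∈ V := fun r hr => by
      by_contra hcon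
      exact absurd (hsmax ⟨⟨hs0.le.trans hr.1.le, hr.2⟩, hcon⟩) (not_le.2 hr.1)
    refine ⟨s, hs0, hs1, hfr ?_ hsE.2, hab⟩
    refine mem_closure_of_tendsto (f := fun r : ℝ => (r : ℂ) * x) (b := 𝓝[>] s)
      (hcont.continuousAt.tendsto.mono_left nhdsWithin_le_nhds) ?_
    filter_upwards [Ioc_mem_nhdsGT hs1] with r hr using hab r hr
  have hupp : ∃ t : ℝ, 1 < t ∧ (t : ℂ) * x ∈ Ω ∧ ∀ r ∈ Ico 1 t, (r : ℂ) * x ∈ V := by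
    set E : Set ℝ := Ici 1 ∩ (fun r : ℝ => (r : ℂ) * x) ⁻¹' Vᶜ with hE
    have hEc : IsClosed E := isClosed_Ici.inter (h.isOpen.isClosed_compl.preimage hcont)
    have hEbdd : BddBelow E := ⟨1, fun r hr => hr.1⟩
    have hEne : E.Nonempty := by
      obtain ⟨M, hM⟩ := h.bounded.exists_norm_le
      have hxn : 0 < ‖x‖ := norm_pos_iff.2 hx0
      refine ⟨max 1 (|M| / ‖x‖ + 1), mem_Ici.2 (le_max_left _ _), fun hV => ?_⟩
      have h1 := hM _ hV
      rw [norm_mul, Complex.norm_real, Real.norm_eq_abs] at h1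
      have h2 : |M| / ‖x‖ + 1 ≤ |max 1 (|M| / ‖x‖ + 1)| := (le_max_right _ _).trans (le_abs_self _)
      have h3 : (|M| / ‖x‖ + 1) * ‖x‖ ≤ M := (mul_le_mul_of_nonneg_right h2 hxn.le).trans h1
      rw [add_mul, div_mul_cancel₀ _ hxn.ne'] at h3
      linarith [le_abs_self M]
    have htE := hEc.csInf_mem hEne hEbdd
    set t := sInf E
    have ht1 : 1 < t := lt_of_le_of_ne htE.1 fun h1 => htE.2 (by simpa [← h1] using hx)
    have hab : ∀ r ∈ Ico 1 t, (r : ℂ) * x ∈ V := fun r hr => by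
      by_contra hcon
      exact absurd (csInf_le hEbdd ⟨hr.1, hcon⟩) (not_le.2 hr.2)
    refine ⟨t, ht1, hfr ?_ htE.2, hab⟩
    refine mem_closure_of_tendsto (f := fun r : ℝ => (r : ℂ) * x) (b := 𝓝[<] t)
      (hcont.continuousAt.tendsto.mono_left nhdsWithin_le_nhds) ?_
    filter_upwards [Ico_mem_nhdsLT ht1] with r hr using hab r hr
  obtain ⟨s, hs0, hs1, hsΩ, hs⟩ := hlow
  obtain ⟨t, ht1, htΩ, ht⟩ := hupp
  refine ⟨s, t, hs0, hs1, ht1, hsΩ, htΩ, fun r hr => ?_⟩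
  rcases le_total r 1 with h1 | h1
  · exact hs r ⟨hr.1, h1⟩
  · exact ht r ⟨h1, hr.2⟩

/-- Signed version of `false_of_crossing` inside a convex subset `U` of `V`. -/
theorem IsInnerDomain.false_of_crossing (h : IsInnerDomain Ω V) {B U : Set ℂ} (hB : IsOpen B)
    (hBc : IsPreconnected B) (hBV : B ⊆ V) (hU : Convex ℝ U) (hUV : U ⊆ V) {x : ℂ} {s t : ℝ}
    (hs : s < 1) (ht : 1 < t) (hsx : (s : ℂ) * x ∈ Ω) (htx : (t : ℂ) * x ∈ Ω)
    (hseg : ∀ r ∈ Ioo s t, (r : ℂ) * x ∉ B) (hxU : x ∈ U) {σ : ℝ}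
    {a b : ℂ} (ha : a ∈ B) (hb : b ∈ B) (haU : a ∈ U) (hbU : b ∈ U)
    (hxa : 0 < σ * cross x a) (hxb : σ * cross x b < 0) : False := by
  have hseg' : ∀ r ∈ Icc s t, (r : ℂ) * x ∉ B := by
    intro r hr hrB
    rcases hr.1.eq_or_lt with rfl | h1
    · exact h.subset_compl (hBV hrB) hsx
    rcases hr.2.eq_or_lt with rfl | h2
    · exact h.subset_compl (hBV hrB) htx
    exact hseg r ⟨h1, h2⟩ hrB
  have hsa : segment ℝ x a ⊆ Ωᶜ := (hU.segment_subset hxU haU).trans (hUV.trans h.subset_compl)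
  have hsb : segment ℝ x b ⊆ Ωᶜ := (hU.segment_subset hxU hbU).trans (hUV.trans h.subset_compl)
  have hBΩ := hBV.trans h.subset_compl
  rcases lt_trichotomy σ 0 with hσ | hσ | hσ
  · exact DualBilliards.false_of_crossing h.preconnected_bdry h.closed_bdry hB hBc hBΩ hs ht hsx htx
      hseg' hb ha hsb hsa (by nlinarith) (by nlinarith)
  · simp [hσ] at hxa
  · exact DualBilliards.false_of_crossing h.preconnected_bdry h.closed_bdry hB hBc hBΩ hs ht hsx htx
      hseg' ha hb hsa hsb (by nlinarith) (by nlinarith)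

/-- A pocket of `V`: a component `P` of the complement in `V` of a radial segment of `V`, the gate,
that lies on one side of the gate, while the star kernel touches the gate from the other side, the
side of sign `σ`. The gate consists of the points `r x` with `s < r < t`, where `s < 1 < t`; the
field `closure_inter` says that `P` is a whole component of the complement of the gate. -/
structure IsPocket (V P : Set ℂ) (σ : ℝ) (x : ℂ) (s t : ℝ) : Prop where
  isOpen : IsOpen P
  preconnected : IsPreconnected P
  nonempty : P.Nonempty
  subset : P ⊆ V
  disjoint : Disjoint P (starKernel V)
  sign : σ = 1 ∨ σ = -1
  ne_zero : x ≠ 0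
  lt_one : s < 1
  one_lt : 1 < t
  closure_inter : closure P ∩ V ⊆ P ∪ (fun r : ℝ => (r : ℂ) * x) '' Ioo s t
  gate_subset : (fun r : ℝ => (r : ℂ) * x) '' Ioo s t ⊆ V
  gate_closure : (fun r : ℝ => (r : ℂ) * x) '' Ioo s t ⊆ closure P
  gate_kernel : (fun r : ℝ => (r : ℂ) * x) '' Ioo s t ⊆ closure (starKernel V)
  one_sided : ∀ r ∈ Ioo s t, ∃ δ > 0, ∀ z ∈ Metric.ball ((r : ℂ) * x) δ,
    0 < σ * cross x z → z ∉ P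

theorem IsPocket.gate_disjoint {P : Set ℂ} {σ : ℝ} {x : ℂ} {s t : ℝ} (hP : IsPocket V P σ x s t)
    {r : ℝ} (hr : r ∈ Ioo s t) : (r : ℂ) * x ∉ P := fun h =>
  Set.disjoint_left.1 (hP.disjoint.closure_right hP.isOpen) h (hP.gate_kernel ⟨r, hr, rfl⟩)

/-- A connected subset of `V` meeting a pocket and avoiding its gate is contained in the pocket. -/
theorem IsPocket.subset_of_preconnected {P : Set ℂ} {σ : ℝ} {x : ℂ} {s t : ℝ}
    (hP : IsPocket V P σ x s t) {Q : Set ℂ} (hQ : IsPreconnected Q) (hQV : Q ⊆ V)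
    (hQg : ∀ r ∈ Ioo s t, (r : ℂ) * x ∉ Q) (hne : (Q ∩ P).Nonempty) : Q ⊆ P := by
  refine hQ.subset_of_closure_inter_subset hP.isOpen hne ?_
  rintro z ⟨hz, hzQ⟩
  rcases hP.closure_inter ⟨hz, hQV hzQ⟩ with h | ⟨r, hr, rfl⟩
  · exact h
  · exact absurd hzQ (hQg r hr)

theorem IsPocket.subset_of_inter_nonempty {P P' : Set ℂ} {σ σ' : ℝ} {x x' : ℂ} {s s' t t' : ℝ}
    (hP : IsPocket V P σ x s t) (hP' : IsPocket V P' σ' x' s' t') (hne : (P' ∩ P).Nonempty) :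
    P' ⊆ P := by
  refine hP.subset_of_preconnected hP'.preconnected hP'.subset (fun r hr hr' => ?_) hne
  exact Set.disjoint_left.1 (hP'.disjoint.closure_right hP'.isOpen) hr'
    (hP.gate_kernel ⟨r, hr, rfl⟩)

/-- Every point of `V` on the frontier of the star kernel lies on the gate of a pocket. -/
theorem IsInnerDomain.exists_pocket (h : IsInnerDomain Ω V) {x : ℂ} (hx : x ∈ V)
    (hxK : x ∉ starKernel V) (hxc : x ∈ closure (starKernel V)) :
    ∃ P σ s t, IsPocket V P σ x s t ∧ x ∈ closure (starKernel V ∩ {z | 0 < σ * cross x z}) ∧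
      ∀ ε > 0, Metric.ball x ε ⊆ V → ∀ z ∈ Metric.ball x ε, 0 < -σ * cross x z → z ∈ P := by
  obtain ⟨s, t, hs0, hs1, ht1, hsΩ, htΩ, hV⟩ := h.exists_fence hx hxK
  set K := starKernel V with hK
  have hx0 : x ≠ 0 := fun h0 => hxK (h0 ▸ zero_mem_starKernel h.zero_mem)
  have hxn : 0 < ‖x‖ := norm_pos_iff.2 hx0
  have hKo : IsOpen K := isOpen_starKernel h.isOpen
  have hKp : IsPreconnected K := isPreconnected_starKernel V
  have hKV : K ⊆ V := starKernel_subset V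
  have hsV : (s : ℂ) * x ∉ V := fun hV => h.subset_compl hV hsΩ
  have htV : (t : ℂ) * x ∉ V := fun hV => h.subset_compl hV htΩ
  have hgK : ∀ r ∈ Ioo s t, (r : ℂ) * x ∉ K := fun r hr hrK => by
    have hr0 : 0 < r := hs0.trans hr.1
    have := hKV (mul_mem_starKernel hrK (t := s / r)
      ⟨by positivity, (div_le_one hr0).2 hr.1.le⟩)
    rw [← mul_assoc, ← Complex.ofReal_mul, div_mul_cancel₀ _ hr0.ne'] at this
    exact hsV this
  obtain ⟨ε₀, hε₀, hball⟩ := Metric.isOpen_iff.1 h.isOpen x hx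
  -- the kernel accumulates at `x` from one of the two sides
  have hside : ∃ σ : ℝ, (σ = 1 ∨ σ = -1) ∧ x ∈ closure (K ∩ {z | 0 < σ * cross x z}) := by
    have hsub : x ∈ closure ((K ∩ {z | 0 < (1 : ℝ) * cross x z}) ∪
        (K ∩ {z | 0 < (-1 : ℝ) * cross x z})) := by
      rw [Metric.mem_closure_iff] at hxc ⊢
      intro ε hε
      set m := min ε (min ((1 - s) * ‖x‖) ((t - 1) * ‖x‖)) with hm
      have hm0 : 0 < m := lt_min hε (lt_min (mul_pos (by linarith) hxn) (mul_pos (by linarith) hxn))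
      obtain ⟨z, hzK, hz⟩ := hxc m hm0
      refine ⟨z, ?_, hz.trans_le (min_le_left _ _)⟩
      rcases lt_trichotomy (cross x z) 0 with hc | hc | hc
      · exact Or.inr ⟨hzK, by simpa using hc⟩
      · exfalso
        obtain ⟨r, hr, hr2⟩ := exists_smul_of_cross_eq_zero hx0 hc
        rw [dist_comm, dist_eq_norm, hr2] at hz
        have h1 : |r - 1| * ‖x‖ < (1 - s) * ‖x‖ :=
          hz.trans_le ((min_le_right _ _).trans (min_le_left _ _))
        have h2 : |r - 1| * ‖x‖ < (t - 1) * ‖x‖ :=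
          hz.trans_le ((min_le_right _ _).trans (min_le_right _ _))
        have h1 := lt_of_mul_lt_mul_right h1 hxn.le
        have h2 := lt_of_mul_lt_mul_right h2 hxn.le
        rw [abs_lt] at h1 h2
        exact hgK r ⟨by linarith, by linarith⟩ (hr ▸ hzK)
      · exact Or.inl ⟨hzK, by simpa using hc⟩
    rw [closure_union] at hsub
    rcases hsub with h1 | h1
    · exact ⟨1, Or.inl rfl, h1⟩
    · exact ⟨-1, Or.inr rfl, h1⟩
  obtain ⟨σ, hσ, hσx⟩ := hside
  have hσσ : σ * σ = 1 := by rcases hσ with rfl | rfl <;> norm_num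
  set g : ℝ → ℂ := fun r => (r : ℂ) * x with hg
  have hgc : Continuous g := by fun_prop
  set S : Set ℂ := g '' Ioo s t with hS
  set W : Set ℂ := V \ (g '' Icc s t) with hW
  have hWo : IsOpen W := h.isOpen.sdiff (isCompact_Icc.image hgc).isClosed
  have hWV : W ⊆ V := sdiff_subset
  have hcross_g : ∀ r, cross x (g r) = 0 := fun r => by simp [hg, cross]; ring
  have hmemW : ∀ z ∈ V, z ∉ S → z ∈ W := by
    rintro z hzV hzS
    refine ⟨hzV, ?_⟩
    rintro ⟨r, hr, rfl⟩
    rcases hr.1.eq_or_lt with rfl | h1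
    · exact hsV hzV
    rcases hr.2.eq_or_lt with rfl | h2
    · exact htV hzV
    exact hzS ⟨r, ⟨h1, h2⟩, rfl⟩
  have hmemW' : ∀ z ∈ V, cross x z ≠ 0 → z ∈ W := fun z hzV hz => hmemW z hzV fun ⟨r, _, hr⟩ =>
    hz (hr ▸ hcross_g r)
  have hWS : ∀ r ∈ Ioo s t, g r ∉ W := fun r hr hW => hW.2 ⟨r, Ioo_subset_Icc_self hr, rfl⟩
  -- a base point on the other side
  obtain ⟨c, hc0, hcε⟩ : ∃ c : ℝ, 0 < c ∧ c * ‖x‖ < ε₀ :=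
    ⟨ε₀ / ‖x‖ / 2, by positivity, by field_simp; linarith⟩
  have hpt : ∀ r d : ℝ, dist ((r : ℂ) * x - ((σ * d : ℝ) : ℂ) * (Complex.I * x)) ((r : ℂ) * x) =
      |d| * ‖x‖ := fun r d => by
    rw [dist_eq_norm, sub_sub_cancel_left, norm_neg, norm_mul, norm_mul, Complex.norm_I,
      Complex.norm_real, one_mul, Real.norm_eq_abs, abs_mul]
    rcases hσ with rfl | rfl <;> simp
  have hptc : ∀ r d : ℝ, -σ * cross x ((r : ℂ) * x - ((σ * d : ℝ) : ℂ) * (Complex.I * x)) =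
      d * Complex.normSq x := fun r d => by
    simp [cross, Complex.normSq_apply]
    linear_combination (d * (x.re * x.re + x.im * x.im)) * hσσ
  have hnx : 0 < Complex.normSq x := Complex.normSq_pos.2 hx0
  set z₀ : ℂ := ((1 : ℝ) : ℂ) * x - ((σ * c : ℝ) : ℂ) * (Complex.I * x) with hz₀
  have hz₀b : z₀ ∈ Metric.ball x ε₀ := by
    have := hpt 1 c
    rw [Complex.ofReal_one, one_mul, abs_of_pos hc0] at this
    rw [Metric.mem_ball, hz₀, Complex.ofReal_one, one_mul, this]
    exact hcε
  have hz₀c : 0 < -σ * cross x z₀ := by rw [hz₀, hptc]; positivity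
  have hneσ : ∀ z, 0 < -σ * cross x z → cross x z ≠ 0 := fun z hz h0 => by simp [h0] at hz
  have hz₀W : z₀ ∈ W := hmemW' z₀ (hball hz₀b) (hneσ _ hz₀c)
  set P := connectedComponentIn W z₀ with hP
  have hPo : IsOpen P := hWo.connectedComponentIn
  have hPp : IsPreconnected P := isPreconnected_connectedComponentIn
  have hPW : P ⊆ W := connectedComponentIn_subset W z₀
  have hz₀P : z₀ ∈ P := mem_connectedComponentIn hz₀W
  -- connected sets on the other side, meeting the pocket
  have hgrow : ∀ Q : Set ℂ, IsPreconnected Q → Q ⊆ W → (Q ∩ P).Nonempty → Q ⊆ P := by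
    rintro Q hQ hQW ⟨y, hyQ, hyP⟩
    have : connectedComponentIn W y = P := (connectedComponentIn_eq hyP).symm
    rw [← this]
    exact hQ.subset_connectedComponentIn hyQ hQW
  have hconv : ∀ U : Set ℂ, Convex ℝ U → U ⊆ V → (U ∩ {z | 0 < -σ * cross x z} ∩ P).Nonempty →
      U ∩ {z | 0 < -σ * cross x z} ⊆ P := fun U hU hUV hne =>
    hgrow _ (hU.inter (convex_side _ x)).isPreconnected
      (fun z hz => hmemW' z (hUV hz.1) (hneσ z hz.2)) hne
  have hb0 : Metric.ball x ε₀ ∩ {z | 0 < -σ * cross x z} ⊆ P :=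
    hconv _ (convex_ball _ _) hball ⟨z₀, ⟨hz₀b, hz₀c⟩, hz₀P⟩
  have hballP : ∀ ε > 0, Metric.ball x ε ⊆ V → ∀ z ∈ Metric.ball x ε, 0 < -σ * cross x z →
      z ∈ P := by
    intro ε hε hεV z hz hzσ
    refine hconv _ (convex_ball x ε) hεV ?_ ⟨hz, hzσ⟩
    obtain ⟨d, hd0, hd⟩ : ∃ d : ℝ, 0 < d ∧ d * ‖x‖ < min ε ε₀ := by
      have : 0 < min ε ε₀ := lt_min hε hε₀
      exact ⟨min ε ε₀ / ‖x‖ / 2, by positivity, by field_simp; linarith⟩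
    have h1 := hpt 1 d
    have h2 := hptc 1 d
    rw [Complex.ofReal_one, one_mul] at h1 h2
    rw [abs_of_pos hd0] at h1
    have h3 : 0 < -σ * cross x (x - ((σ * d : ℝ) : ℂ) * (Complex.I * x)) := by rw [h2]; positivity
    refine ⟨_, ⟨?_, h3⟩, hb0 ⟨?_, h3⟩⟩
    · rw [Metric.mem_ball, h1]; exact hd.trans_le (min_le_left _ _)
    · rw [Metric.mem_ball, h1]; exact hd.trans_le (min_le_right _ _)
  -- a convex neighbourhood of the part of the gate between `x` and another of its points
  have hthick : ∀ r ∈ Ioo s t, ∃ δ > 0, Metric.thickening δ (segment ℝ x (g r)) ⊆ V := by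
    intro r hr
    have hsc : IsCompact (segment ℝ x (g r)) := by
      rw [segment_eq_image_lineMap]
      exact isCompact_Icc.image (by fun_prop)
    obtain ⟨δ, hδ, hδV⟩ := hsc.exists_thickening_subset_open h.isOpen (by
      rw [segment_eq_image']
      rintro _ ⟨u, hu, rfl⟩
      have : x + u • (g r - x) = g (1 + u * (r - 1)) := by simp [hg]; ring
      simp only [this]
      have hmem := (convex_Ioo s t) (x := 1) ⟨hs1, ht1⟩ hr (sub_nonneg.2 hu.2) hu.1
        (sub_add_cancel 1 u)
      have heq : (1 - u) • (1 : ℝ) + u • r = 1 + u * (r - 1) := by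
        simp only [smul_eq_mul]; ring
      exact hV _ (heq ▸ hmem))
    exact ⟨δ, hδ, hδV⟩
  have hgateP : ∀ r ∈ Ioo s t, ∃ δ > 0, Metric.ball (g r) δ ⊆ V ∧
      ∀ z ∈ Metric.ball (g r) δ, 0 < -σ * cross x z → z ∈ P := by
    intro r hr
    obtain ⟨δ, hδ, hδV⟩ := hthick r hr
    have hbt : ∀ y ∈ segment ℝ x (g r), Metric.ball y δ ⊆ Metric.thickening δ (segment ℝ x (g r)) :=
      fun y hy => Metric.ball_subset_thickening hy δ
    refine ⟨δ, hδ, (hbt _ (right_mem_segment _ _ _)).trans hδV, fun z hz hzσ => ?_⟩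
    refine hconv _ ((convex_segment x (g r)).thickening δ) hδV ?_
      ⟨hbt _ (right_mem_segment _ _ _) hz, hzσ⟩
    obtain ⟨d, hd0, hd⟩ : ∃ d : ℝ, 0 < d ∧ d * ‖x‖ < min δ ε₀ := by
      have : 0 < min δ ε₀ := lt_min hδ hε₀
      exact ⟨min δ ε₀ / ‖x‖ / 2, by positivity, by field_simp; linarith⟩
    have h1 := hpt 1 d
    have h2 := hptc 1 d
    rw [Complex.ofReal_one, one_mul] at h1 h2
    rw [abs_of_pos hd0] at h1
    have h3 : 0 < -σ * cross x (x - ((σ * d : ℝ) : ℂ) * (Complex.I * x)) := by rw [h2]; positivity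
    refine ⟨_, ⟨hbt _ (left_mem_segment _ _ _) ?_, h3⟩, hb0 ⟨?_, h3⟩⟩
    · rw [Metric.mem_ball, h1]; exact hd.trans_le (min_le_left _ _)
    · rw [Metric.mem_ball, h1]; exact hd.trans_le (min_le_right _ _)
  have hgate_closure : S ⊆ closure (P ∩ {z | 0 < -σ * cross x z}) := by
    rintro _ ⟨r, hr, rfl⟩
    obtain ⟨δ, hδ, -, hδP⟩ := hgateP r hr
    rw [Metric.mem_closure_iff]
    intro ε hε
    obtain ⟨d, hd0, hd⟩ : ∃ d : ℝ, 0 < d ∧ d * ‖x‖ < min δ ε := by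
      have : 0 < min δ ε := lt_min hδ hε
      exact ⟨min δ ε / ‖x‖ / 2, by positivity, by field_simp; linarith⟩
    have h1 := hpt r d
    have h2 := hptc r d
    rw [abs_of_pos hd0] at h1
    have h3 : 0 < -σ * cross x ((r : ℂ) * x - ((σ * d : ℝ) : ℂ) * (Complex.I * x)) := by
      rw [h2]; positivity
    refine ⟨_, ⟨hδP _ ?_ h3, h3⟩, ?_⟩
    · rw [Metric.mem_ball, h1]; exact hd.trans_le (min_le_left _ _)
    · rw [dist_comm, h1]; exact hd.trans_le (min_le_right _ _)
  have hgate_kernel : S ⊆ closure K := by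
    rintro _ ⟨r, hr, rfl⟩
    have hr0 : 0 < r := hs0.trans hr.1
    obtain ⟨δ, hδ, hδV⟩ := hthick r hr
    rw [Metric.mem_closure_iff] at hxc ⊢
    intro ε hε
    set m := min (ε / r) (min δ (δ / r)) with hm
    have hm0 : 0 < m := by positivity
    obtain ⟨z, hzK, hz⟩ := hxc m hm0
    have hzε : dist x z < ε / r := hz.trans_le (min_le_left _ _)
    have hzδ : dist x z < δ := hz.trans_le ((min_le_right _ _).trans (min_le_left _ _))
    have hzδ' : dist x z < δ / r := hz.trans_le ((min_le_right _ _).trans (min_le_right _ _))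
    have hdist : ∀ u : ℝ, 0 < u → dist (g u) ((u : ℂ) * z) = u * dist x z := fun u hu => by
      rw [dist_eq_norm, dist_eq_norm, hg, ← mul_sub, norm_mul, Complex.norm_real,
        Real.norm_of_nonneg hu.le]
    refine ⟨(r : ℂ) * z, fun u hu => ?_, ?_⟩
    · rw [← mul_assoc, ← Complex.ofReal_mul]
      rcases le_or_gt (u * r) 1 with h1 | h1
      · exact hzK _ ⟨mul_nonneg hu.1 hr0.le, h1⟩
      · have hur : u * r ≤ r := by nlinarith [hu.2]
        have hr1 : 1 < r := h1.trans_le hur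
        refine hδV (Metric.mem_thickening_iff.2 ⟨g (u * r), ?_, ?_⟩)
        · rw [segment_eq_image']
          refine ⟨(u * r - 1) / (r - 1), ⟨div_nonneg (by linarith) (by linarith),
            (div_le_one (by linarith)).2 (by linarith)⟩, ?_⟩
          have hne : (r - 1 : ℂ) ≠ 0 := by
            have : (r - 1 : ℝ) ≠ 0 := by linarith
            exact_mod_cast this
          simp only [hg, Complex.real_smul]
          push_cast
          field_simp
          ring
        · rw [dist_comm, hdist _ (by linarith)]
          calc u * r * dist x z ≤ r * dist x z := by gcongr
            _ < δ := by rwa [lt_div_iff₀' hr0] at hzδ'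
    · rw [hdist r hr0]
      rwa [lt_div_iff₀' hr0] at hzε
  have hgP : ∀ r ∈ Ioo s t, (r : ℂ) * x ∉ P := fun r hr hrP => hWS r hr (hPW hrP)
  have hone : ∀ r ∈ Ioo s t, ∃ δ > 0, ∀ z ∈ Metric.ball ((r : ℂ) * x) δ,
      0 < σ * cross x z → z ∉ P := by
    intro r hr
    have hr0 : 0 < r := hs0.trans hr.1
    obtain ⟨δ, hδ, hδV, hδP⟩ := hgateP r hr
    refine ⟨δ, hδ, fun z hz hzσ hzP => ?_⟩
    obtain ⟨y, hyP, hyd⟩ := Metric.mem_closure_iff.1 (hgate_closure ⟨r, hr, rfl⟩) δ hδ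
    refine h.false_of_crossing hPo hPp (hPW.trans hWV) (convex_ball (g r) δ) hδV (x := g r)
      (s := s / r) (t := t / r) (by rw [div_lt_one hr0]; exact hr.1)
      (by rw [one_lt_div hr0]; exact hr.2) ?_ ?_ ?_ (Metric.mem_ball_self hδ) (σ := σ) hzP hyP.1
      hz (by rwa [Metric.mem_ball, dist_comm]) ?_ ?_
    · have : ((s / r : ℝ) : ℂ) * g r = s * x := by
        rw [hg, ← mul_assoc, ← Complex.ofReal_mul, div_mul_cancel₀ _ hr0.ne']
      rwa [this]
    · have : ((t / r : ℝ) : ℂ) * g r = t * x := by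
        rw [hg, ← mul_assoc, ← Complex.ofReal_mul, div_mul_cancel₀ _ hr0.ne']
      rwa [this]
    · intro u hu
      rw [hg, ← mul_assoc, ← Complex.ofReal_mul]
      refine hgP _ ⟨?_, ?_⟩
      · have := hu.1; rwa [div_lt_iff₀ hr0] at this
      · have := hu.2; rwa [lt_div_iff₀ hr0] at this
    · rw [hg, cross_smul_left]
      have := mul_pos hr0 hzσ
      linarith
    · have h1 : 0 < -σ * cross x y := hyP.2
      rw [hg, cross_smul_left]
      have := mul_pos hr0 h1
      linarith
  have hdisj : Disjoint P K := by
    rw [Set.disjoint_left]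
    intro y hyP hyK
    have hKP : K ⊆ P := hgrow K hKp (fun z hz => hmemW z (hKV hz) (fun ⟨r, hr, hrz⟩ =>
      hgK r hr (show g r ∈ K from hrz ▸ hz))) ⟨y, hyK, hyP⟩
    obtain ⟨δ, hδ, hδP⟩ := hone 1 ⟨hs1, ht1⟩
    obtain ⟨z, hz, hzd⟩ := Metric.mem_closure_iff.1 hσx δ hδ
    refine hδP z ?_ hz.2 (hKP hz.1)
    rwa [Complex.ofReal_one, one_mul, Metric.mem_ball, dist_comm]
  refine ⟨P, σ, s, t, ⟨hPo, hPp, ⟨z₀, hz₀P⟩, hPW.trans hWV, hdisj, hσ, hx0, hs1, ht1, ?_, ?_,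
    hgate_closure.trans (closure_mono inter_subset_left), hgate_kernel, hone⟩, hσx, hballP⟩
  · rintro y ⟨hyc, hyV⟩
    by_cases hyS : y ∈ S
    · exact Or.inr hyS
    · refine Or.inl ?_
      obtain ⟨δ, hδ, hδW⟩ := Metric.isOpen_iff.1 hWo y (hmemW y hyV hyS)
      obtain ⟨w, hwP, hw⟩ := Metric.mem_closure_iff.1 hyc δ hδ
      exact hgrow _ (convex_ball y δ).isPreconnected hδW
        ⟨w, by rwa [Metric.mem_ball, dist_comm], hwP⟩ (Metric.mem_ball_self hδ)
  · rintro _ ⟨r, hr, rfl⟩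
    exact hV r hr

end

/-! ### Area-preserving twist maps: invariant domains are star-shaped -/

section

variable {Ω V : Set ℂ}

/-- If the star kernel is not the whole domain, there is a pocket. -/
theorem IsInnerDomain.exists_pocket_of_ne (h : IsInnerDomain Ω V) (hne : ¬ V ⊆ starKernel V) :
    ∃ P σ x s t, IsPocket V P σ x s t := by
  have hKo : IsOpen (starKernel V) := isOpen_starKernel h.isOpen
  have : ¬ closure (starKernel V) ∩ V ⊆ starKernel V := fun hcon => hne
    (h.preconnected.subset_of_closure_inter_subset hKo
      ⟨0, h.zero_mem, zero_mem_starKernel h.zero_mem⟩ hcon)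
  obtain ⟨x, ⟨hxc, hxV⟩, hxK⟩ := not_subset.1 this
  obtain ⟨P, σ, s, t, hP, -⟩ := h.exists_pocket hxV hxK hxc
  exact ⟨P, σ, x, s, t, hP⟩

/-- Connected open subsets of `V` disjoint from the star kernel are contained in pockets. -/
theorem IsInnerDomain.exists_pocket_superset (h : IsInnerDomain Ω V) {C : Set ℂ} (hCo : IsOpen C)
    (hC : IsPreconnected C) (hne : C.Nonempty) (hCV : C ⊆ V) (hCK : Disjoint C (starKernel V)) :
    ∃ P σ x s t, IsPocket V P σ x s t ∧ C ⊆ P := by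
  set K := starKernel V with hK
  have hKo : IsOpen K := isOpen_starKernel h.isOpen
  have hKV : K ⊆ V := starKernel_subset V
  obtain ⟨y, hy⟩ := hne
  have hCK' : Disjoint C (closure K) := hCK.closure_right hCo
  set W : Set ℂ := V \ closure K with hW
  have hWo : IsOpen W := h.isOpen.sdiff isClosed_closure
  have hCW : C ⊆ W := fun z hz => ⟨hCV hz, Set.disjoint_left.1 hCK' hz⟩
  set D := connectedComponentIn W y with hD
  have hDo : IsOpen D := hWo.connectedComponentIn
  have hDp : IsPreconnected D := isPreconnected_connectedComponentIn
  have hDW : D ⊆ W := connectedComponentIn_subset W y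
  have hCD : C ⊆ D := hC.subset_connectedComponentIn hy hCW
  have hKD : Disjoint K D := by
    rw [Set.disjoint_left]
    exact fun z hz hzD => (hDW hzD).2 (subset_closure hz)
  have hnot : ¬ closure D ∩ V ⊆ D := fun hcon => by
    have := h.preconnected.subset_of_closure_inter_subset hDo ⟨y, hCV hy, hCD hy⟩ hcon
    exact Set.disjoint_left.1 hKD (zero_mem_starKernel h.zero_mem) (this h.zero_mem)
  obtain ⟨x, ⟨hxD, hxV⟩, hxnD⟩ := not_subset.1 hnot
  have hxc : x ∈ closure K := by
    by_contra hcon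
    obtain ⟨ε, hε, hεW⟩ := Metric.isOpen_iff.1 hWo x ⟨hxV, hcon⟩
    obtain ⟨w, hwD, hw⟩ := Metric.mem_closure_iff.1 hxD ε hε
    have heq : connectedComponentIn W w = D := (connectedComponentIn_eq hwD).symm
    refine hxnD (heq ▸ (convex_ball x ε).isPreconnected.subset_connectedComponentIn ?_ hεW
      (Metric.mem_ball_self hε))
    rwa [Metric.mem_ball, dist_comm]
  have hxK : x ∉ K := fun hxK =>
    Set.disjoint_left.1 (hKD.closure_right hKo) hxK hxD
  obtain ⟨P, σ, s, t, hP, hσx, hball⟩ := h.exists_pocket hxV hxK hxc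
  refine ⟨P, σ, x, s, t, hP, hCD.trans ?_⟩
  obtain ⟨ε, hε, hεV⟩ := Metric.isOpen_iff.1 h.isOpen x hxV
  have hDg : ∀ r ∈ Ioo s t, (r : ℂ) * x ∉ D := fun r hr hrD =>
    (hDW hrD).2 (hP.gate_kernel ⟨r, hr, rfl⟩)
  refine hP.subset_of_preconnected hDp (hDW.trans sdiff_subset) hDg ?_
  -- a kernel point `k` on the kernel side of the gate
  obtain ⟨k, ⟨hkK, hkσ⟩, hk⟩ := Metric.mem_closure_iff.1 hσx ε hε
  have hkσ : 0 < σ * cross x k := hkσ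
  rw [dist_comm] at hk
  -- a point `z` of `D` so close to the gate that `k` is still on the same side of its ray
  have hcont : ContinuousAt (fun z => σ * cross z k) x := by
    have : Continuous fun z => σ * cross z k := by unfold cross; fun_prop
    exact this.continuousAt
  have hev : ∀ᶠ z in 𝓝 x, 0 < σ * cross z k := hcont.eventually (lt_mem_nhds hkσ)
  have hgate : ∀ᶠ z in 𝓝 x, cross x z = 0 → z ∈ (fun r : ℝ => (r : ℂ) * x) '' Ioo s t := by
    have hxn : 0 < ‖x‖ := norm_pos_iff.2 hP.ne_zero
    have hm : 0 < min ((1 - s) * ‖x‖) ((t - 1) * ‖x‖) :=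
      lt_min (mul_pos (by linarith [hP.lt_one]) hxn) (mul_pos (by linarith [hP.one_lt]) hxn)
    filter_upwards [Metric.ball_mem_nhds x hm] with z hz hc
    obtain ⟨r, hr, hr2⟩ := exists_smul_of_cross_eq_zero hP.ne_zero hc
    rw [Metric.mem_ball, dist_eq_norm, hr2] at hz
    have h1 := lt_of_mul_lt_mul_right (hz.trans_le (min_le_left _ _)) hxn.le
    have h2 := lt_of_mul_lt_mul_right (hz.trans_le (min_le_right _ _)) hxn.le
    rw [abs_lt] at h1 h2
    exact ⟨r, ⟨by linarith, by linarith⟩, hr.symm⟩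
  obtain ⟨z, ⟨⟨hz1, hz2⟩, hz3⟩, hzD⟩ := mem_closure_iff_nhds.1 hxD _
    (inter_mem (inter_mem hev hgate) (Metric.ball_mem_nhds x hε))
  have hz1 : 0 < σ * cross z k := hz1
  have hz2 : cross x z = 0 → z ∈ (fun r : ℝ => (r : ℂ) * x) '' Ioo s t := hz2
  have hzV : z ∈ V := (hDW hzD).1
  have hzK : z ∉ K := fun hzK => Set.disjoint_left.1 hKD hzK hzD
  have hzc : cross x z ≠ 0 := fun h0 => by
    obtain ⟨r, hr, hrz⟩ := hz2 h0
    have hrz : (r : ℂ) * x = z := hrz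
    exact hDg r hr (hrz ▸ hzD)
  have hσ0 : σ ≠ 0 := by rcases hP.sign with h | h <;> rw [h] <;> norm_num
  rcases lt_or_gt_of_ne (mul_ne_zero hσ0 hzc) with hzσ | hzσ
  · exact ⟨z, hzD, hball ε hε hεV z hz3 (by linarith)⟩
  · exfalso
    -- otherwise the kernel touches the radial segment through `z` from both sides
    have hcont2 : ∀ᶠ w in 𝓝 x, σ * cross z w < 0 := by
      have : Continuous fun w => σ * cross z w := continuous_const.mul (continuous_cross z)
      refine this.continuousAt.eventually (gt_mem_nhds ?_)
      show σ * cross z x < 0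
      rw [cross_swap]; linarith
    obtain ⟨k', ⟨hk'1, hk'2⟩, hk'K⟩ := mem_closure_iff_nhds.1 hxc _
      (inter_mem hcont2 (Metric.ball_mem_nhds x hε))
    have hk'1 : σ * cross z k' < 0 := hk'1
    obtain ⟨s', t', hs0', hs', ht', hsΩ', htΩ', hV'⟩ := h.exists_fence hzV hzK
    refine h.false_of_crossing hKo (isPreconnected_starKernel V) hKV (convex_ball x ε) hεV
      hs' ht' hsΩ' htΩ' ?_ hz3 hkK hk'K hk hk'2 hz1 hk'1
    intro r hr hrK
    have hr0 : 0 < r := hs0'.trans hr.1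
    have := hKV (mul_mem_starKernel hrK (t := s' / r) ⟨by positivity, (div_le_one hr0).2 hr.1.le⟩)
    rw [← mul_assoc, ← Complex.ofReal_mul, div_mul_cancel₀ _ hr0.ne'] at this
    exact h.subset_compl this hsΩ'

/-- The tilting argument: if `g` turns radial directions to the side from which the star kernel
touches the gate of `P`, then radial paths starting at the origin are mapped by `g` to paths that
cannot enter `P`. -/
theorem IsPocket.preimage_disjoint {P : Set ℂ} {σ : ℝ} {x : ℂ} {s t : ℝ}
    (hP : IsPocket V P σ x s t) (hV : IsOpen V) (h0 : (0 : ℂ) ∈ V) (g : ℂ ≃ₜ ℂ) (hgV : g '' V = V)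
    (hg0 : g 0 = 0)
    (htwist : ∀ w ≠ 0, ∀ l : ℝ, 1 < l → 0 < σ * cross (g w) (g ((l : ℂ) * w))) :
    Disjoint (g ⁻¹' P) (starKernel V) := by
  rw [Set.disjoint_right]
  intro q hqK hqP
  have hcont : Continuous fun t : ℝ => g ((t : ℂ) * q) := g.continuous.comp (by fun_prop)
  have h0K : (0 : ℂ) ∈ starKernel V := zero_mem_starKernel h0
  have h0P : (0 : ℂ) ∉ P := fun h => Set.disjoint_left.1 hP.disjoint h h0K
  set E : Set ℝ := Icc 0 1 ∩ (fun t : ℝ => g ((t : ℂ) * q)) ⁻¹' Pᶜ with hE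
  have hEc : IsCompact E := isCompact_Icc.inter_right (hP.isOpen.isClosed_compl.preimage hcont)
  have hEne : E.Nonempty := ⟨0, by simp, by simpa [hg0] using h0P⟩
  obtain ⟨u, huE, humax⟩ := hEc.exists_isGreatest hEne
  have hu1 : u < 1 := lt_of_le_of_ne huE.1.2 fun h1 => huE.2 (by simpa [h1] using hqP)
  have hup : ∀ r ∈ Ioc u 1, g ((r : ℂ) * q) ∈ P := fun r hr => by
    by_contra hcon
    exact absurd (humax ⟨⟨huE.1.1.trans hr.1.le, hr.2⟩, hcon⟩) (not_le.2 hr.1)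
  have hu0 : 0 < u := by
    refine lt_of_le_of_ne huE.1.1 fun h1 => ?_
    have hev : ∀ᶠ r : ℝ in 𝓝[>] 0, g ((r : ℂ) * q) ∈ starKernel V := by
      have : Tendsto (fun t : ℝ => g ((t : ℂ) * q)) (𝓝[>] 0) (𝓝 0) := by
        have := hcont.tendsto 0
        simp only [Complex.ofReal_zero, zero_mul, hg0] at this
        exact this.mono_left nhdsWithin_le_nhds
      exact this.eventually_mem ((isOpen_starKernel hV).mem_nhds h0K)
    obtain ⟨r, hr, hr1⟩ := (hev.and (Ioc_mem_nhdsGT (zero_lt_one' ℝ))).exists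
    exact Set.disjoint_left.1 hP.disjoint (hup r (h1 ▸ hr1)) hr
  have hq0 : q ≠ 0 := fun h => h0P (by simpa [h, hg0] using hqP)
  have hyV : g ((u : ℂ) * q) ∈ V := by
    rw [← hgV]
    exact ⟨_, hqK u huE.1, rfl⟩
  have hlim : Tendsto (fun t : ℝ => g ((t : ℂ) * q)) (𝓝[>] u) (𝓝 (g ((u : ℂ) * q))) :=
    (hcont.tendsto u).mono_left nhdsWithin_le_nhds
  have hyc : g ((u : ℂ) * q) ∈ closure P := by
    refine mem_closure_of_tendsto hlim ?_
    filter_upwards [Ioc_mem_nhdsGT hu1] with r hr using hup r hr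
  rcases hP.closure_inter ⟨hyc, hyV⟩ with hy | ⟨r, hr, hry⟩
  · exact huE.2 hy
  · obtain ⟨δ, hδ, hδP⟩ := hP.one_sided r hr
    have hry : (r : ℂ) * x = g ((u : ℂ) * q) := hry
    rw [hry] at hδP
    obtain ⟨v, ⟨hv1, hv2⟩, hv3⟩ := ((hlim.eventually_mem (Metric.ball_mem_nhds _ hδ)).and
      (Ioc_mem_nhdsGT hu1)).and self_mem_nhdsWithin |>.exists
    have hv3 : u < v := hv3
    have htw := htwist ((u : ℂ) * q) (mul_ne_zero (by exact_mod_cast hu0.ne') hq0) (v / u)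
      ((one_lt_div hu0).2 hv3)
    rw [← mul_assoc, ← Complex.ofReal_mul, div_mul_cancel₀ _ hu0.ne', ← hry,
      cross_smul_left] at htw
    -- the gate has positive radial coordinates, since it avoids the star kernel
    have hr0 : 0 < r := by
      by_contra hr0
      have hmem : (0 : ℝ) ∈ Ico r t := ⟨not_lt.1 hr0, by linarith [hP.one_lt]⟩
      rcases hmem.1.eq_or_lt with h1 | h1
      · have h2 := hP.gate_kernel ⟨r, hr, rfl⟩
        have hev : (0 : ℂ) ∈ P := by
          exfalso
          have := hP.gate_closure ⟨r, hr, rfl⟩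
          have h3 : (0 : ℂ) ∈ closure P := by simpa [h1] using this
          exact Set.disjoint_left.1 (hP.disjoint.symm.closure_right (isOpen_starKernel hV)) h0K h3
        exact h0P hev
      · have h3 : (0 : ℂ) ∈ closure P := by
          have := hP.gate_closure ⟨0, ⟨hr.1.trans h1, hmem.2⟩, rfl⟩
          simpa using this
        exact Set.disjoint_left.1 (hP.disjoint.symm.closure_right (isOpen_starKernel hV)) h0K h3
    refine hδP _ hv1 ?_ (hup v hv2)
    by_contra hcon
    have : r * (σ * cross x (g ((v : ℂ) * q))) ≤ 0 :=
      mul_nonpos_of_nonneg_of_nonpos hr0.le (not_lt.1 hcon)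
    linarith

/-- A pocket of largest area cannot be mapped into the complement of the star kernel by the inverse
of an area preserving homeomorphism that tilts radial directions. -/
theorem IsPocket.false_of_max (h : IsInnerDomain Ω V) {P : Set ℂ} {σ : ℝ} {x : ℂ} {s t : ℝ}
    (hP : IsPocket V P σ x s t)
    (hmax : ∀ P' σ' x' s' t', IsPocket V P' σ' x' s' t' → volume P' ≤ volume P)
    (g : ℂ ≃ₜ ℂ) (hgV : g '' V = V) (hg0 : g 0 = 0)
    (hvol : ∀ A : Set ℂ, IsOpen A → A ⊆ V → volume (g ⁻¹' A) = volume A)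
    (htwist : ∀ w ≠ 0, ∀ l : ℝ, 1 < l → 0 < σ * cross (g w) (g ((l : ℂ) * w))) : False := by
  have hgV' : g ⁻¹' V = V := by
    conv_lhs => rw [← hgV]
    exact preimage_image_eq _ g.injective
  set Q : Set ℂ := g ⁻¹' P with hQ
  have hQo : IsOpen Q := hP.isOpen.preimage g.continuous
  have hQp : IsPreconnected Q := by
    have := hP.preconnected.image g.symm g.symm.continuous.continuousOn
    rwa [Homeomorph.image_symm] at this
  have hQne : Q.Nonempty := hP.nonempty.preimage g.surjective
  have hQV : Q ⊆ V := hgV' ▸ preimage_mono hP.subset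
  obtain ⟨P', σ', x', s', t', hP', hQP'⟩ := h.exists_pocket_superset hQo hQp hQne hQV
    (hP.preimage_disjoint h.isOpen h.zero_mem g hgV hg0 htwist)
  have hfin : volume P' ≠ ⊤ :=
    (measure_mono hP'.subset).trans_lt h.bounded.measure_lt_top |>.ne
  have hvolQ : volume Q = volume P := hvol P hP.isOpen hP.subset
  have hnull : volume (P' \ Q) = 0 := by
    rw [measure_sdiff hQP' hQo.measurableSet.nullMeasurableSet
      (ne_top_of_le_ne_top hfin (measure_mono hQP')), hvolQ]
    exact tsub_eq_zero_of_le (hmax _ _ _ _ _ hP')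
  have hclQ : closure Q = g ⁻¹' closure P := (g.preimage_closure P).symm
  -- `P'` cannot be larger than `Q`: near a boundary point of `Q` in `P'`, one side is not in `Q`
  have hP'Q : P' ⊆ Q := by
    by_contra hcon
    have : ¬ closure Q ∩ P' ⊆ Q := fun hc => hcon
      (hP'.preconnected.subset_of_closure_inter_subset hQo
        (hQne.mono fun z hz => ⟨hQP' hz, hz⟩) hc)
    obtain ⟨w, ⟨hwc, hwP'⟩, hwQ⟩ := not_subset.1 this
    rw [hclQ] at hwc
    have hgwV : g w ∈ V := by rw [← hgV]; exact ⟨w, hP'.subset hwP', rfl⟩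
    rcases hP.closure_inter ⟨hwc, hgwV⟩ with hy | ⟨r, hr, hry⟩
    · exact hwQ hy
    have hry : (r : ℂ) * x = g w := hry
    obtain ⟨δ, hδ, hδP⟩ := hP.one_sided r hr
    set O : Set ℂ := Metric.ball ((r : ℂ) * x) δ ∩ {z | 0 < σ * cross x z} with hO
    have hOo : IsOpen O := Metric.isOpen_ball.inter
      (isOpen_lt continuous_const (continuous_const.mul (continuous_cross x)))
    have hwO : g w ∈ closure O := by
      rw [← hry]
      have hlim : Tendsto (fun d : ℝ => (r : ℂ) * x + ((σ * d : ℝ) : ℂ) * (Complex.I * x)) (𝓝[>] 0)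
          (𝓝 ((r : ℂ) * x)) := by
        have : Continuous fun d : ℝ => (r : ℂ) * x + ((σ * d : ℝ) : ℂ) * (Complex.I * x) := by
          fun_prop
        have h2 := this.tendsto 0
        simp only [mul_zero, Complex.ofReal_zero, zero_mul, add_zero] at h2
        exact h2.mono_left nhdsWithin_le_nhds
      refine mem_closure_of_tendsto hlim ?_
      filter_upwards [hlim.eventually_mem (Metric.ball_mem_nhds _ hδ), self_mem_nhdsWithin]
        with d hd hd0
      refine ⟨hd, ?_⟩
      have hd0 : 0 < d := hd0
      have hσσ : σ * σ = 1 := by rcases hP.sign with h | h <;> rw [h] <;> norm_num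
      have hval : σ * cross x ((r : ℂ) * x + ((σ * d : ℝ) : ℂ) * (Complex.I * x)) =
          d * Complex.normSq x := by
        simp [cross, Complex.normSq_apply]
        linear_combination (d * (x.re * x.re + x.im * x.im)) * hσσ
      have := Complex.normSq_pos.2 hP.ne_zero
      show 0 < σ * cross x _
      rw [hval]
      positivity
    have hwO' : w ∈ closure (g ⁻¹' O) := by rw [← g.preimage_closure]; exact hwO
    have hne : (g ⁻¹' O ∩ P').Nonempty := by
      obtain ⟨y, hy1, hy2⟩ := mem_closure_iff.1 hwO' P' hP'.isOpen hwP'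
      exact ⟨y, hy2, hy1⟩
    have hpos := ((hOo.preimage g.continuous).inter hP'.isOpen).measure_pos volume hne
    have hsub : g ⁻¹' O ∩ P' ⊆ P' \ Q := fun y hy => ⟨hy.2, fun hyQ => hδP _ hy.1.1 hy.1.2 hyQ⟩
    exact absurd (measure_mono_null hsub hnull) hpos.ne'
  have hQeq : Q = P' := hQP'.antisymm hP'Q
  -- hence `g` maps the gate of `P'` into the gate of `P`, although it tilts radial directions
  have hgate : ∀ r ∈ Ioo s' t', ∃ u ∈ Ioo s t, (u : ℂ) * x = g ((r : ℂ) * x') := by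
    intro r hr
    have h1 : (r : ℂ) * x' ∈ closure Q := hQeq ▸ hP'.gate_closure ⟨r, hr, rfl⟩
    have h2 : (r : ℂ) * x' ∈ V := hP'.gate_subset ⟨r, hr, rfl⟩
    have h3 : (r : ℂ) * x' ∉ Q := hQeq ▸ hP'.gate_disjoint hr
    rw [hclQ] at h1
    have h4 : g ((r : ℂ) * x') ∈ V := by rw [← hgV]; exact ⟨_, h2, rfl⟩
    rcases hP.closure_inter ⟨h1, h4⟩ with hy | ⟨u, hu, huy⟩
    · exact absurd hy h3
    · exact ⟨u, hu, huy⟩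
  obtain ⟨l, hl1, hlt⟩ := exists_between hP'.one_lt
  obtain ⟨u, -, hu⟩ := hgate 1 ⟨hP'.lt_one, hP'.one_lt⟩
  obtain ⟨v, -, hv⟩ := hgate l ⟨hP'.lt_one.trans hl1, hlt⟩
  have := htwist x' hP'.ne_zero l hl1
  rw [Complex.ofReal_one, one_mul] at hu
  rw [← hu, ← hv, cross_smul_left, cross_smul_right] at this
  have h0 : cross x x = 0 := by unfold cross; ring
  simp [h0] at this

/-- **Birkhoff's theorem**, topological part: if an area preserving homeomorphism of the plane that
fixes the origin and twists radial directions maps an inner domain to itself, then this domain is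
star-shaped with respect to the origin. -/
theorem IsInnerDomain.subset_starKernel (h : IsInnerDomain Ω V) (f : ℂ ≃ₜ ℂ) (hfV : f '' V = V)
    (hf0 : f 0 = 0) (hvol : ∀ A : Set ℂ, IsOpen A → volume (f ⁻¹' A) = volume A)
    (htwist : ∀ w ≠ 0, ∀ l : ℝ, 1 < l → 0 < cross (f w) (f ((l : ℂ) * w)))
    (htwist' : ∀ w ≠ 0, ∀ l : ℝ, 1 < l → cross (f.symm w) (f.symm ((l : ℂ) * w)) < 0) :
    V ⊆ starKernel V := by
  by_contra hne
  obtain ⟨P₀, σ₀, x₀, s₀, t₀, hP₀⟩ := h.exists_pocket_of_ne hne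
  set I := {P : Set ℂ // ∃ σ x s t, IsPocket V P σ x s t} with hI
  have hpair : Pairwise (Function.onFun Disjoint fun P : I => (P : Set ℂ)) := by
    rintro ⟨P, σ, x, s, t, hP⟩ ⟨P', σ', x', s', t', hP'⟩ hPP'
    by_contra hcon
    rw [Function.onFun, Set.not_disjoint_iff_nonempty_inter] at hcon
    refine hPP' (Subtype.ext ?_)
    exact (hP'.subset_of_inter_nonempty hP hcon).antisymm
      (hP.subset_of_inter_nonempty hP' (inter_comm P P' ▸ hcon))
  have hfin := Measure.finite_const_le_meas_of_disjoint_iUnion (volume : Measure ℂ)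
    (ε := volume P₀) (hP₀.isOpen.measure_pos volume hP₀.nonempty)
    (As := fun P : I => (P : Set ℂ))
    (fun ⟨P, σ, x, s, t, hP⟩ => hP.isOpen.measurableSet) hpair
    ((measure_mono (iUnion_subset fun ⟨P, σ, x, s, t, hP⟩ => hP.subset)).trans_lt
      h.bounded.measure_lt_top).ne
  obtain ⟨⟨P, σ, x, s, t, hP⟩, hmem, hmax⟩ := hfin.exists_maximalFor
    (fun P : I => volume (P : Set ℂ)) _ ⟨⟨P₀, σ₀, x₀, s₀, t₀, hP₀⟩, le_refl (volume P₀)⟩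
  have hmax' : ∀ P' σ' x' s' t', IsPocket V P' σ' x' s' t' → volume P' ≤ volume P := by
    intro P' σ' x' s' t' hP'
    rcases le_total (volume P') (volume P) with hle | hle
    · exact hle
    · exact hmax (j := ⟨P', σ', x', s', t', hP'⟩) (le_trans hmem hle) hle
  rcases hP.sign with rfl | rfl
  · exact hP.false_of_max h hmax' f hfV hf0 (fun A hA _ => hvol A hA) (by simpa using htwist)
  · refine hP.false_of_max h hmax' f.symm ?_ ?_ (fun A hA _ => ?_) (fun w hw l hl => ?_)
    · rw [Homeomorph.image_symm]
      conv_lhs => rw [← hfV]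
      exact preimage_image_eq _ f.injective
    · rw [Homeomorph.symm_apply_eq, hf0]
    · have h1 := hvol (f '' A) (f.isOpenMap A hA)
      rw [preimage_image_eq _ f.injective] at h1
      rw [Homeomorph.preimage_symm, h1]
    · have := htwist' w hw l hl
      linarith

end

/-! ### Support curves and tangent lengths -/

section

/-- The scalar product of `z` with `u_θ`. -/
noncomputable def proj (z : ℂ) (θ : ℝ) : ℝ := z.re * Real.cos θ + z.im * Real.sin θ

/-- `α` parametrizes the boundary of a convex body with nonempty interior by the direction of the
outward normal: `α θ` is the support point in the direction `u_θ`. -/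
structure IsSupportCurve (α : ℝ → ℂ) : Prop where
  continuous : Continuous α
  periodic : ∀ θ, α (θ + 2 * Real.pi) = α θ
  support : ∀ θ φ, proj (α φ) θ ≤ proj (α θ) θ
  width : ∀ θ, proj (α (θ + Real.pi)) θ < proj (α θ) θ

/-- The distance from `α θ` to the intersection of the tangent lines at `θ` and `φ`, measured along
the direction `n_θ`. -/
noncomputable def fore (α : ℝ → ℂ) (θ φ : ℝ) : ℝ := proj (α φ - α θ) φ / Real.sin (φ - θ)

/-- The distance from the intersection of the tangent lines at `θ` and `φ` to `α φ`, measured along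
the direction `n_φ`. -/
noncomputable def back (α : ℝ → ℂ) (θ φ : ℝ) : ℝ := -proj (α φ - α θ) θ / Real.sin (φ - θ)

/-- The reflected curve. Reflection exchanges `fore` and `back`. -/
noncomputable def mirror (α : ℝ → ℂ) (θ : ℝ) : ℂ := (starRingEnd ℂ) (α (-θ))

theorem proj_sub (z w : ℂ) (θ : ℝ) : proj (z - w) θ = proj z θ - proj w θ := by
  simp [proj]; ring

theorem proj_add (z w : ℂ) (θ : ℝ) : proj (z + w) θ = proj z θ + proj w θ := by
  simp [proj]; ring

theorem proj_smul_dirVec (r θ φ : ℝ) : proj (r • dirVec θ) φ = r * Real.sin (φ - θ) := by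
  simp [proj, dirVec, Real.sin_sub]; ring

theorem proj_add_pi (z : ℂ) (θ : ℝ) : proj z (θ + Real.pi) = - proj z θ := by
  simp [proj]; ring

theorem proj_conj (z : ℂ) (θ : ℝ) : proj ((starRingEnd ℂ) z) θ = proj z (-θ) := by
  simp [proj]

theorem abs_proj_le (z : ℂ) (θ : ℝ) : |proj z θ| ≤ ‖z‖ := by
  rw [← Real.sqrt_sq_eq_abs, Complex.norm_def, Complex.normSq_apply]
  apply Real.sqrt_le_sqrt
  unfold proj
  nlinarith [Real.sin_sq_add_cos_sq θ, sq_nonneg (z.re * Real.sin θ - z.im * Real.cos θ)]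

theorem norm_dirVec (θ : ℝ) : ‖dirVec θ‖ = 1 := by
  rw [Complex.norm_def, Complex.normSq_apply]
  simp [dirVec, ← sq]

/-- A vector orthogonal to `u_θ` is a multiple of `n_θ`. -/
theorem exists_smul_dirVec {z : ℂ} {θ : ℝ} (h : proj z θ = 0) : ∃ r : ℝ, z = r • dirVec θ := by
  refine ⟨-z.re * Real.sin θ + z.im * Real.cos θ, Complex.ext ?_ ?_⟩
  · simp only [Complex.smul_re, dirVec, smul_eq_mul]
    unfold proj at h
    linear_combination Real.cos θ * h - z.re * Real.sin_sq_add_cos_sq θ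
  · simp only [Complex.smul_im, dirVec, smul_eq_mul]
    unfold proj at h
    linear_combination Real.sin θ * h - z.im * Real.sin_sq_add_cos_sq θ

theorem mirror_mirror (α : ℝ → ℂ) : mirror (mirror α) = α := by
  funext θ; simp [mirror]

theorem fore_mirror (α : ℝ → ℂ) (θ φ : ℝ) : fore (mirror α) θ φ = back α (-φ) (-θ) := by
  unfold fore back mirror
  rw [← map_sub, proj_conj, show -θ - -φ = φ - θ by ring, proj_sub, proj_sub]
  ring

theorem back_mirror (α : ℝ → ℂ) (θ φ : ℝ) : back (mirror α) θ φ = fore α (-φ) (-θ) := by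
  unfold fore back mirror
  rw [← map_sub, proj_conj, show -θ - -φ = φ - θ by ring, proj_sub, proj_sub]
  ring

variable {α : ℝ → ℂ}

theorem sin_sub_pos {θ φ : ℝ} (h : θ < φ) (h' : φ < θ + Real.pi) : 0 < Real.sin (φ - θ) :=
  Real.sin_pos_of_pos_of_lt_pi (by linarith) (by linarith)

theorem fore_mul_sin {θ φ : ℝ} (h : θ < φ) (h' : φ < θ + Real.pi) :
    fore α θ φ * Real.sin (φ - θ) = proj (α φ - α θ) φ :=
  div_mul_cancel₀ _ (sin_sub_pos h h').ne'

theorem back_mul_sin {θ φ : ℝ} (h : θ < φ) (h' : φ < θ + Real.pi) :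
    back α θ φ * Real.sin (φ - θ) = -proj (α φ - α θ) θ :=
  div_mul_cancel₀ _ (sin_sub_pos h h').ne'

/-- The chord from `α θ` to `α φ` decomposed along the two tangent directions. -/
theorem sub_eq_fore_add_back {θ φ : ℝ} (h : θ < φ) (h' : φ < θ + Real.pi) :
    α φ - α θ = fore α θ φ • dirVec θ + back α θ φ • dirVec φ := by
  have hs := (sin_sub_pos h h').ne'
  have h1 := fore_mul_sin (α := α) h h'
  have h2 := back_mul_sin (α := α) h h'
  generalize fore α θ φ = X at *
  generalize back α θ φ = Y at *
  generalize α φ - α θ = v at *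
  unfold proj at h1 h2
  have e1 := Real.sin_sq_add_cos_sq θ
  have e2 := Real.sin_sq_add_cos_sq φ
  have hS : Real.sin (φ - θ) = Real.sin φ * Real.cos θ - Real.cos φ * Real.sin θ := Real.sin_sub _ _
  apply Complex.ext
  · apply mul_right_cancel₀ hs
    simp only [Complex.add_re, Complex.smul_re, dirVec, smul_eq_mul]
    rw [hS] at h1 h2 ⊢
    linear_combination Real.sin θ * h1 + Real.sin φ * h2
  · apply mul_right_cancel₀ hs
    simp only [Complex.add_im, Complex.smul_im, dirVec, smul_eq_mul]
    rw [hS] at h1 h2 ⊢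
    linear_combination -Real.cos θ * h1 - Real.cos φ * h2

/-- Composition rule for three tangent lines. -/
theorem fore_add {a b c : ℝ} (hab : a < b) (hbc : b < c) (hca : c < a + Real.pi) :
    fore α a c = fore α a b +
      (fore α b c + back α a b) * (Real.sin (c - b) / Real.sin (c - a)) := by
  have hs := (sin_sub_pos (hab.trans hbc) hca).ne'
  have h1 := fore_mul_sin (α := α) (hab.trans hbc) hca
  have h2 := fore_mul_sin (α := α) hbc (by linarith : c < b + Real.pi)
  have h3 := sub_eq_fore_add_back (α := α) hab (by linarith : b < a + Real.pi)
  have h4 : proj (α b - α a) c = fore α a b * Real.sin (c - a) + back α a b * Real.sin (c - b) := by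
    rw [h3, proj_add, proj_smul_dirVec, proj_smul_dirVec]
  have h5 : proj (α c - α a) c = proj (α c - α b) c + proj (α b - α a) c := by
    rw [← proj_add]; congr 1; ring
  rw [mul_div_assoc', eq_comm, ← eq_sub_iff_add_eq', div_eq_iff hs]
  linear_combination h2 - h1 - h4 - h5

theorem back_add {a b c : ℝ} (hab : a < b) (hbc : b < c) (hca : c < a + Real.pi) :
    back α a c = back α b c +
      (fore α b c + back α a b) * (Real.sin (b - a) / Real.sin (c - a)) := by
  have h := fore_add (α := mirror α) (a := -c) (b := -b) (c := -a) (by linarith) (by linarith)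
    (by linarith)
  simp only [fore_mirror, back_mirror, neg_neg] at h
  rw [h, show -a - -b = b - a by ring, show -a - -c = c - a by ring]
  ring

namespace IsSupportCurve

theorem mirror (h : IsSupportCurve α) : IsSupportCurve (mirror α) where
  continuous := by
    have := h.continuous
    unfold DualBilliards.mirror
    exact Complex.continuous_conj.comp (this.comp continuous_neg)
  periodic θ := by
    have := h.periodic (-(θ + 2 * Real.pi))
    unfold DualBilliards.mirror
    rw [← this]
    congr 2; ring
  support θ φ := by
    unfold DualBilliards.mirror
    rw [proj_conj, proj_conj]
    exact h.support _ _
  width θ := by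
    unfold DualBilliards.mirror
    rw [proj_conj, proj_conj]
    have := h.width (-θ)
    have hp := h.periodic (-(θ + Real.pi))
    rwa [← hp, show -(θ + Real.pi) + 2 * Real.pi = -θ + Real.pi by ring]

theorem fore_nonneg (h : IsSupportCurve α) {θ φ : ℝ} (h1 : θ < φ) (h2 : φ < θ + Real.pi) :
    0 ≤ fore α θ φ := by
  refine div_nonneg ?_ (sin_sub_pos h1 h2).le
  rw [proj_sub]
  linarith [h.support φ θ]

theorem back_nonneg (h : IsSupportCurve α) {θ φ : ℝ} (h1 : θ < φ) (h2 : φ < θ + Real.pi) :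
    0 ≤ back α θ φ := by
  refine div_nonneg ?_ (sin_sub_pos h1 h2).le
  rw [proj_sub]
  linarith [h.support θ φ]

/-- By continuity of `α` the curve contains no segments: if the tangent line at `φ` meets the curve
at `α θ`, then `α` is constant on the interval between `θ` and `φ`. -/
theorem eq_of_fore_eq_zero (h : IsSupportCurve α) {θ φ : ℝ} (h1 : θ < φ) (h2 : φ < θ + Real.pi)
    (h0 : fore α θ φ = 0) : α φ = α θ := by
  have key : ∀ ψ ∈ Ioo θ φ, α ψ = α θ := by
    intro ψ hψ
    have hadd := fore_add (α := α) hψ.1 hψ.2 h2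
    have hq : 0 < Real.sin (φ - ψ) / Real.sin (φ - θ) :=
      div_pos (sin_sub_pos hψ.2 (by linarith [hψ.1])) (sin_sub_pos h1 h2)
    have n1 := h.fore_nonneg hψ.1 (by linarith [hψ.2] : ψ < θ + Real.pi)
    have n2 := h.fore_nonneg hψ.2 (by linarith [hψ.1] : φ < ψ + Real.pi)
    have n3 := h.back_nonneg hψ.1 (by linarith [hψ.2] : ψ < θ + Real.pi)
    rw [h0] at hadd
    have hm := mul_nonneg (add_nonneg n2 n3) hq.le
    have e1 : fore α θ ψ = 0 := by linarith
    have e2 : (fore α ψ φ + back α θ ψ) = 0 := by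
      have : (fore α ψ φ + back α θ ψ) * (Real.sin (φ - ψ) / Real.sin (φ - θ)) = 0 := by linarith
      exact (mul_eq_zero.1 this).resolve_right hq.ne'
    have e3 : back α θ ψ = 0 := by linarith
    have := sub_eq_fore_add_back (α := α) hψ.1 (by linarith [hψ.2] : ψ < θ + Real.pi)
    rw [e1, e3] at this
    simpa [sub_eq_zero] using this
  have hlim : Tendsto α (𝓝[<] φ) (𝓝 (α φ)) := h.continuous.continuousAt.mono_left nhdsWithin_le_nhds
  refine tendsto_nhds_unique hlim (tendsto_const_nhds.congr' ?_)
  filter_upwards [Ioo_mem_nhdsLT h1] with ψ hψ using (key ψ hψ).symm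

theorem eq_of_back_eq_zero (h : IsSupportCurve α) {θ φ : ℝ} (h1 : θ < φ) (h2 : φ < θ + Real.pi)
    (h0 : back α θ φ = 0) : α φ = α θ := by
  have := h.mirror.eq_of_fore_eq_zero (θ := -φ) (φ := -θ) (by linarith) (by linarith)
    (by rw [fore_mirror]; simpa using h0)
  have h3 : (starRingEnd ℂ) (α θ) = (starRingEnd ℂ) (α φ) := by
    simpa [DualBilliards.mirror] using this
  exact ((starRingEnd ℂ).injective h3).symm

theorem fore_pos_of_ne (h : IsSupportCurve α) {θ φ : ℝ} (h1 : θ < φ) (h2 : φ < θ + Real.pi)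
    (hne : α φ ≠ α θ) : 0 < fore α θ φ :=
  lt_of_le_of_ne (h.fore_nonneg h1 h2) fun h0 => hne (h.eq_of_fore_eq_zero h1 h2 h0.symm)

theorem back_pos_of_ne (h : IsSupportCurve α) {θ φ : ℝ} (h1 : θ < φ) (h2 : φ < θ + Real.pi)
    (hne : α φ ≠ α θ) : 0 < back α θ φ :=
  lt_of_le_of_ne (h.back_nonneg h1 h2) fun h0 => hne (h.eq_of_back_eq_zero h1 h2 h0.symm)

theorem back_pos (h : IsSupportCurve α) {θ φ : ℝ} (h1 : θ < φ) (h2 : φ < θ + Real.pi)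
    (hp : 0 < fore α θ φ) : 0 < back α θ φ := by
  refine h.back_pos_of_ne h1 h2 fun h0 => hp.ne' ?_
  simp [fore, h0, proj]

theorem fore_mono (h : IsSupportCurve α) {θ φ ψ : ℝ} (h1 : θ < φ) (h2 : φ ≤ ψ)
    (h3 : ψ < θ + Real.pi) : fore α θ φ ≤ fore α θ ψ := by
  rcases h2.eq_or_lt with rfl | h2
  · exact le_rfl
  rw [fore_add h1 h2 h3]
  have n2 := h.fore_nonneg h2 (by linarith : ψ < φ + Real.pi)
  have n3 := h.back_nonneg h1 (by linarith : φ < θ + Real.pi)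
  have hq : 0 < Real.sin (ψ - φ) / Real.sin (ψ - θ) :=
    div_pos (sin_sub_pos h2 (by linarith)) (sin_sub_pos (h1.trans h2) h3)
  have := mul_nonneg (add_nonneg n2 n3) hq.le
  linarith

theorem fore_strictMono (h : IsSupportCurve α) {θ φ ψ : ℝ} (h1 : θ < φ) (h2 : φ < ψ)
    (h3 : ψ < θ + Real.pi) (hp : 0 < fore α θ φ) : fore α θ φ < fore α θ ψ := by
  rw [fore_add h1 h2 h3]
  have n2 := h.fore_nonneg h2 (by linarith : ψ < φ + Real.pi)
  have n3 := h.back_pos h1 (by linarith : φ < θ + Real.pi) hp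
  have hq : 0 < Real.sin (ψ - φ) / Real.sin (ψ - θ) :=
    div_pos (sin_sub_pos h2 (by linarith)) (sin_sub_pos (h1.trans h2) h3)
  have := mul_pos (add_pos_of_nonneg_of_pos n2 n3) hq
  linarith

theorem back_anti (h : IsSupportCurve α) {θ φ ψ : ℝ} (h1 : θ ≤ φ) (h2 : φ < ψ)
    (h3 : ψ < θ + Real.pi) : back α φ ψ ≤ back α θ ψ := by
  have := h.mirror.fore_mono (θ := -ψ) (φ := -φ) (ψ := -θ) (by linarith) (by linarith)
    (by linarith)
  simpa [fore_mirror] using this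

theorem back_strictAnti (h : IsSupportCurve α) {θ φ ψ : ℝ} (h1 : θ < φ) (h2 : φ < ψ)
    (h3 : ψ < θ + Real.pi) (hp : 0 < back α φ ψ) : back α φ ψ < back α θ ψ := by
  have := h.mirror.fore_strictMono (θ := -ψ) (φ := -φ) (ψ := -θ) (by linarith) (by linarith)
    (by linarith) (by simpa [fore_mirror] using hp)
  simpa [fore_mirror] using this

theorem fore_le_norm {θ φ : ℝ} (h : IsSupportCurve α) (h1 : θ < φ) (h2 : φ ≤ θ + Real.pi / 2) :
    fore α θ φ ≤ ‖α φ - α θ‖ := by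
  have hpi := Real.pi_pos
  have h2' : φ < θ + Real.pi := by linarith
  have hX := h.fore_nonneg h1 h2'
  have hY := h.back_nonneg h1 h2'
  have hc : 0 ≤ Real.cos (φ - θ) := Real.cos_nonneg_of_mem_Icc ⟨by linarith, by linarith⟩
  rw [sub_eq_fore_add_back h1 h2', Complex.norm_def, Complex.normSq_apply]
  apply Real.le_sqrt_of_sq_le
  generalize fore α θ φ = X at *
  generalize back α θ φ = Y at *
  simp only [Complex.add_re, Complex.add_im, Complex.smul_re, Complex.smul_im, dirVec, smul_eq_mul]
  have e1 := Real.sin_sq_add_cos_sq θ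
  have e2 := Real.sin_sq_add_cos_sq φ
  rw [Real.cos_sub] at hc
  have : 0 ≤ X * Y * (Real.cos φ * Real.cos θ + Real.sin φ * Real.sin θ) := by positivity
  nlinarith [sq_nonneg Y]

theorem continuousAt_fore (h : IsSupportCurve α) {θ φ : ℝ} (h1 : θ < φ) (h2 : φ < θ + Real.pi) :
    ContinuousAt (fun p : ℝ × ℝ => fore α p.1 p.2) (θ, φ) := by
  have hα := h.continuous
  unfold fore proj
  refine ContinuousAt.div (Continuous.continuousAt (by fun_prop))
    (Continuous.continuousAt (by fun_prop)) (sin_sub_pos h1 h2).ne'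

theorem continuousAt_back (h : IsSupportCurve α) {θ φ : ℝ} (h1 : θ < φ) (h2 : φ < θ + Real.pi) :
    ContinuousAt (fun p : ℝ × ℝ => back α p.1 p.2) (θ, φ) := by
  have hα := h.continuous
  unfold back proj
  refine ContinuousAt.div (Continuous.continuousAt (by fun_prop))
    (Continuous.continuousAt (by fun_prop)) (sin_sub_pos h1 h2).ne'

/-- Every point of the forward tangent ray at `θ` lies on the tangent line at some later `φ`. -/
theorem exists_fore_eq (h : IsSupportCurve α) (θ : ℝ) {r : ℝ} (hr : 0 < r) :
    ∃ φ, θ < φ ∧ φ < θ + Real.pi ∧ fore α θ φ = r := by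
  have hpi := Real.pi_pos
  -- a first angle where `fore` is still small
  obtain ⟨φ₀, hφ₀, hφ₀', hsmall⟩ : ∃ φ₀, θ < φ₀ ∧ φ₀ < θ + Real.pi / 2 ∧ ‖α φ₀ - α θ‖ < r := by
    have hlim : Tendsto (fun φ => ‖α φ - α θ‖) (𝓝[>] θ) (𝓝 0) := by
      have : Continuous fun φ => ‖α φ - α θ‖ := by have := h.continuous; fun_prop
      have h2 := this.tendsto θ
      simp only [sub_self, norm_zero] at h2
      exact h2.mono_left nhdsWithin_le_nhds
    obtain ⟨φ, hφ, hφ'⟩ := ((hlim.eventually (gt_mem_nhds hr)).and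
      (Ioo_mem_nhdsGT (show θ < θ + Real.pi / 2 by linarith))).exists
    exact ⟨φ, hφ'.1, hφ'.2, hφ⟩
  set G : ℝ → ℝ := fun φ => proj (α φ - α θ) φ - r * Real.sin (φ - θ) with hG
  have hGc : Continuous G := by
    have := h.continuous
    unfold G proj
    fun_prop
  have hG0 : G φ₀ < 0 := by
    have h3 : φ₀ < θ + Real.pi := by linarith
    have h1 := fore_mul_sin (α := α) hφ₀ h3
    have h2 := h.fore_le_norm hφ₀ hφ₀'.le
    simp only [hG, ← h1]
    have := sin_sub_pos hφ₀ h3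
    nlinarith
  have hG1 : 0 < G (θ + Real.pi) := by
    have := h.width θ
    simp only [hG, proj_add_pi, add_sub_cancel_left, Real.sin_pi, mul_zero, sub_zero, proj_sub]
    linarith
  obtain ⟨φ, hφ, hφG⟩ := intermediate_value_Ioo (show φ₀ ≤ θ + Real.pi by linarith)
    hGc.continuousOn ⟨hG0, hG1⟩
  have h1 : θ < φ := hφ₀.trans hφ.1
  refine ⟨φ, h1, hφ.2, ?_⟩
  rw [fore, div_eq_iff (sin_sub_pos h1 hφ.2).ne']
  simp only [hG] at hφG
  linarith

theorem exists_back_eq (h : IsSupportCurve α) (φ : ℝ) {r : ℝ} (hr : 0 < r) :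
    ∃ θ, φ - Real.pi < θ ∧ θ < φ ∧ back α θ φ = r := by
  obtain ⟨θ, h1, h2, h3⟩ := h.mirror.exists_fore_eq (-φ) hr
  refine ⟨-θ, by linarith, by linarith, ?_⟩
  rw [fore_mirror] at h3
  simpa using h3

/-- Not both of two opposite angles can have the same support point as a given one, hence some pair
of opposite angles around `θ` has support points different from `α θ`. -/
theorem exists_ne_ne (h : IsSupportCurve α) (θ : ℝ) :
    ∃ τ ∈ Ioo 0 Real.pi, α (θ + τ) ≠ α θ ∧ α (θ + τ - Real.pi) ≠ α θ := by
  by_contra! hcon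
  have hα := h.continuous
  set A : Set ℝ := {τ | α (θ + τ) = α θ}
  set B : Set ℝ := {τ | α (θ + τ - Real.pi) = α θ}
  have hA : IsClosed A := isClosed_eq (by fun_prop) (by fun_prop)
  have hB : IsClosed B := isClosed_eq (by fun_prop) (by fun_prop)
  have hpi := Real.pi_pos
  obtain ⟨τ, -, h1, h2⟩ := isPreconnected_closed_iff.1
    (isPreconnected_Icc (a := (0 : ℝ)) (b := Real.pi)) A B hA hB (by
      intro τ hτ
      rcases hτ.1.eq_or_lt with rfl | h1
      · exact Or.inl (show α (θ + 0) = α θ by rw [add_zero])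
      rcases hτ.2.eq_or_lt with rfl | h2
      · exact Or.inr (show α (θ + Real.pi - Real.pi) = α θ by rw [add_sub_cancel_right])
      by_cases h3 : α (θ + τ) = α θ
      · exact Or.inl h3
      · exact Or.inr (hcon τ ⟨h1, h2⟩ h3))
    ⟨0, by simp [hpi.le], show α (θ + 0) = α θ by rw [add_zero]⟩
    ⟨Real.pi, by simp [hpi.le], show α (θ + Real.pi - Real.pi) = α θ by rw [add_sub_cancel_right]⟩
  have h1 : α (θ + τ) = α θ := h1
  have h2 : α (θ + τ - Real.pi) = α θ := h2
  have h3 := h.width (θ + τ - Real.pi)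
  rw [sub_add_cancel, h1, h2] at h3
  exact lt_irrefl _ h3

end IsSupportCurve

end

/-! ### Invariant radius functions and vanishing curvature -/

section

variable {α : ℝ → ℂ} {R : ℝ → ℝ}

/-- The region `{α θ - r n_θ : 0 < r < R θ}` is invariant under the dual billiards map of the curve
`α`: when the tangent lines at `θ < φ` meet at a point `z`, then the preimage of `z`, which lies on
the tangent line at `θ`, is in the region iff `z`, as a point of the tangent line at `φ`, is. -/
structure IsInvariantRadius (α : ℝ → ℂ) (R : ℝ → ℝ) : Prop where
  pos : ∀ θ, 0 < R θ
  lt_iff : ∀ θ φ, θ < φ → φ < θ + Real.pi → (fore α θ φ < R θ ↔ back α θ φ < R φ)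

namespace IsInvariantRadius

theorem mirror (hR : IsInvariantRadius α R) :
    IsInvariantRadius (mirror α) fun θ => R (-θ) where
  pos θ := hR.pos _
  lt_iff θ φ h1 h2 := by
    rw [fore_mirror, back_mirror]
    exact (hR.lt_iff _ _ (by linarith) (by linarith)).symm

/-- An invariant radius function is not assumed to be continuous; this semicontinuity from the left
follows from the invariance. -/
theorem usc_left (hα : IsSupportCurve α) (hR : IsInvariantRadius α R) {θ c : ℝ} (hc : R θ < c) :
    ∀ᶠ ψ in 𝓝[<] θ, R ψ < c := by
  obtain ⟨c₁, h1, h2⟩ := exists_between hc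
  obtain ⟨φ, hφ, hφ', hX⟩ := hα.exists_fore_eq θ ((hR.pos θ).trans h1)
  have hcont : ContinuousAt (fun ψ => fore α ψ φ) θ :=
    (hα.continuousAt_fore hφ hφ').comp (f := fun ψ : ℝ => (ψ, φ)) (by fun_prop)
  have hev : ∀ᶠ ψ in 𝓝[<] θ, fore α ψ φ < c :=
    (hcont.eventually (gt_mem_nhds (hX.trans_lt h2))).filter_mono nhdsWithin_le_nhds
  filter_upwards [hev, Ioo_mem_nhdsLT (show φ - Real.pi < θ by linarith)] with ψ hψ hψ'
  refine lt_of_le_of_lt (not_lt.1 fun hlt => ?_) hψ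
  have h3 := (hR.lt_iff ψ φ (by linarith [hψ'.2]) (by linarith [hψ'.1])).1 hlt
  have h4 := hα.back_anti hψ'.2.le hφ (by linarith [hψ'.1] : φ < ψ + Real.pi)
  have h5 := (hR.lt_iff θ φ hφ hφ').2 (h4.trans_lt h3)
  linarith

/-- The boundary of the invariant region is invariant. -/
theorem back_eq (hα : IsSupportCurve α) (hR : IsInvariantRadius α R) {θ φ : ℝ} (h1 : θ < φ)
    (h2 : φ < θ + Real.pi) (h : fore α θ φ = R θ) : back α θ φ = R φ := by
  have hpos := hR.pos θ
  refine le_antisymm ?_ (not_lt.1 fun hlt => ?_)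
  · by_contra hcon
    push Not at hcon
    obtain ⟨c, hc1, hc2⟩ := exists_between hcon
    have hcont : ContinuousAt (fun ψ => back α θ ψ) φ :=
      (hα.continuousAt_back h1 h2).comp (f := fun ψ : ℝ => (θ, ψ)) (by fun_prop)
    have hcont' : ContinuousAt (fun ψ => fore α θ ψ) φ :=
      (hα.continuousAt_fore h1 h2).comp (f := fun ψ : ℝ => (θ, ψ)) (by fun_prop)
    have hev : ∀ᶠ ψ in 𝓝[<] φ, c < back α θ ψ :=
      (hcont.eventually (lt_mem_nhds hc2)).filter_mono nhdsWithin_le_nhds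
    have hev' : ∀ᶠ ψ in 𝓝[<] φ, 0 < fore α θ ψ :=
      (hcont'.eventually (lt_mem_nhds (hpos.trans_eq h.symm))).filter_mono nhdsWithin_le_nhds
    obtain ⟨ψ, ⟨⟨hψ1, hψ2⟩, hψ3⟩, hψ4⟩ :=
      (((hev.and hev').and (hR.usc_left hα hc1)).and (Ioo_mem_nhdsLT h1)).exists
    have h3 : fore α θ ψ < R θ := h ▸ hα.fore_strictMono hψ4.1 hψ4.2 h2 hψ2
    have h4 := (hR.lt_iff θ ψ hψ4.1 (by linarith [hψ4.2])).1 h3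
    linarith
  · have := (hR.lt_iff θ φ h1 h2).2 hlt
    linarith

theorem fore_eq (hα : IsSupportCurve α) (hR : IsInvariantRadius α R) {θ φ : ℝ} (h1 : θ < φ)
    (h2 : φ < θ + Real.pi) (h : back α θ φ = R φ) : fore α θ φ = R θ := by
  have := hR.mirror.back_eq hα.mirror (θ := -φ) (φ := -θ) (by linarith) (by linarith)
    (by rw [fore_mirror]; simpa using h)
  rw [back_mirror] at this
  simpa using this

theorem gt_iff (hα : IsSupportCurve α) (hR : IsInvariantRadius α R) {θ φ : ℝ} (h1 : θ < φ)
    (h2 : φ < θ + Real.pi) : R θ < fore α θ φ ↔ R φ < back α θ φ := by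
  constructor
  · intro h
    rcases lt_trichotomy (back α θ φ) (R φ) with h3 | h3 | h3
    · have := (hR.lt_iff θ φ h1 h2).2 h3; linarith
    · have := hR.fore_eq hα h1 h2 h3; linarith
    · exact h3
  · intro h
    rcases lt_trichotomy (fore α θ φ) (R θ) with h3 | h3 | h3
    · have := (hR.lt_iff θ φ h1 h2).1 h3; linarith
    · have := hR.back_eq hα h1 h2 h3; linarith
    · exact h3

/-- The angle before `θ` in the orbit of the boundary point over `θ`. -/
theorem exists_prev (hα : IsSupportCurve α) (hR : IsInvariantRadius α R) (θ : ℝ) :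
    ∃ ψ, θ - Real.pi < ψ ∧ ψ < θ ∧ back α ψ θ = R θ ∧ fore α ψ θ = R ψ := by
  obtain ⟨ψ, h1, h2, h3⟩ := hα.exists_back_eq θ (hR.pos θ)
  exact ⟨ψ, h1, h2, h3, hR.fore_eq hα h2 (by linarith) h3⟩

theorem exists_next (hα : IsSupportCurve α) (hR : IsInvariantRadius α R) (θ : ℝ) :
    ∃ ψ, θ < ψ ∧ ψ < θ + Real.pi ∧ fore α θ ψ = R θ ∧ back α θ ψ = R ψ := by
  obtain ⟨ψ, h1, h2, h3⟩ := hα.exists_fore_eq θ (hR.pos θ)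
  exact ⟨ψ, h1, h2, h3, hR.back_eq hα h1 h2 h3⟩

/-- The boundary orbits of the invariant region are ordered. -/
theorem prev_strictMono (hα : IsSupportCurve α) (hR : IsInvariantRadius α R) {a b a' b' : ℝ}
    (hab : a < b) (ha2 : a' < a) (ha : back α a' a = R a)
    (hb1 : b - Real.pi < b') (hb2 : b' < b) (hb : back α b' b = R b) : a' < b' := by
  by_contra hcon
  push Not at hcon
  have hXa := hR.fore_eq hα ha2 (by linarith) ha
  have hXb := hR.fore_eq hα hb2 (by linarith) hb
  have h1 : R a ≤ back α b' a := ha ▸ hα.back_anti hcon ha2 (by linarith)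
  have h2 : R b' ≤ fore α b' a := not_lt.1 fun h =>
    absurd ((hR.lt_iff b' a (by linarith) (by linarith)).1 h) (not_lt.2 h1)
  have h3 := hα.fore_strictMono (by linarith : b' < a) hab (by linarith)
    ((hR.pos b').trans_le h2)
  linarith

end IsInvariantRadius

/-- If the curvature radius vanishes at `θ₀` in the sense of a derivative from the right, then an
invariant region reaches over the angle `θ₀` at least up to a bound depending on the curve only. -/
theorem exists_le_of_right_deriv_zero (hα : IsSupportCurve α) {θ₀ : ℝ}
    (hd : (fun θ => α θ - α θ₀) =o[𝓝[>] θ₀] fun θ => θ - θ₀) :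
    ∃ ε > 0, ∀ R, IsInvariantRadius α R → ε ≤ R θ₀ := by
  obtain ⟨τ, hτ, hτ1, hτ2⟩ := hα.exists_ne_ne θ₀
  have hA := hα.fore_pos_of_ne (θ := θ₀) (φ := θ₀ + τ) (by linarith [hτ.1]) (by linarith [hτ.2]) hτ1
  have hB := hα.back_pos_of_ne (θ := θ₀ + τ - Real.pi) (φ := θ₀) (by linarith [hτ.2])
    (by linarith [hτ.1]) hτ2.symm
  refine ⟨min (fore α θ₀ (θ₀ + τ)) (back α (θ₀ + τ - Real.pi) θ₀), lt_min hA hB, fun R hR => ?_⟩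
  by_contra hcon
  push Not at hcon
  have hR0 := hR.pos θ₀
  obtain ⟨p, hp1, hp2, hp3, hp4⟩ := hR.exists_prev hα θ₀
  obtain ⟨q, hq1, hq2, hq3, hq4⟩ := hR.exists_next hα θ₀
  have hq : q < θ₀ + τ := by
    by_contra h
    have := hα.fore_mono (by linarith [hτ.1] : θ₀ < θ₀ + τ) (not_lt.1 h) hq2
    linarith [hcon.trans_le (min_le_left _ _)]
  have hp : θ₀ + τ - Real.pi < p := by
    by_contra h
    have := hα.back_anti (not_lt.1 h) (by linarith [hτ.2] : θ₀ + τ - Real.pi < θ₀) (by linarith)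
    linarith [hcon.trans_le (min_le_right _ _)]
  -- for `φ > θ₀` close to `θ₀` the orbits are compared with the tangent lines at `p` and `q`
  have key : ∀ φ ∈ Ioo θ₀ q, φ < p + Real.pi → fore α φ q < back α p φ := by
    intro φ hφ hφp
    have h1 : back α φ q < R q := by
      rcases (hα.back_nonneg hφ.2 (by linarith [hφ.1] : q < φ + Real.pi)).eq_or_lt with h0 | h0
      · exact h0 ▸ hR.pos q
      · exact hq4 ▸ hα.back_strictAnti hφ.1 hφ.2 hq2 h0
    have h2 := (hR.lt_iff φ q hφ.2 (by linarith [hφ.1])).2 h1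
    have h3 : R p < fore α p φ := hp4 ▸ hα.fore_strictMono hp2 hφ.1 hφp (hp4 ▸ hR.pos p)
    have h4 := (hR.gt_iff hα (by linarith [hφ.1]) hφp).1 h3
    linarith
  set c := R θ₀ * Real.sin (q - p) with hc
  have hpi := Real.pi_pos
  have hc0 : 0 < c := mul_pos hR0 (Real.sin_pos_of_pos_of_lt_pi (by linarith) (by linarith))
  have ho := hd.def (c := c / Real.pi) (by positivity)
  obtain ⟨φ, ⟨⟨hφo, hφ1⟩, hφ2⟩, hφ3⟩ := (((ho.and (Ioo_mem_nhdsGT hq1)).and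
    (Ioo_mem_nhdsGT (show θ₀ < p + Real.pi by linarith))).and
    (Ioo_mem_nhdsGT (show θ₀ < θ₀ + Real.pi / 2 by linarith))).exists
  have hlt := key φ hφ1 hφ2.2
  have hs1 := sin_sub_pos hφ1.2 (by linarith [hφ1.1] : q < φ + Real.pi)
  have hs2 := sin_sub_pos (by linarith [hφ1.1] : p < φ) hφ2.2
  have hs := mul_lt_mul_of_pos_right hlt (mul_pos hs1 hs2)
  have e1 := fore_mul_sin (α := α) hφ1.2 (by linarith [hφ1.1] : q < φ + Real.pi)
  have e2 := back_mul_sin (α := α) (by linarith [hφ1.1] : p < φ) hφ2.2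
  have e3 := fore_mul_sin (α := α) hq1 hq2
  have e4 := back_mul_sin (α := α) hp2 (by linarith : θ₀ < p + Real.pi)
  rw [hq3] at e3
  rw [hp3] at e4
  set v := α φ - α θ₀ with hv
  have e5 : proj (α q - α φ) q = R θ₀ * Real.sin (q - θ₀) - proj v q := by
    rw [e3, ← proj_sub]; congr 1; rw [hv]; ring
  have e6 : proj (α φ - α p) p = proj v p - R θ₀ * Real.sin (θ₀ - p) := by
    rw [e4, sub_neg_eq_add, ← proj_add]; congr 1; rw [hv]; ring
  have e7 : (R θ₀ * Real.sin (q - θ₀) - proj v q) * Real.sin (φ - p) <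
      (R θ₀ * Real.sin (θ₀ - p) - proj v p) * Real.sin (q - φ) := by
    rw [← e5, ← e1]
    have : R θ₀ * Real.sin (θ₀ - p) - proj v p = back α p φ * Real.sin (φ - p) := by
      rw [e2, e6]; ring
    rw [this]
    linarith
  have e8 : Real.sin (q - θ₀) * Real.sin (φ - p) - Real.sin (θ₀ - p) * Real.sin (q - φ) =
      Real.sin (φ - θ₀) * Real.sin (q - p) := by
    rw [show φ - p = (φ - θ₀) + (θ₀ - p) by ring, show q - φ = (q - θ₀) - (φ - θ₀) by ring,
      show q - p = (q - θ₀) + (θ₀ - p) by ring]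
    simp only [Real.sin_add, Real.sin_sub (q - θ₀)]
    ring
  have e9 : Real.sin (φ - θ₀) * c < proj v q * Real.sin (φ - p) - proj v p * Real.sin (q - φ) := by
    have : Real.sin (φ - θ₀) * c = R θ₀ * (Real.sin (q - θ₀) * Real.sin (φ - p) -
      Real.sin (θ₀ - p) * Real.sin (q - φ)) := by rw [e8, hc]; ring
    rw [this]
    linarith
  have hb1 : proj v q * Real.sin (φ - p) ≤ ‖v‖ := by
    have h1 := (le_abs_self _).trans (abs_proj_le v q)
    nlinarith [Real.sin_le_one (φ - p), norm_nonneg v]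
  have hb2 : -(proj v p * Real.sin (q - φ)) ≤ ‖v‖ := by
    have h1 := (neg_le_abs _).trans (abs_proj_le v p)
    nlinarith [Real.sin_le_one (q - φ), norm_nonneg v]
  have hη := Real.mul_le_sin (x := φ - θ₀) (by linarith [hφ1.1]) (by linarith [hφ3.2])
  rw [Real.norm_of_nonneg (by linarith [hφ1.1] : 0 ≤ φ - θ₀)] at hφo
  have h1 : 2 / Real.pi * (φ - θ₀) * c ≤ Real.sin (φ - θ₀) * c :=
    mul_le_mul_of_nonneg_right hη hc0.le
  have h2 : 2 / Real.pi * (φ - θ₀) * c = 2 * (c / Real.pi * (φ - θ₀)) := by ring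
  linarith

/-- The mirror image of `exists_le_of_right_deriv_zero`. -/
theorem exists_le_of_left_deriv_zero (hα : IsSupportCurve α) {θ₀ : ℝ}
    (hd : (fun θ => α θ - α θ₀) =o[𝓝[<] θ₀] fun θ => θ - θ₀) :
    ∃ ε > 0, ∀ R, IsInvariantRadius α R → ε ≤ R θ₀ := by
  have hneg : Tendsto (fun θ : ℝ => -θ) (𝓝[>] (-θ₀)) (𝓝[<] θ₀) := by
    have := tendsto_neg_nhdsGT (a := -θ₀)
    rwa [neg_neg] at this
  obtain ⟨ε, hε, h⟩ := exists_le_of_right_deriv_zero hα.mirror (θ₀ := -θ₀) (by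
    have h1 := hd.comp_tendsto hneg
    refine Asymptotics.IsLittleO.of_norm_norm (h1.norm_norm.congr ?_ ?_)
    · intro θ
      simp only [mirror, Function.comp, neg_neg, ← map_sub, RCLike.norm_conj]
    · intro θ
      simp only [Function.comp]
      rw [← norm_neg]; congr 1; ring)
  refine ⟨ε, hε, fun R hR => ?_⟩
  simpa using h _ hR.mirror

end

/-! ### Invariant radius functions and jumps of the curvature -/

section

variable {α : ℝ → ℂ} {R : ℝ → ℝ}

/-- On `[p, q]` the quantities `fore` and `back` agree up to the factor `κ` with those of a circle
of radius `2 m` (to first order). -/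
def IsNearlyCircular (α : ℝ → ℂ) (κ m p q : ℝ) : Prop :=
  ∀ θ φ, p ≤ θ → θ < φ → φ ≤ q →
    m * (φ - θ) ≤ κ * fore α θ φ ∧ fore α θ φ ≤ κ * (m * (φ - θ)) ∧
    m * (φ - θ) ≤ κ * back α θ φ ∧ back α θ φ ≤ κ * (m * (φ - θ))

theorem IsNearlyCircular.mirror {κ m p q : ℝ} (h : IsNearlyCircular α κ m p q) :
    IsNearlyCircular (mirror α) κ m (-q) (-p) := by
  intro θ φ h1 h2 h3
  obtain ⟨e1, e2, e3, e4⟩ := h (-φ) (-θ) (by linarith) (by linarith) (by linarith)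
  rw [fore_mirror, back_mirror]
  rw [show -θ - -φ = φ - θ by ring] at *
  exact ⟨e3, e4, e1, e2⟩

/-- Along an orbit in a nearly circular part the radius and the steps are nearly constant. -/
theorem IsInvariantRadius.orbit_bounds (hR : IsInvariantRadius α R) {g : ℝ → ℝ}
    (hg1 : ∀ θ, g θ < θ) (hg2 : ∀ θ, back α (g θ) θ = R θ) (hg3 : ∀ θ, fore α (g θ) θ = R (g θ))
    {κ m p q : ℝ} (hκ : 1 ≤ κ) (hm : 0 < m) (hc : IsNearlyCircular α κ m p q) {N : ℕ} {x : ℝ} :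
    ∀ k, k ≤ N → (∀ j ≤ k, g^[j] x ∈ Icc p q) →
      R x ≤ κ ^ (2 * k) * R (g^[k] x) ∧ R (g^[k] x) ≤ κ ^ (2 * k) * R x ∧
      k * R x ≤ κ ^ (2 * N) * (m * (x - g^[k] x)) ∧ m * (x - g^[k] x) ≤ k * (κ ^ (2 * N) * R x) := by
  have hκ0 : 0 < κ := by linarith
  intro k
  induction k with
  | zero => intro _ _; simp
  | succ k ih =>
    intro hk hr
    obtain ⟨i1, i2, i3, i4⟩ := ih (by omega) (fun j hj => hr j (by omega))
    have hin := hr (k + 1) le_rfl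
    have hin0 := hr k (by omega)
    rw [Function.iterate_succ_apply'] at hin ⊢
    set y := g^[k] x with hy
    obtain ⟨c1, c2, c3, c4⟩ := hc (g y) y hin.1 (hg1 y) hin0.2
    rw [hg2] at c3 c4
    rw [hg3] at c1 c2
    have hRx := hR.pos x
    have hpk : 0 < κ ^ (2 * k) := by positivity
    have hpow : κ ^ (2 * (k + 1)) = κ ^ (2 * k) * κ * κ := by
      rw [show 2 * (k + 1) = 2 * k + 1 + 1 by ring, pow_succ, pow_succ]
    have hN : κ ^ (2 * k) * κ ≤ κ ^ (2 * N) := by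
      rw [← pow_succ]
      exact pow_le_pow_right₀ hκ (by omega)
    have hRy : R y ≤ κ * κ * R (g y) := by nlinarith
    have hRy' : R (g y) ≤ κ * κ * R y := by nlinarith
    refine ⟨?_, ?_, ?_, ?_⟩
    · rw [hpow]
      calc R x ≤ κ ^ (2 * k) * R y := i1
        _ ≤ κ ^ (2 * k) * (κ * κ * R (g y)) := by gcongr
        _ = _ := by ring
    · rw [hpow]
      calc R (g y) ≤ κ * κ * R y := hRy'
        _ ≤ κ * κ * (κ ^ (2 * k) * R x) := by gcongr
        _ = _ := by ring
    · have hd : 0 ≤ m * (y - g y) := mul_nonneg hm.le (by linarith [hg1 y])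
      have : R x ≤ κ ^ (2 * N) * (m * (y - g y)) :=
        calc R x ≤ κ ^ (2 * k) * R y := i1
          _ ≤ κ ^ (2 * k) * (κ * (m * (y - g y))) := by gcongr
          _ = κ ^ (2 * k) * κ * (m * (y - g y)) := by ring
          _ ≤ _ := by gcongr
      push_cast
      nlinarith
    · have : m * (y - g y) ≤ κ ^ (2 * N) * R x :=
        calc m * (y - g y) ≤ κ * R y := c3
          _ ≤ κ * (κ ^ (2 * k) * R x) := by gcongr
          _ = κ ^ (2 * k) * κ * R x := by ring
          _ ≤ _ := by gcongr
      push_cast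
      nlinarith

/-- To the left of `b`, where the curve is nearly circular, an invariant radius is nearly constant:
the boundary orbit of a point `a` between `b` and its predecessor interlaces with the orbit of `b`,
so after many steps the average step lengths, which are proportional to the radii at `a` and `b`,
nearly agree. -/
theorem IsInvariantRadius.radius_left (hα : IsSupportCurve α) (hR : IsInvariantRadius α R)
    {κ m b δ : ℝ} (hκ : 1 ≤ κ) (hm : 0 < m) (hc : IsNearlyCircular α κ m (b - δ) b) {n : ℕ}
    (hn : 1 ≤ n) (hsmall : (n + 1) * (κ ^ (2 * (n + 1)) * R b) < m * δ) {a : ℝ} (hab : a < b)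
    (ha : κ * (m * (b - a)) ≤ R b) :
    n * R a ≤ (n + 1) * (κ ^ (4 * (n + 1)) * R b) ∧
      (n - 1) * R b ≤ n * (κ ^ (4 * (n + 1)) * R a) := by
  have hκ0 : 0 < κ := by linarith
  choose g hg0 hg1 hg2 hg3 using hR.exists_prev hα
  have hgm : StrictMono g := fun x y hxy =>
    hR.prev_strictMono hα hxy (hg1 x) (hg2 x) (hg0 y) (hg1 y) (hg2 y)
  have hRb := hR.pos b
  have hpowN : 0 < κ ^ (2 * (n + 1)) := by positivity
  have hanti : ∀ x, ∀ k, g^[k + 1] x < g^[k] x := fun x k => by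
    rw [Function.iterate_succ_apply']; exact hg1 _
  have hle : ∀ x k, g^[k] x ≤ x := fun x k => by
    induction k with
    | zero => exact le_rfl
    | succ k ih => exact (hanti x k).le.trans ih
  -- the orbit of `b` stays in the nearly circular part
  have hbr : ∀ k ≤ n + 1, ∀ j ≤ k, g^[j] b ∈ Icc (b - δ) b := by
    intro k
    induction k with
    | zero =>
      intro _ j hj
      obtain rfl : j = 0 := by omega
      have : 0 < m * δ := lt_of_le_of_lt (by positivity) hsmall
      have : 0 < δ := pos_of_mul_pos_right this hm.le
      exact ⟨by simpa using this.le, le_rfl⟩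
    | succ k ih =>
      intro hk j hj
      rcases Nat.lt_or_ge j (k + 1) with h | h
      · exact ih (by omega) j (by omega)
      obtain rfl : j = k + 1 := by omega
      refine ⟨?_, hle b _⟩
      by_contra hcon
      push Not at hcon
      obtain ⟨-, i2, -, i4⟩ := hR.orbit_bounds hg1 hg2 hg3 hκ hm hc (N := n + 1) k (by omega)
        (ih (by omega))
      have hin := ih (by omega) k le_rfl
      rw [Function.iterate_succ_apply'] at hcon
      set y := g^[k] b with hy
      have hkn : (k : ℝ) + 1 ≤ n + 1 := by exact_mod_cast hk
      have hstep : κ * R y ≤ κ ^ (2 * (n + 1)) * R b :=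
        calc κ * R y ≤ κ * (κ ^ (2 * k) * R b) := by gcongr
          _ = κ ^ (2 * k + 1) * R b := by rw [pow_succ]; ring
          _ ≤ _ := by
            gcongr
            omega
      have hbase : k * (κ ^ (2 * (n + 1)) * R b) + κ ^ (2 * (n + 1)) * R b < m * δ := by
        refine lt_of_le_of_lt ?_ hsmall
        have : 0 ≤ κ ^ (2 * (n + 1)) * R b := by positivity
        nlinarith
      have hy1 : b - δ < y := by
        have h0 : 0 < κ ^ (2 * (n + 1)) * R b := by positivity
        have : m * (b - y) < m * δ := by linarith
        have := lt_of_mul_lt_mul_left this hm.le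
        linarith
      obtain ⟨-, -, c3, -⟩ := hc (b - δ) y le_rfl hy1 hin.2
      have h5 := hα.back_anti hcon.le hy1 (by linarith [hg0 y])
      rw [hg2] at h5
      have h6 : κ * back α (b - δ) y ≤ κ * R y := by gcongr
      nlinarith
  have hbr' := hbr (n + 1) le_rfl
  -- interlacing
  have hgb : g b ≤ a := by
    obtain ⟨-, -, -, c4⟩ := hc (g b) b (hbr' 1 (by omega)).1 (hg1 b) le_rfl
    rw [hg2] at c4
    have h1 : κ * m * (b - a) ≤ κ * m * (b - g b) := by nlinarith
    have := le_of_mul_le_mul_left h1 (by positivity)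
    linarith
  have hinter : ∀ k, g^[k + 1] b ≤ g^[k] a ∧ g^[k] a ≤ g^[k] b := fun k => by
    refine ⟨?_, (hgm.monotone.iterate k) hab.le⟩
    rw [Function.iterate_succ_apply]
    exact (hgm.monotone.iterate k) hgb
  have har : ∀ j ≤ n, g^[j] a ∈ Icc (b - δ) b := fun j hj =>
    ⟨(hbr' (j + 1) (by omega)).1.trans (hinter j).1, (hinter j).2.trans (hle b j)⟩
  obtain ⟨-, -, a3, a4⟩ := hR.orbit_bounds hg1 hg2 hg3 hκ hm hc (N := n + 1) n (by omega) har
  obtain ⟨-, -, -, b4⟩ := hR.orbit_bounds hg1 hg2 hg3 hκ hm hc (N := n + 1) (n + 1) le_rfl hbr'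
  obtain ⟨-, -, b3, -⟩ := hR.orbit_bounds hg1 hg2 hg3 hκ hm hc (N := n + 1) n (by omega)
    (fun j hj => hbr' j (by omega))
  obtain ⟨-, b2, -, -⟩ := hR.orbit_bounds hg1 hg2 hg3 hκ hm hc (N := n + 1) 1 (by omega)
    (fun j hj => hbr' j (by omega))
  have hpow : κ ^ (4 * (n + 1)) = κ ^ (2 * (n + 1)) * κ ^ (2 * (n + 1)) := by
    rw [← pow_add]; congr 1; ring
  have hRa := hR.pos a
  rw [hpow]
  constructor
  · have h1 : m * (a - g^[n] a) ≤ m * (b - g^[n + 1] b) :=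
      mul_le_mul_of_nonneg_left (by linarith [(hinter n).1]) hm.le
    calc n * R a ≤ κ ^ (2 * (n + 1)) * (m * (a - g^[n] a)) := a3
      _ ≤ κ ^ (2 * (n + 1)) * (((n + 1 : ℕ) : ℝ) * (κ ^ (2 * (n + 1)) * R b)) :=
        mul_le_mul_of_nonneg_left (h1.trans b4) hpowN.le
      _ = _ := by push_cast; ring
  · -- the orbit of `g b` makes `n - 1` steps while that of `a` makes `n`
    obtain ⟨j, rfl⟩ : ∃ j, n = j + 1 := ⟨n - 1, by omega⟩
    have hsteps : ∀ i ≤ j, (i : ℝ) * R b ≤ κ ^ (2 * (j + 1 + 1)) * (m * (g b - g^[i + 1] b)) := by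
      intro i
      induction i with
      | zero => intro _; simp
      | succ i ih =>
        intro hi
        have h1 := ih (by omega)
        obtain ⟨e1, -, -, -⟩ := hR.orbit_bounds hg1 hg2 hg3 hκ hm hc (N := j + 1 + 1) (i + 1)
          (by omega) (fun k hk => hbr' k (by omega))
        have hin := (hbr' (i + 1 + 1) (by omega)).1
        rw [Function.iterate_succ_apply'] at hin ⊢
        set y := g^[i + 1] b
        obtain ⟨-, -, -, c4⟩ := hc (g y) y hin (hg1 y) (hbr' (i + 1) (by omega)).2
        rw [hg2] at c4
        have hd : 0 ≤ m * (y - g y) := mul_nonneg hm.le (by linarith [hg1 y])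
        have : R b ≤ κ ^ (2 * (j + 1 + 1)) * (m * (y - g y)) :=
          calc R b ≤ κ ^ (2 * (i + 1)) * R y := e1
            _ ≤ κ ^ (2 * (i + 1)) * (κ * (m * (y - g y))) := by gcongr
            _ = κ ^ (2 * (i + 1) + 1) * (m * (y - g y)) := by rw [pow_succ]; ring
            _ ≤ _ := by
              gcongr
              omega
        push_cast
        nlinarith
    have h1 := hsteps j le_rfl
    have h2 : m * (g b - g^[j + 1] b) ≤ m * (a - g^[j + 1] a) :=
      mul_le_mul_of_nonneg_left (by linarith [(hinter (j + 1)).2]) hm.le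
    calc (((j + 1 : ℕ) : ℝ) - 1) * R b = j * R b := by push_cast; ring
      _ ≤ κ ^ (2 * (j + 1 + 1)) * (m * (g b - g^[j + 1] b)) := h1
      _ ≤ κ ^ (2 * (j + 1 + 1)) * (((j + 1 : ℕ) : ℝ) * (κ ^ (2 * (j + 1 + 1)) * R a)) :=
        mul_le_mul_of_nonneg_left (h2.trans a4) hpowN.le
      _ = _ := by ring

theorem exists_le_sin {κ : ℝ} (hκ : 1 < κ) : ∃ η > 0, ∀ x, 0 < x → x < η → x ≤ κ * Real.sin x := by
  have h : Tendsto (fun x : ℝ => Real.sinc x) (𝓝 0) (𝓝 1) := by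
    have := Real.continuous_sinc.tendsto 0
    rwa [Real.sinc_zero] at this
  have hk : κ⁻¹ < 1 := inv_lt_one_of_one_lt₀ hκ
  obtain ⟨η, hη, h2⟩ := Metric.eventually_nhds_iff.1 (h.eventually (lt_mem_nhds hk))
  refine ⟨η, hη, fun x hx hxη => ?_⟩
  have h3 := h2 (y := x) (by rwa [Real.dist_eq, sub_zero, abs_of_pos hx])
  rw [Real.sinc_of_ne_zero hx.ne', lt_div_iff₀ hx, inv_mul_lt_iff₀ (by linarith)] at h3
  exact h3.le

theorem div_le_mul_sin_div {κ x y : ℝ} (hy : 0 < y) (hs : 0 < Real.sin y)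
    (h : x ≤ κ * Real.sin x) (hx : 0 ≤ x) : x / y ≤ κ * (Real.sin x / Real.sin y) := by
  rw [mul_div_assoc', div_le_div_iff₀ hy hs]
  exact mul_le_mul h (Real.sin_le hy.le) hs.le (hx.trans h)

theorem sin_div_le_mul_div {κ x y : ℝ} (hy : 0 < y) (hs : 0 < Real.sin y)
    (h : y ≤ κ * Real.sin y) (hx : 0 ≤ x) : Real.sin x / Real.sin y ≤ κ * (x / y) := by
  rw [mul_div_assoc', div_le_div_iff₀ hs hy]
  calc Real.sin x * y ≤ x * (κ * Real.sin y) := mul_le_mul (Real.sin_le hx) h hy.le hx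
    _ = _ := by ring

/-- Lower bound for `fore` between two points at distance `ρ / l` and `ρ / r` on the two sides of a
jump of the curvature radius from `l` to `r`, in terms of the four tangent lengths involved. The
quotient of sines `q` weighs the two sides, and `d` is its excess over the value `1 / 2` that it has
without a jump. -/
theorem jump_lower {κ ρ d X Y Z q : ℝ} (hκ : 1 ≤ κ) (hρ : 0 ≤ ρ) (hd : 0 ≤ d)
    (hX : ρ / 2 ≤ κ * X) (hY : ρ / 2 ≤ κ * Y) (hZ : ρ / 2 ≤ κ * Z) (hq : 1 / 2 + d ≤ κ * q) :
    ρ * (1 + d) ≤ κ ^ 2 * (X + (Y + Z) * q) := by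
  have h1 : ρ ≤ κ * (Y + Z) := by linarith
  have h2 : ρ * (1 / 2 + d) ≤ κ * (Y + Z) * (κ * q) :=
    mul_le_mul h1 hq (by linarith) (hρ.trans h1)
  have h3 : κ * X ≤ κ * (κ * X) := le_mul_of_one_le_left (by linarith) hκ
  calc ρ * (1 + d) = ρ / 2 + ρ * (1 / 2 + d) := by ring
    _ ≤ κ * (κ * X) + κ * (Y + Z) * (κ * q) := by linarith
    _ = _ := by ring

/-- The upper bound for `back` that corresponds to `jump_lower`. -/
theorem jump_upper {κ ρ d X Y Z q : ℝ} (hκ : 1 ≤ κ) (hρ : 0 ≤ ρ)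
    (hX : X ≤ κ * (ρ / 2)) (hY : Y ≤ κ * (ρ / 2)) (hZ : Z ≤ κ * (ρ / 2)) (hq0 : 0 ≤ q)
    (hq : q ≤ κ * (1 / 2 - d)) : X + (Y + Z) * q ≤ κ ^ 2 * (ρ * (1 - d)) := by
  have h1 : Y + Z ≤ κ * ρ := by linarith
  have h2 : (Y + Z) * q ≤ κ * ρ * (κ * (1 / 2 - d)) :=
    mul_le_mul h1 hq hq0 (mul_nonneg (by linarith) hρ)
  have h3 : κ * (ρ / 2) ≤ κ * (κ * (ρ / 2)) :=
    le_mul_of_one_le_left (mul_nonneg (by linarith) (by linarith)) hκ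
  calc X + (Y + Z) * q ≤ κ * (κ * (ρ / 2)) + κ * ρ * (κ * (1 / 2 - d)) := by linarith
    _ = _ := by ring

/-- Constants for the comparison at a jump: `d` measures the jump, `n` is a number of steps and `κ`
the precision of the local approximation. -/
theorem exists_jump_constants {d : ℝ} (hd : 0 < d) (hd1 : d < 1) : ∃ (n : ℕ) (κ : ℝ), 1 ≤ n ∧
    1 < κ ∧ κ < 2 ∧ (n + 1) * κ ^ (4 * (n + 1) + 2) < n * (1 + d) ∧
    n * (1 - d) * κ ^ (4 * (n + 1) + 2) < n - 1 := by
  obtain ⟨n, hn⟩ := exists_nat_gt (1 / d)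
  rw [div_lt_iff₀ hd] at hn
  have hn0 : 1 ≤ n := by
    rcases Nat.eq_zero_or_pos n with rfl | h
    · simp at hn; linarith
    · exact h
  have hc1 : ContinuousAt (fun κ : ℝ => ((n : ℝ) + 1) * κ ^ (4 * (n + 1) + 2)) 1 := by fun_prop
  have hc2 : ContinuousAt (fun κ : ℝ => (n : ℝ) * (1 - d) * κ ^ (4 * (n + 1) + 2)) 1 := by fun_prop
  have e1 := hc1.tendsto.eventually_lt_const (u := n * (1 + d)) (by rw [one_pow]; linarith)
  have e2 := hc2.tendsto.eventually_lt_const (u := (n : ℝ) - 1) (by rw [one_pow]; linarith)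
  obtain ⟨κ, ⟨h1, h2⟩, h3⟩ := (((e1.and e2).filter_mono nhdsWithin_le_nhds).and
    (Ioo_mem_nhdsGT (show (1 : ℝ) < 2 by norm_num))).exists
  exact ⟨n, κ, hn0, h3.1, h3.2, h1, h2⟩

theorem jump_compare {n : ℕ} {κ ρ d X Y R R' : ℝ} (hn : 1 ≤ n) (hκ : 0 < κ) (hρ : 0 < ρ)
    (hc1 : (n + 1) * κ ^ (4 * (n + 1) + 2) < n * (1 + d))
    (hc2 : n * (1 - d) * κ ^ (4 * (n + 1) + 2) < n - 1)
    (hX : ρ * (1 + d) ≤ κ ^ 2 * X) (hY : Y ≤ κ ^ 2 * (ρ * (1 - d)))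
    (hR : n * R ≤ (n + 1) * (κ ^ (4 * (n + 1)) * ρ))
    (hR' : (n - 1) * ρ ≤ n * (κ ^ (4 * (n + 1)) * R')) : R < X ∧ Y < R' := by
  have hpow : κ ^ (4 * (n + 1) + 2) = κ ^ (4 * (n + 1)) * κ ^ 2 := pow_add _ _ _
  rw [hpow] at hc1 hc2
  have hP4 : 0 < κ ^ (4 * (n + 1)) := by positivity
  have hκsq : 0 < κ ^ 2 := by positivity
  generalize κ ^ (4 * (n + 1)) = P at *
  generalize κ ^ 2 = K at *
  have hn0 : (0 : ℝ) < n := by exact_mod_cast hn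
  constructor
  · have h1 : n * K * R < n * K * X :=
      calc n * K * R = K * (n * R) := by ring
        _ ≤ K * ((n + 1) * (P * ρ)) := by gcongr
        _ = ((n + 1) * (P * K)) * ρ := by ring
        _ < n * (1 + d) * ρ := mul_lt_mul_of_pos_right hc1 hρ
        _ = n * (ρ * (1 + d)) := by ring
        _ ≤ n * (K * X) := by gcongr
        _ = _ := by ring
    exact lt_of_mul_lt_mul_left h1 (by positivity)
  · have h1 : n * P * Y < n * P * R' :=
      calc n * P * Y ≤ n * P * (K * (ρ * (1 - d))) := by gcongr
        _ = n * (1 - d) * (P * K) * ρ := by ring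
        _ < (n - 1) * ρ := mul_lt_mul_of_pos_right hc2 hρ
        _ ≤ n * (P * R') := hR'
        _ = _ := by ring
    exact lt_of_mul_lt_mul_left h1 (by positivity)

/-- A jump downwards. If the radius `ρ` over `θ₀` were small, then the radii over `θ₀ - ρ / (2 m)` and
`θ₀ + ρ / (2 k)` would be close to `ρ`, but the tangent lines at these angles meet at a point which
is farther than `ρ` from the first and closer than `ρ` to the second point of tangency. -/
theorem exists_le_of_jump_aux (hα : IsSupportCurve α) {θ₀ m k : ℝ} (hk : 0 < k) (hkm : k < m)
    (hleft : ∀ κ > 1, ∃ δ > 0, IsNearlyCircular α κ m (θ₀ - δ) θ₀)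
    (hright : ∀ κ > 1, ∃ δ > 0, IsNearlyCircular α κ k θ₀ (θ₀ + δ)) :
    ∃ ε > 0, ∀ R, IsInvariantRadius α R → ε ≤ R θ₀ := by
  have hm : 0 < m := hk.trans hkm
  have hmk : 0 < m + k := by linarith
  obtain ⟨d, hd⟩ : ∃ d, d = (m - k) / (2 * (m + k)) := ⟨_, rfl⟩
  have hd0 : 0 < d := by rw [hd]; exact div_pos (by linarith) (by linarith)
  have hd1 : d < 1 := by rw [hd, div_lt_one (by linarith)]; linarith
  obtain ⟨n, κ, hn, hκ1, hκ2, hc1, hc2⟩ := exists_jump_constants hd0 hd1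
  have hκ0 : 0 < κ := by linarith
  obtain ⟨δ₁, hδ₁, hL⟩ := hleft κ hκ1
  obtain ⟨δ₂, hδ₂, hRt⟩ := hright κ hκ1
  obtain ⟨η, hη, hsin⟩ := exists_le_sin hκ1
  have hn0 : (0 : ℝ) < n := by exact_mod_cast hn
  have hc : 0 < ((n : ℝ) + 1) * κ ^ (2 * (n + 1)) := by positivity
  obtain ⟨ε, hε, hε1, hε2, hε3, hε4⟩ : ∃ ε > 0, (n + 1) * κ ^ (2 * (n + 1)) * ε ≤ m * δ₁ ∧
      (n + 1) * κ ^ (2 * (n + 1)) * ε ≤ k * δ₂ ∧ ε / k ≤ η ∧ ε / k ≤ Real.pi := by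
    have hpi := Real.pi_pos
    refine ⟨min (min (m * δ₁ / ((n + 1) * κ ^ (2 * (n + 1)))) (k * δ₂ / ((n + 1) * κ ^ (2 * (n + 1)))))
      (min (η * k) (Real.pi * k)), by positivity, ?_, ?_, ?_, ?_⟩
    · rw [← le_div_iff₀' hc]
      exact (min_le_left _ _).trans (min_le_left _ _)
    · rw [← le_div_iff₀' hc]
      exact (min_le_left _ _).trans (min_le_right _ _)
    · rw [div_le_iff₀ hk]
      exact (min_le_right _ _).trans (min_le_left _ _)
    · rw [div_le_iff₀ hk]
      exact (min_le_right _ _).trans (min_le_right _ _)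
  refine ⟨ε, hε, fun R hR => ?_⟩
  by_contra hcon
  push Not at hcon
  obtain ⟨ρ, hρ⟩ : ∃ ρ, ρ = R θ₀ := ⟨_, rfl⟩
  rw [← hρ] at hcon
  have hρ0 : 0 < ρ := hρ ▸ hR.pos θ₀
  obtain ⟨A, hA⟩ : ∃ A, A = ρ / (2 * m) := ⟨_, rfl⟩
  obtain ⟨C, hC⟩ : ∃ C, C = ρ / (2 * k) := ⟨_, rfl⟩
  have hA0 : 0 < A := by rw [hA]; positivity
  have hC0 : 0 < C := by rw [hC]; positivity
  have hmA : m * A = ρ / 2 := by rw [hA]; field_simp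
  have hkC : k * C = ρ / 2 := by rw [hC]; field_simp
  have hAC : A < C := by
    rw [hA, hC]
    exact div_lt_div_of_pos_left hρ0 (by linarith) (by linarith)
  have hACη : C + A < ε / k := by
    have : C + C = ρ / k := by rw [hC]; field_simp; norm_num
    have h2 : ρ / k < ε / k := div_lt_div_of_pos_right hcon hk
    linarith
  have hP1 : 1 ≤ κ ^ (2 * (n + 1)) := one_le_pow₀ hκ1.le
  have hρP : ρ ≤ (n + 1) * κ ^ (2 * (n + 1)) * ρ :=
    le_mul_of_one_le_left hρ0.le (by nlinarith)
  have hA1 : A ≤ δ₁ := by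
    have : m * A ≤ m * δ₁ := by linarith [mul_le_mul_of_nonneg_left hcon.le hc.le]
    exact le_of_mul_le_mul_left this hm
  have hC1 : C ≤ δ₂ := by
    have : k * C ≤ k * δ₂ := by linarith [mul_le_mul_of_nonneg_left hcon.le hc.le]
    exact le_of_mul_le_mul_left this hk
  -- the radius is nearly constant on both sides of `θ₀`
  have hcρ := mul_lt_mul_of_pos_left hcon hc
  have hκρ : κ * (ρ / 2) ≤ ρ := by nlinarith
  have hRa := (hR.radius_left hα hκ1.le hm hL hn
    (by rw [← mul_assoc, ← hρ]; exact hcρ.trans_le hε1) (a := θ₀ - A)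
    (by linarith) (by rw [sub_sub_cancel, hmA, ← hρ]; exact hκρ)).1
  have hRc := (hR.mirror.radius_left hα.mirror hκ1.le hk (b := -θ₀) (δ := δ₂)
    (by have := hRt.mirror; rwa [neg_add'] at this) hn
    (by rw [← mul_assoc, neg_neg, ← hρ]; exact hcρ.trans_le hε2) (a := -θ₀ - C)
    (by linarith) (by rw [sub_sub_cancel, hkC, neg_neg, ← hρ]; exact hκρ)).2
  rw [neg_neg, show -(-θ₀ - C) = θ₀ + C by ring] at hRc
  rw [← hρ] at hRa hRc
  -- but the curve is not symmetric under reflection at `θ₀`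
  obtain ⟨a1, a2, a3, a4⟩ := hL (θ₀ - A) θ₀ (by linarith) (by linarith) le_rfl
  obtain ⟨c1, c2, c3, c4⟩ := hRt θ₀ (θ₀ + C) le_rfl (by linarith) (by linarith)
  rw [sub_sub_cancel, hmA] at a1 a2 a3 a4
  rw [add_sub_cancel_left, hkC] at c1 c2 c3 c4
  have hπ : θ₀ + C < θ₀ - A + Real.pi := by linarith
  have hX := fore_add (α := α) (a := θ₀ - A) (b := θ₀) (c := θ₀ + C) (by linarith) (by linarith) hπ
  have hY := back_add (α := α) (a := θ₀ - A) (b := θ₀) (c := θ₀ + C) (by linarith) (by linarith) hπ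
  rw [add_sub_cancel_left, show θ₀ + C - (θ₀ - A) = C + A by ring] at hX
  rw [sub_sub_cancel, show θ₀ + C - (θ₀ - A) = C + A by ring] at hY
  have hs0 : 0 < Real.sin (C + A) := Real.sin_pos_of_pos_of_lt_pi (by linarith) (by linarith)
  have hfracC : C / (C + A) = m / (m + k) := by
    rw [hC, hA]; field_simp
  have hfracA : A / (C + A) = k / (m + k) := by
    rw [hC, hA]; field_simp
  have hq1 : m / (m + k) ≤ κ * (Real.sin C / Real.sin (C + A)) := by
    rw [← hfracC]
    exact div_le_mul_sin_div (by linarith) hs0 (hsin C hC0 (by linarith)) hC0.le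
  have hq2 : Real.sin A / Real.sin (C + A) ≤ κ * (k / (m + k)) := by
    rw [← hfracA]
    exact sin_div_le_mul_div (by linarith) hs0 (hsin (C + A) (by linarith) (by linarith)) hA0.le
  have hq3 : 0 ≤ Real.sin A / Real.sin (C + A) :=
    div_nonneg (Real.sin_nonneg_of_nonneg_of_le_pi hA0.le (by linarith)) hs0.le
  have hmd : m / (m + k) = 1 / 2 + d := by rw [hd]; field_simp; ring
  have hkd : k / (m + k) = 1 / 2 - d := by rw [hd]; field_simp; ring
  rw [hmd] at hq1
  rw [hkd] at hq2
  have hd2 : d < 1 / 2 := by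
    have : 0 < k / (m + k) := div_pos hk hmk
    linarith
  have hXlow : ρ * (1 + d) ≤ κ ^ 2 * fore α (θ₀ - A) (θ₀ + C) := by
    rw [hX]
    exact jump_lower hκ1.le hρ0.le hd0.le a1 c1 a3 hq1
  have hYupp : back α (θ₀ - A) (θ₀ + C) ≤ κ ^ 2 * (ρ * (1 - d)) := by
    rw [hY]
    exact jump_upper hκ1.le hρ0.le c4 c2 a4 hq3 hq2
  obtain ⟨h1, h2⟩ := jump_compare (R := R (θ₀ - A)) (R' := R (θ₀ + C)) hn hκ0 hρ0 hc1 hc2 hXlow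
    hYupp hRa hRc
  exact absurd ((hR.gt_iff hα (by linarith) hπ).1 h1) (not_lt.2 h2.le)

/-- If the curvature radius has different positive one-sided limits `2 m` and `2 k` at `θ₀`, then
an invariant region reaches over `θ₀` at least up to a bound depending on the curve only. -/
theorem exists_le_of_jump (hα : IsSupportCurve α) {θ₀ m k : ℝ} (hm : 0 < m) (hk : 0 < k)
    (hkm : m ≠ k) (hleft : ∀ κ > 1, ∃ δ > 0, IsNearlyCircular α κ m (θ₀ - δ) θ₀)
    (hright : ∀ κ > 1, ∃ δ > 0, IsNearlyCircular α κ k θ₀ (θ₀ + δ)) :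
    ∃ ε > 0, ∀ R, IsInvariantRadius α R → ε ≤ R θ₀ := by
  rcases lt_or_gt_of_ne hkm with h | h
  · obtain ⟨ε, hε, h2⟩ := exists_le_of_jump_aux hα.mirror (θ₀ := -θ₀) hm h
      (fun κ hκ => by
        obtain ⟨δ, hδ, h1⟩ := hright κ hκ
        exact ⟨δ, hδ, by have := h1.mirror; rwa [neg_add'] at this⟩)
      (fun κ hκ => by
        obtain ⟨δ, hδ, h1⟩ := hleft κ hκ
        refine ⟨δ, hδ, ?_⟩
        have := h1.mirror
        rwa [neg_sub, show δ - θ₀ = -θ₀ + δ by ring] at this)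
    refine ⟨ε, hε, fun R hR => ?_⟩
    simpa using h2 _ hR.mirror
  · exact exists_le_of_jump_aux hα hk h hleft hright

end

/-! ### The point of tangency of a convex body -/

section

variable {Γ : Set ℂ}

theorem inner_unitVec (z : ℂ) (θ : ℝ) : inner ℝ z (unitVec θ) = proj z θ := by
  rw [Complex.inner]; simp [unitVec, proj]; ring

theorem inner_dirVec (z : ℂ) (θ : ℝ) : inner ℝ z (dirVec θ) = proj z (θ + Real.pi / 2) := by
  rw [Complex.inner]; simp [dirVec, proj, Real.cos_add_pi_div_two, Real.sin_add_pi_div_two]; ring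

theorem continuous_proj_left (θ : ℝ) : Continuous fun z => proj z θ := by
  unfold proj; fun_prop

theorem eq_proj_smul_add (z : ℂ) (θ : ℝ) :
    proj z θ • unitVec θ + proj z (θ + Real.pi / 2) • dirVec θ = z := by
  have e1 := Real.sin_sq_add_cos_sq θ
  apply Complex.ext
  · simp only [Complex.add_re, Complex.smul_re, unitVec, dirVec, smul_eq_mul, proj,
      Real.cos_add_pi_div_two, Real.sin_add_pi_div_two]
    linear_combination z.re * e1
  · simp only [Complex.add_im, Complex.smul_im, unitVec, dirVec, smul_eq_mul, proj,
      Real.cos_add_pi_div_two, Real.sin_add_pi_div_two]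
    linear_combination z.im * e1

section Convex

variable {K : Set ℂ}

/-- The maximum of a linear functional over a compact set is attained on the frontier. -/
theorem exists_frontier_isMax (hK : IsCompact K) (hne : K.Nonempty) (θ : ℝ) :
    ∃ w ∈ frontier K, ∀ z ∈ K, proj z θ ≤ proj w θ := by
  obtain ⟨w, hw, hmax⟩ := hK.exists_isMaxOn hne (continuous_proj_left θ).continuousOn
  refine ⟨w, ⟨subset_closure hw, fun hint => ?_⟩, fun z hz => hmax hz⟩
  obtain ⟨ε, hε, hball⟩ := Metric.isOpen_iff.1 isOpen_interior w hint
  have hu : ‖unitVec θ‖ = 1 := by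
    rw [Complex.norm_def, Complex.normSq_apply]
    simp [unitVec, ← sq]
  have hmem : w + (ε / 2) • unitVec θ ∈ K := interior_subset (hball (by
    rw [Metric.mem_ball, dist_eq_norm, add_sub_cancel_left, norm_smul, hu, mul_one,
      Real.norm_of_nonneg (by positivity)]
    linarith))
  have h1 : proj (w + (ε / 2) • unitVec θ) θ ≤ proj w θ := hmax hmem
  rw [proj_add] at h1
  have h2 : proj ((ε / 2) • unitVec θ) θ = ε / 2 := by
    simp only [proj, unitVec, Complex.smul_re, Complex.smul_im, smul_eq_mul]
    linear_combination (ε / 2) * Real.sin_sq_add_cos_sq θ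
  linarith

/-- The supremum in `height` is attained, and bounds the functional on all of `K`. -/
theorem isGreatest_height (hK : IsCompact K) (hne : K.Nonempty) (θ : ℝ) :
    ∃ w ∈ frontier K, proj w θ = height (frontier K) θ ∧
      ∀ z ∈ K, proj z θ ≤ height (frontier K) θ := by
  obtain ⟨w, hw, hmax⟩ := exists_frontier_isMax hK hne θ
  have hsub : frontier K ⊆ K := hK.isClosed.frontier_subset
  have hg : IsGreatest ((fun z : ℂ => inner ℝ z (unitVec θ)) '' frontier K) (proj w θ) := by
    refine ⟨⟨w, hw, inner_unitVec w θ⟩, ?_⟩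
    rintro _ ⟨z, hz, rfl⟩
    simp only [inner_unitVec]
    exact hmax z (hsub hz)
  have : height (frontier K) θ = proj w θ := hg.csSup_eq
  exact ⟨w, hw, this.symm, fun z hz => this ▸ hmax z hz⟩

/-- The supremum in `tangencyPoint` is attained. -/
theorem tangencyPoint_mem (hK : IsCompact K) (hne : K.Nonempty) (θ : ℝ) :
    tangencyPoint (frontier K) θ ∈ supportFace (frontier K) θ := by
  obtain ⟨w, hw, hwh, -⟩ := isGreatest_height hK hne θ
  have hcomp : IsCompact (supportFace (frontier K) θ) := by
    have hc : IsCompact (frontier K) := hK.of_isClosed_subset isClosed_frontier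
      hK.isClosed.frontier_subset
    refine hc.inter_right (t := {z | inner ℝ z (unitVec θ) = height (frontier K) θ}) ?_
    exact isClosed_eq (by fun_prop) continuous_const
  have hfne : (supportFace (frontier K) θ).Nonempty := ⟨w, hw, by rw [inner_unitVec, hwh]⟩
  obtain ⟨y, hy, hmax⟩ := hcomp.exists_isMaxOn hfne
    (f := fun z : ℂ => (inner ℝ z (dirVec θ) : ℝ)) (by fun_prop)
  have hg : IsGreatest ((fun z : ℂ => inner ℝ z (dirVec θ)) '' supportFace (frontier K) θ)
      (inner ℝ y (dirVec θ)) := by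
    refine ⟨⟨y, hy, rfl⟩, ?_⟩
    rintro _ ⟨z, hz, rfl⟩
    exact hmax hz
  have heq : tangencyPoint (frontier K) θ = y := by
    unfold tangencyPoint
    rw [hg.csSup_eq, ← hy.2, inner_unitVec, inner_dirVec, eq_proj_smul_add]
  rw [heq]
  exact hy

theorem proj_tangencyPoint (hK : IsCompact K) (hne : K.Nonempty) (θ : ℝ) :
    proj (tangencyPoint (frontier K) θ) θ = height (frontier K) θ := by
  rw [← inner_unitVec]
  exact (tangencyPoint_mem hK hne θ).2

theorem tangencyPoint_mem_frontier (hK : IsCompact K) (hne : K.Nonempty) (θ : ℝ) :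
    tangencyPoint (frontier K) θ ∈ frontier K := (tangencyPoint_mem hK hne θ).1

theorem proj_le_proj_tangencyPoint (hK : IsCompact K) {z : ℂ} (hz : z ∈ K) (θ : ℝ) :
    proj z θ ≤ proj (tangencyPoint (frontier K) θ) θ := by
  rw [proj_tangencyPoint hK ⟨z, hz⟩]
  obtain ⟨-, -, -, h⟩ := isGreatest_height hK ⟨z, hz⟩ θ
  exact h z hz

theorem tangencyPoint_periodic (Γ : Set ℂ) (θ : ℝ) :
    tangencyPoint Γ (θ + 2 * Real.pi) = tangencyPoint Γ θ := by
  have h1 : unitVec (θ + 2 * Real.pi) = unitVec θ := by simp [unitVec]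
  have h2 : dirVec (θ + 2 * Real.pi) = dirVec θ := by simp [dirVec]
  simp only [tangencyPoint, supportFace, height, h1, h2]

/-- A body with interior points has positive width in every direction. -/
theorem tangencyPoint_width (hK : IsCompact K) (hint : (interior K).Nonempty) (θ : ℝ) :
    proj (tangencyPoint (frontier K) (θ + Real.pi)) θ < proj (tangencyPoint (frontier K) θ) θ := by
  obtain ⟨o, ho⟩ := hint
  have hoK := interior_subset ho
  have h1 := proj_le_proj_tangencyPoint hK hoK (θ + Real.pi)
  rw [proj_add_pi, proj_add_pi] at h1
  obtain ⟨w, hw, hmax⟩ := exists_frontier_isMax hK ⟨o, hoK⟩ θ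
  obtain ⟨ε, hε, hball⟩ := Metric.isOpen_iff.1 isOpen_interior o ho
  have hu : ‖unitVec θ‖ = 1 := by
    rw [Complex.norm_def, Complex.normSq_apply]
    simp [unitVec, ← sq]
  have hmem : o + (ε / 2) • unitVec θ ∈ K := interior_subset (hball (by
    rw [Metric.mem_ball, dist_eq_norm, add_sub_cancel_left, norm_smul, hu, mul_one,
      Real.norm_of_nonneg (by positivity)]
    linarith))
  have h2 := proj_le_proj_tangencyPoint hK hmem θ
  rw [proj_add] at h2
  have h3 : proj ((ε / 2) • unitVec θ) θ = ε / 2 := by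
    simp only [proj, unitVec, Complex.smul_re, Complex.smul_im, smul_eq_mul]
    linear_combination (ε / 2) * Real.sin_sq_add_cos_sq θ
  linarith

/-- A compact convex set is cut out by its supporting half-planes. -/
theorem notMem_iff_exists_lt_proj (hK : IsCompact K) (hc : Convex ℝ K) (hne : K.Nonempty) {z : ℂ} :
    z ∉ K ↔ ∃ θ, proj (tangencyPoint (frontier K) θ) θ < proj z θ := by
  constructor
  · intro hz
    obtain ⟨f, u, hf1, hf2⟩ := geometric_hahn_banach_closed_point hc hK.isClosed hz
    set w : ℂ := ⟨f 1, f Complex.I⟩ with hw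
    have hf : ∀ y : ℂ, f y = y.re * w.re + y.im * w.im := fun y => by
      have hy : y = y.re • (1 : ℂ) + y.im • Complex.I := by
        apply Complex.ext <;> simp
      conv_lhs => rw [hy]
      rw [map_add, map_smul, map_smul]
      simp [hw]
    have hp : ∀ y : ℂ, f y = ‖w‖ * proj y w.arg := fun y => by
      rw [hf]
      have h1 := Complex.norm_mul_cos_arg w
      have h2 := Complex.norm_mul_sin_arg w
      unfold proj
      linear_combination -y.re * h1 - y.im * h2
    refine ⟨w.arg, ?_⟩
    have h1 := hf1 _ (hK.isClosed.frontier_subset (tangencyPoint_mem_frontier hK hne w.arg))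
    have h2 := h1.trans hf2
    rw [hp, hp] at h2
    exact lt_of_mul_lt_mul_left h2 (norm_nonneg w)
  · rintro ⟨θ, hθ⟩ hz
    exact absurd (proj_le_proj_tangencyPoint hK hz θ) (not_le.2 hθ)

/-- The exterior of the boundary of a planar compact convex set is the complement of the set. -/
theorem exteriorRegion_frontier (hK : IsCompact K) (hc : Convex ℝ K) (hne : K.Nonempty) :
    exteriorRegion (frontier K) = Kᶜ := by
  ext z
  simp only [exteriorRegion, mem_compl_iff]
  constructor
  · rintro ⟨hz, hunb⟩ hzK
    refine hunb (hK.isBounded.subset ?_)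
    have hzi : z ∈ interior K := by
      by_contra h
      exact hz ⟨subset_closure hzK, h⟩
    have hpre : IsPreconnected (connectedComponentIn (frontier K)ᶜ z) :=
      isPreconnected_connectedComponentIn
    have hsub := connectedComponentIn_subset (frontier K)ᶜ z
    refine (hpre.subset_of_closure_inter_subset isOpen_interior
      ⟨z, mem_connectedComponentIn hz, hzi⟩ ?_).trans interior_subset
    rintro y ⟨hy, hyc⟩
    by_contra h
    exact hsub hyc ⟨closure_mono interior_subset hy, h⟩
  · intro hz
    have hzΓ : z ∉ frontier K := fun h => hz (hK.isClosed.frontier_subset h)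
    refine ⟨hzΓ, fun hb => ?_⟩
    obtain ⟨θ, hθ⟩ := (notMem_iff_exists_lt_proj hK hc hne).1 hz
    have hp : ∀ t : ℝ, proj (z + t • unitVec θ) θ = proj z θ + t := fun t => by
      rw [proj_add]
      congr 1
      simp only [proj, unitVec, Complex.smul_re, Complex.smul_im, smul_eq_mul]
      linear_combination t * Real.sin_sq_add_cos_sq θ
    have hray : (fun t : ℝ => z + t • unitVec θ) '' Ici 0 ⊆
        connectedComponentIn (frontier K)ᶜ z := by
      refine (isPreconnected_Ici.image _ (by fun_prop)).subset_connectedComponentIn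
        ⟨0, by simp, by simp⟩ ?_
      rintro _ ⟨t, ht, rfl⟩ hmem
      have h1 := proj_le_proj_tangencyPoint hK (hK.isClosed.frontier_subset hmem) θ
      rw [hp] at h1
      have ht : 0 ≤ t := ht
      linarith
    obtain ⟨M, hM⟩ := (hb.subset hray).exists_norm_le
    set t := |M| + |proj z θ| + 1
    have ht : 0 ≤ t := by positivity
    have h1 := hM _ ⟨t, ht, rfl⟩
    have h2 := (le_abs_self _).trans (abs_proj_le (z + t • unitVec θ) θ)
    rw [hp] at h2
    linarith [le_abs_self M, neg_abs_le (proj z θ)]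

end Convex

end

/-! ### Arclength and tangent lengths -/

section

/-- The functional `z ↦ z · n_c` controls the length of chords with nearby normal directions. -/
theorem norm_mul_cos_le {α : ℝ → ℂ} (hsupp : ∀ θ φ, proj (α φ) θ ≤ proj (α θ) θ) {p q θ φ c : ℝ}
    (hpq : q - p < Real.pi / 2) (h1 : p ≤ θ) (h2 : θ ≤ φ) (h3 : φ ≤ q) (hc : c ∈ Icc p q) :
    ‖α φ - α θ‖ * Real.cos (q - p) ≤ proj (α φ - α θ) (c + Real.pi / 2) := by
  rcases h2.eq_or_lt with rfl | h2
  · simp [proj]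
  have hpi := Real.pi_pos
  have h4 : φ < θ + Real.pi := by linarith
  have hX : 0 ≤ fore α θ φ := by
    refine div_nonneg ?_ (sin_sub_pos h2 h4).le
    rw [proj_sub]; linarith [hsupp φ θ]
  have hY : 0 ≤ back α θ φ := by
    refine div_nonneg ?_ (sin_sub_pos h2 h4).le
    rw [proj_sub]; linarith [hsupp θ φ]
  have hcos : ∀ x ∈ Icc p q, Real.cos (q - p) ≤ Real.cos (c - x) := fun x hx => by
    rw [← Real.cos_abs (c - x)]
    refine Real.cos_le_cos_of_nonneg_of_le_pi (abs_nonneg _) (by linarith) ?_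
    rw [abs_le]
    constructor <;> linarith [hx.1, hx.2, hc.1, hc.2]
  have hc0 : 0 ≤ Real.cos (q - p) :=
    Real.cos_nonneg_of_mem_Icc ⟨by linarith [hc.1, hc.2], hpq.le⟩
  rw [sub_eq_fore_add_back h2 h4, proj_add, proj_smul_dirVec, proj_smul_dirVec,
    show c + Real.pi / 2 - θ = (c - θ) + Real.pi / 2 by ring, Real.sin_add_pi_div_two,
    show c + Real.pi / 2 - φ = (c - φ) + Real.pi / 2 by ring, Real.sin_add_pi_div_two]
  have hn : ‖fore α θ φ • dirVec θ + back α θ φ • dirVec φ‖ ≤ fore α θ φ + back α θ φ := by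
    refine (norm_add_le _ _).trans_eq ?_
    rw [norm_smul, norm_smul, norm_dirVec, norm_dirVec, Real.norm_of_nonneg hX,
      Real.norm_of_nonneg hY, mul_one, mul_one]
  calc _ ≤ (fore α θ φ + back α θ φ) * Real.cos (q - p) := by gcongr
    _ = fore α θ φ * Real.cos (q - p) + back α θ φ * Real.cos (q - p) := by ring
    _ ≤ _ := add_le_add (mul_le_mul_of_nonneg_left (hcos θ ⟨h1, by linarith⟩) hX)
      (mul_le_mul_of_nonneg_left (hcos φ ⟨by linarith, h3⟩) hY)

theorem eVariationOn_le {α : ℝ → ℂ} (hsupp : ∀ θ φ, proj (α φ) θ ≤ proj (α θ) θ) {p q c : ℝ}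
    (hpq : q - p < Real.pi / 2) (hc : c ∈ Icc p q) :
    eVariationOn α (Icc p q) ≤
      ENNReal.ofReal (proj (α q - α p) (c + Real.pi / 2) / Real.cos (q - p)) := by
  have hpq0 : p ≤ q := hc.1.trans hc.2
  have hcos : 0 < Real.cos (q - p) :=
    Real.cos_pos_of_mem_Ioo ⟨by linarith [Real.pi_pos], hpq⟩
  set F : ℝ → ℝ := fun θ => proj (α θ) (c + Real.pi / 2) / Real.cos (q - p) with hF
  have hstep : ∀ θ φ, p ≤ θ → θ ≤ φ → φ ≤ q → ‖α φ - α θ‖ ≤ F φ - F θ := fun θ φ h1 h2 h3 => by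
    rw [hF]
    simp only
    rw [← sub_div, ← proj_sub, le_div_iff₀ hcos]
    exact norm_mul_cos_le hsupp hpq h1 h2 h3 hc
  refine iSup_le ?_
  rintro ⟨n, u, hu, hmem⟩
  have h1 : ∀ i ∈ Finset.range n, edist (α (u (i + 1))) (α (u i)) ≤
      ENNReal.ofReal (F (u (i + 1)) - F (u i)) := fun i _ => by
    rw [edist_dist, dist_eq_norm]
    exact ENNReal.ofReal_le_ofReal (hstep _ _ (hmem i).1 (hu (Nat.le_succ i)) (hmem (i + 1)).2)
  have h0 : ∀ i ∈ Finset.range n, 0 ≤ F (u (i + 1)) - F (u i) := fun i _ =>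
    (norm_nonneg _).trans (hstep _ _ (hmem i).1 (hu (Nat.le_succ i)) (hmem (i + 1)).2)
  refine (Finset.sum_le_sum h1).trans ?_
  rw [← ENNReal.ofReal_sum_of_nonneg h0, Finset.sum_range_sub (fun i => F (u i))]
  apply ENNReal.ofReal_le_ofReal
  have e1 := (norm_nonneg _).trans (hstep p (u 0) le_rfl (hmem 0).1 (hmem 0).2)
  have e2 := (norm_nonneg _).trans (hstep (u n) q (hmem n).1 (hmem n).2 le_rfl)
  have e3 : F q - F p = proj (α q - α p) (c + Real.pi / 2) / Real.cos (q - p) := by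
    rw [hF]
    simp only
    rw [← sub_div, ← proj_sub]
  linarith

theorem locallyBoundedVariationOn_of_support {α : ℝ → ℂ}
    (hsupp : ∀ θ φ, proj (α φ) θ ≤ proj (α θ) θ) : LocallyBoundedVariationOn α univ := by
  have h : ∀ n : ℕ, ∀ p : ℝ, eVariationOn α (Icc p (p + n)) < ⊤ := by
    intro n p
    induction n with
    | zero =>
      have : eVariationOn α (Icc p (p + (0 : ℕ))) = 0 := by
        apply eVariationOn.subsingleton
        simp
      rw [this]; exact ENNReal.zero_lt_top
    | succ n ih =>
      have := eVariationOn.Icc_add_Icc α (s := univ) (a := p) (b := p + n) (c := p + (n + 1 : ℕ))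
        (by simp) (by push_cast; linarith) (mem_univ _)
      simp only [univ_inter] at this
      rw [← this]
      refine ENNReal.add_lt_top.2 ⟨ih, lt_of_le_of_lt (eVariationOn_le hsupp (c := p + n) ?_ ?_)
        ENNReal.ofReal_lt_top⟩
      · push_cast; linarith [Real.pi_gt_three]
      · constructor
        · exact le_rfl
        · push_cast; linarith
  intro a b _ _
  obtain ⟨n, hn⟩ := exists_nat_ge (b - a)
  refine ((eVariationOn.mono α ?_).trans_lt (h n a)).ne
  rw [univ_inter]
  exact Icc_subset_Icc le_rfl (by linarith)

/-- `s` measures the length along the curve `α`: its increments are bounded below by chords, and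
above, over small angles, by the extent of a chord in any of the directions `n_c` in between. -/
structure IsLengthFunction (α : ℝ → ℂ) (s : ℝ → ℝ) : Prop where
  norm_le : ∀ p q, p ≤ q → ‖α q - α p‖ ≤ s q - s p
  le_proj : ∀ p q c, q - p < Real.pi / 2 → c ∈ Icc p q →
    (s q - s p) * Real.cos (q - p) ≤ proj (α q - α p) (c + Real.pi / 2)

theorem isLengthFunction_variation {α : ℝ → ℂ} (hsupp : ∀ θ φ, proj (α φ) θ ≤ proj (α θ) θ) :
    IsLengthFunction α (variationOnFromTo α univ 0) := by
  have hbv := locallyBoundedVariationOn_of_support hsupp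
  have hsub : ∀ p q, p ≤ q → variationOnFromTo α univ 0 q - variationOnFromTo α univ 0 p =
      (eVariationOn α (Icc p q)).toReal := fun p q hpq => by
    have := variationOnFromTo.add hbv (mem_univ 0) (mem_univ p) (mem_univ q)
    have h2 := variationOnFromTo.eq_of_le α univ hpq
    rw [univ_inter] at h2
    linarith
  have hfin : ∀ p q, eVariationOn α (Icc p q) ≠ ⊤ := fun p q => by
    have := hbv p q (mem_univ _) (mem_univ _)
    rwa [univ_inter] at this
  refine ⟨fun p q hpq => ?_, fun p q c hpq hc => ?_⟩
  · rw [hsub p q hpq, ← dist_eq_norm, ← ENNReal.ofReal_le_ofReal_iff ENNReal.toReal_nonneg,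
      ENNReal.ofReal_toReal (hfin p q), ← edist_dist]
    exact eVariationOn.edist_le α ⟨hpq, le_rfl⟩ ⟨le_rfl, hpq⟩
  · have hpq0 : p ≤ q := hc.1.trans hc.2
    have hcos : 0 < Real.cos (q - p) :=
      Real.cos_pos_of_mem_Ioo ⟨by linarith [Real.pi_pos], hpq⟩
    rw [hsub p q hpq0, ← le_div_iff₀ hcos]
    refine ENNReal.toReal_le_of_le_ofReal ?_ (eVariationOn_le hsupp hpq hc)
    refine div_nonneg ?_ hcos.le
    exact (mul_nonneg (norm_nonneg _) hcos.le).trans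
      (norm_mul_cos_le hsupp hpq le_rfl hpq0 le_rfl hc)

variable {α : ℝ → ℂ} {s : ℝ → ℝ}

theorem IsLengthFunction.mirror (h : IsLengthFunction α s) :
    IsLengthFunction (mirror α) fun θ => - s (-θ) where
  norm_le p q hpq := by
    have := h.norm_le (-q) (-p) (by linarith)
    unfold DualBilliards.mirror
    rw [← map_sub, RCLike.norm_conj, norm_sub_rev]
    linarith
  le_proj p q c hpq hc := by
    have := h.le_proj (-q) (-p) (-c) (by linarith) ⟨by linarith [hc.2], by linarith [hc.1]⟩
    unfold DualBilliards.mirror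
    rw [← map_sub, proj_conj]
    rw [show -p - -q = q - p by ring] at this
    have e : proj (α (-q) - α (-p)) (-(c + Real.pi / 2)) =
        proj (α (-p) - α (-q)) (-c + Real.pi / 2) := by
      rw [show -c + Real.pi / 2 = -(c + Real.pi / 2) + Real.pi by ring, proj_add_pi, proj_sub,
        proj_sub]
      ring
    rw [e]
    linarith

theorem IsLengthFunction.proj_le (h : IsLengthFunction α s) {p q : ℝ} (hpq : p ≤ q) (c : ℝ) :
    proj (α q - α p) c ≤ s q - s p :=
  ((le_abs_self _).trans (abs_proj_le _ _)).trans (h.norm_le p q hpq)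

theorem abs_proj_sub_proj_le (z : ℂ) (θ φ : ℝ) : |proj z φ - proj z θ| ≤ ‖z‖ * |φ - θ| := by
  have hd : ∀ x ∈ (univ : Set ℝ), HasDerivWithinAt (proj z) (proj z (x + Real.pi / 2)) univ x := by
    intro x _
    unfold proj
    rw [Real.cos_add_pi_div_two, Real.sin_add_pi_div_two]
    exact (((Real.hasDerivAt_cos x).const_mul z.re).add
      ((Real.hasDerivAt_sin x).const_mul z.im)).hasDerivWithinAt
  have := convex_univ.norm_image_sub_le_of_norm_hasDerivWithin_le hd
    (fun x _ => abs_proj_le z _) (mem_univ θ) (mem_univ φ)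
  simpa [Real.norm_eq_abs] using this

/-- The support function has derivative `α θ · n_θ`. -/
theorem IsSupportCurve.hasDerivAt_support (hα : IsSupportCurve α) (φ : ℝ) :
    HasDerivAt (fun ψ => proj (α ψ) ψ) (proj (α φ) (φ + Real.pi / 2)) φ := by
  have h1 : HasDerivAt (proj (α φ)) (proj (α φ) (φ + Real.pi / 2)) φ := by
    unfold proj
    rw [Real.cos_add_pi_div_two, Real.sin_add_pi_div_two]
    exact ((Real.hasDerivAt_cos φ).const_mul _).add ((Real.hasDerivAt_sin φ).const_mul _)
  have h2 : HasDerivAt (fun ψ => proj (α ψ - α φ) ψ) 0 φ := by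
    rw [hasDerivAt_iff_isLittleO]
    simp only [sub_self, smul_zero, sub_zero]
    have h3 : (fun ψ => ‖α ψ - α φ‖ * |ψ - φ|) =o[𝓝 φ] fun ψ => ψ - φ := by
      have h4 : Tendsto (fun ψ => ‖α ψ - α φ‖) (𝓝 φ) (𝓝 0) := by
        have : Continuous fun ψ => ‖α ψ - α φ‖ := by have := hα.continuous; fun_prop
        simpa using this.tendsto φ
      have := ((Asymptotics.isLittleO_one_iff ℝ).2 h4).mul_isBigO
        (Asymptotics.isBigO_refl (fun ψ => |ψ - φ|) (𝓝 φ))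
      refine (this.congr_right fun ψ => one_mul _).trans_isBigO ?_
      exact Asymptotics.IsBigO.of_bound 1 (Eventually.of_forall fun ψ => by simp)
    refine Asymptotics.IsBigO.trans_isLittleO (Asymptotics.IsBigO.of_bound 1
      (Eventually.of_forall fun ψ => ?_)) h3
    rw [Real.norm_eq_abs, one_mul, Real.norm_of_nonneg (by positivity)]
    have e0 : proj (0 : ℂ) φ = 0 := by simp [proj]
    rw [e0, sub_zero]
    have e1 : 0 ≤ proj (α ψ - α φ) ψ := by rw [proj_sub]; linarith [hα.support ψ φ]
    have e2 : proj (α ψ - α φ) φ ≤ 0 := by rw [proj_sub]; linarith [hα.support φ ψ]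
    have e3 := (le_abs_self _).trans (abs_proj_sub_proj_le (α ψ - α φ) φ ψ)
    rw [abs_of_nonneg e1]
    linarith
  have := h1.add h2
  rw [add_zero] at this
  refine this.congr_of_eventuallyEq (Eventually.of_forall fun ψ => ?_)
  simp only [Pi.add_apply]
  rw [← proj_add]; congr 1; ring

/-- On an interval `s` grows, up to the factor `κ`, with constant speed `l`. -/
def HasNearlyConstantSpeed (s : ℝ → ℝ) (κ l p q : ℝ) : Prop :=
  ∀ θ φ, p ≤ θ → θ ≤ φ → φ ≤ q →
    l * (φ - θ) ≤ κ * (s φ - s θ) ∧ s φ - s θ ≤ κ * (l * (φ - θ))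

/-- A linear lower bound for the derivative integrates to a quadratic one. -/
theorem le_of_hasDerivAt_linear {W W' : ℝ → ℝ} {θ φ c : ℝ} (h : θ ≤ φ)
    (hW : ∀ ψ, HasDerivAt W (W' ψ) ψ) (h0 : W θ = 0)
    (hle : ∀ ψ ∈ Ioo θ φ, c * (ψ - θ) ≤ W' ψ) : c * (φ - θ) ^ 2 / 2 ≤ W φ := by
  have hd : ∀ ψ, HasDerivAt (fun ψ => W ψ - c * (ψ - θ) ^ 2 / 2) (W' ψ - c * (ψ - θ)) ψ := by
    intro ψ
    have h1 : HasDerivAt (fun ψ : ℝ => c * (ψ - θ) ^ 2 / 2) (c * (ψ - θ)) ψ := by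
      have := ((((hasDerivAt_id ψ).sub_const θ).pow 2).const_mul c).div_const 2
      refine this.congr_deriv ?_
      simp; ring
    exact (hW ψ).sub h1
  have hmono : MonotoneOn (fun ψ => W ψ - c * (ψ - θ) ^ 2 / 2) (Icc θ φ) := by
    refine monotoneOn_of_deriv_nonneg (convex_Icc θ φ)
      (fun ψ _ => (hd ψ).continuousAt.continuousWithinAt)
      (fun ψ _ => (hd ψ).differentiableAt.differentiableWithinAt) (fun ψ hψ => ?_)
    rw [interior_Icc] at hψ
    rw [(hd ψ).deriv]
    linarith [hle ψ hψ]
  have := hmono (left_mem_Icc.2 h) (right_mem_Icc.2 h) h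
  simp only [h0, sub_self] at this
  norm_num at this
  exact this

/-- Where the speed is nearly `l`, the function `fore` is nearly that of a circle of radius `l`. With
`W ψ = (α ψ - α θ) · u_ψ`, the numerator of `fore`, one has `W' ψ = (α ψ - α θ) · n_ψ`, which is
nearly `s ψ - s θ`, hence nearly `l (ψ - θ)`. -/
theorem IsSupportCurve.fore_bounds (hα : IsSupportCurve α) (hs : IsLengthFunction α s)
    {κ l p q : ℝ} (hκ : 1 < κ) (hpq : q - p < Real.pi / 2)
    (hsin : ∀ x, 0 < x → x ≤ q - p → x ≤ κ * Real.sin x)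
    (hcos : ∀ x, 0 < x → x ≤ q - p → 1 ≤ κ * Real.cos x)
    (hc : HasNearlyConstantSpeed s κ l p q) {θ φ : ℝ} (h1 : p ≤ θ) (h2 : θ < φ) (h3 : φ ≤ q) :
    l / 2 * (φ - θ) ≤ κ ^ 2 * fore α θ φ ∧ fore α θ φ ≤ κ ^ 2 * (l / 2 * (φ - θ)) := by
  have hpi := Real.pi_pos
  have hκ0 : 0 < κ := by linarith
  have hx : 0 < φ - θ := by linarith
  set W : ℝ → ℝ := fun ψ => proj (α ψ - α θ) ψ with hW
  have hWd : ∀ ψ, HasDerivAt W (proj (α ψ - α θ) (ψ + Real.pi / 2)) ψ := by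
    intro ψ
    have e1 : HasDerivAt (proj (α θ)) (proj (α θ) (ψ + Real.pi / 2)) ψ := by
      unfold proj
      rw [Real.cos_add_pi_div_two, Real.sin_add_pi_div_two]
      exact ((Real.hasDerivAt_cos ψ).const_mul _).add ((Real.hasDerivAt_sin ψ).const_mul _)
    have := (hα.hasDerivAt_support ψ).sub e1
    rw [← proj_sub] at this
    refine this.congr_of_eventuallyEq (Eventually.of_forall fun y => ?_)
    simp [hW, proj_sub]
  have hW0 : W θ = 0 := by simp [hW, proj]
  have hs0 := sin_sub_pos h2 (by linarith)
  have hlow := le_of_hasDerivAt_linear (c := l / κ ^ 2) h2.le hWd hW0 (fun ψ hψ => by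
    have e1 := hs.le_proj θ ψ ψ (by linarith [hψ.2]) ⟨hψ.1.le, le_rfl⟩
    have e2 := (hc θ ψ h1 hψ.1.le (by linarith [hψ.2])).1
    have e3 := hcos (ψ - θ) (by linarith [hψ.1]) (by linarith [hψ.2])
    rw [div_mul_eq_mul_div, div_le_iff₀ (by positivity)]
    have e4 : 0 ≤ s ψ - s θ := (norm_nonneg _).trans (hs.norm_le θ ψ hψ.1.le)
    calc l * (ψ - θ) ≤ κ * (s ψ - s θ) := e2
      _ ≤ κ * (s ψ - s θ) * (κ * Real.cos (ψ - θ)) := le_mul_of_one_le_right (by positivity) e3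
      _ = ((s ψ - s θ) * Real.cos (ψ - θ)) * κ ^ 2 := by ring
      _ ≤ _ := by gcongr)
  have hupp := le_of_hasDerivAt_linear (W := fun ψ => - W ψ) (c := -(κ * l)) h2.le
    (fun ψ => (hWd ψ).neg) (by rw [hW0, neg_zero]) (fun ψ hψ => by
    have e1 := hs.proj_le hψ.1.le (ψ + Real.pi / 2)
    have e2 := (hc θ ψ h1 hψ.1.le (by linarith [hψ.2])).2
    linarith)
  have hfore : fore α θ φ * Real.sin (φ - θ) = W φ := fore_mul_sin h2 (by linarith)
  have hsle := Real.sin_le hx.le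
  have hsge := hsin (φ - θ) hx (by linarith)
  have hf0 := hα.fore_nonneg h2 (by linarith)
  constructor
  · have : l / 2 * (φ - θ) * (φ - θ) ≤ κ ^ 2 * fore α θ φ * (φ - θ) := by
      have e1 : l / κ ^ 2 * (φ - θ) ^ 2 / 2 = (l / 2 * (φ - θ) * (φ - θ)) / κ ^ 2 := by ring
      rw [e1, div_le_iff₀ (by positivity), ← hfore] at hlow
      calc _ ≤ fore α θ φ * Real.sin (φ - θ) * κ ^ 2 := hlow
        _ ≤ fore α θ φ * (φ - θ) * κ ^ 2 := by gcongr
        _ = _ := by ring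
    exact le_of_mul_le_mul_right this hx
  · have : fore α θ φ * (φ - θ) ≤ κ ^ 2 * (l / 2 * (φ - θ)) * (φ - θ) :=
      calc fore α θ φ * (φ - θ) ≤ fore α θ φ * (κ * Real.sin (φ - θ)) := by gcongr
        _ = κ * W φ := by rw [← hfore]; ring
        _ ≤ κ * (κ * l * (φ - θ) ^ 2 / 2) := by
          refine mul_le_mul_of_nonneg_left ?_ hκ0.le
          linarith
        _ = _ := by ring
    exact le_of_mul_le_mul_right this hx

theorem HasNearlyConstantSpeed.mirror {κ l p q : ℝ} (h : HasNearlyConstantSpeed s κ l p q) :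
    HasNearlyConstantSpeed (fun θ => - s (-θ)) κ l (-q) (-p) := by
  intro θ φ h1 h2 h3
  have := h (-φ) (-θ) (by linarith) (by linarith) (by linarith)
  rw [show -θ - -φ = φ - θ by ring] at this
  rwa [show - s (-φ) - - s (-θ) = s (-θ) - s (-φ) by ring]

theorem IsSupportCurve.isNearlyCircular (hα : IsSupportCurve α) (hs : IsLengthFunction α s)
    {κ l p q : ℝ} (hκ : 1 < κ) (hpq : q - p < Real.pi / 2)
    (hsin : ∀ x, 0 < x → x ≤ q - p → x ≤ κ * Real.sin x)
    (hcos : ∀ x, 0 < x → x ≤ q - p → 1 ≤ κ * Real.cos x)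
    (hc : HasNearlyConstantSpeed s κ l p q) : IsNearlyCircular α (κ ^ 2) (l / 2) p q := by
  intro θ φ h1 h2 h3
  obtain ⟨e1, e2⟩ := hα.fore_bounds hs hκ hpq hsin hcos hc h1 h2 h3
  have hr : -p - -q = q - p := by ring
  obtain ⟨e3, e4⟩ := hα.mirror.fore_bounds hs.mirror hκ (by rwa [hr]) (by rwa [hr])
    (by rwa [hr]) hc.mirror (θ := -φ) (φ := -θ) (by linarith) (by linarith) (by linarith)
  rw [fore_mirror, neg_neg, neg_neg, show -θ - -φ = φ - θ by ring] at e3 e4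
  exact ⟨e1, e2, e3, e4⟩

/-- Precision factors can be chosen uniformly on short intervals. -/
theorem exists_trig_bounds {κ : ℝ} (hκ : 1 < κ) : ∃ η > 0, η < Real.pi / 2 ∧
    (∀ x, 0 < x → x ≤ η → x ≤ κ * Real.sin x) ∧ ∀ x, 0 < x → x ≤ η → 1 ≤ κ * Real.cos x := by
  obtain ⟨η₁, h1, h2⟩ := exists_le_sin hκ
  have hlim : Tendsto (fun x : ℝ => κ * Real.cos x) (𝓝 0) (𝓝 κ) := by
    have : Continuous fun x : ℝ => κ * Real.cos x := by fun_prop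
    simpa using this.tendsto 0
  obtain ⟨η₂, h3, h4⟩ := Metric.eventually_nhds_iff.1 (hlim.eventually_const_lt hκ)
  have hpi := Real.pi_pos
  refine ⟨min (η₁ / 2) (min (η₂ / 2) (Real.pi / 4)), by positivity, ?_, fun x hx hx2 => ?_,
    fun x hx hx2 => ?_⟩
  · exact lt_of_le_of_lt ((min_le_right _ _).trans (min_le_right _ _)) (by linarith)
  · exact h2 x hx (by linarith [hx2.trans (min_le_left _ _)])
  · refine (h4 ?_).le
    rw [Real.dist_eq, sub_zero, abs_of_pos hx]
    linarith [hx2.trans ((min_le_right _ _).trans (min_le_left _ _))]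

/-- If the speed of `s` tends to `l` from the left, the curve is nearly circular there. -/
theorem IsSupportCurve.nearlyCircular_left (hα : IsSupportCurve α) (hs : IsLengthFunction α s)
    {θ₀ l : ℝ}
    (h : ∀ κ > 1, ∃ δ > 0, HasNearlyConstantSpeed s κ l (θ₀ - δ) θ₀) :
    ∀ κ > 1, ∃ δ > 0, IsNearlyCircular α κ (l / 2) (θ₀ - δ) θ₀ := by
  intro κ hκ
  have hκ1 : 1 < √κ := by rw [Real.lt_sqrt (by norm_num)]; linarith
  obtain ⟨δ, hδ, h1⟩ := h _ hκ1
  obtain ⟨η, hη, hη2, hsin, hcos⟩ := exists_trig_bounds hκ1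
  refine ⟨min δ η, lt_min hδ hη, ?_⟩
  have hle1 := min_le_left δ η
  have hle2 := min_le_right δ η
  have := hα.isNearlyCircular hs (p := θ₀ - min δ η) (q := θ₀) hκ1 (by linarith)
    (fun x hx hx2 => hsin x hx (by linarith)) (fun x hx hx2 => hcos x hx (by linarith))
    (fun θ φ e1 e2 e3 => h1 θ φ (by linarith) e2 e3)
  rwa [Real.sq_sqrt (by linarith)] at this

theorem IsSupportCurve.nearlyCircular_right (hα : IsSupportCurve α) (hs : IsLengthFunction α s)
    {θ₀ l : ℝ}
    (h : ∀ κ > 1, ∃ δ > 0, HasNearlyConstantSpeed s κ l θ₀ (θ₀ + δ)) :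
    ∀ κ > 1, ∃ δ > 0, IsNearlyCircular α κ (l / 2) θ₀ (θ₀ + δ) := by
  intro κ hκ
  obtain ⟨δ, hδ, h1⟩ := hα.mirror.nearlyCircular_left hs.mirror (θ₀ := -θ₀) (l := l) (fun κ hκ => by
    obtain ⟨δ, hδ, h1⟩ := h κ hκ
    exact ⟨δ, hδ, by have := h1.mirror; rwa [neg_add'] at this⟩) κ hκ
  refine ⟨δ, hδ, ?_⟩
  have := h1.mirror
  rwa [mirror_mirror, neg_neg, neg_sub, sub_neg_eq_add, add_comm] at this

end

/-! ### Curvature conditions -/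

section

variable {α : ℝ → ℂ} {s : ℝ → ℝ}

theorem IsLengthFunction.norm_sub_le (hs : IsLengthFunction α s) (p q : ℝ) :
    ‖α q - α p‖ ≤ |s q - s p| := by
  rcases le_total p q with h | h
  · exact (hs.norm_le _ _ h).trans (le_abs_self _)
  · rw [norm_sub_rev, abs_sub_comm]
    exact (hs.norm_le _ _ h).trans (le_abs_self _)

theorem IsLengthFunction.lipschitzWith (hs : IsLengthFunction α s) {C : NNReal}
    (hC : LipschitzWith C s) : LipschitzWith C α := by
  refine LipschitzWith.of_dist_le_mul fun p q => ?_
  rw [dist_eq_norm]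
  exact (hs.norm_sub_le q p).trans (by rw [← Real.dist_eq]; exact hC.dist_le_mul p q)

theorem IsLengthFunction.isLittleO (hs : IsLengthFunction α s) {S : Set ℝ} {θ₀ : ℝ}
    (h : HasDerivWithinAt s 0 S θ₀) :
    (fun θ => α θ - α θ₀) =o[𝓝[S] θ₀] fun θ => θ - θ₀ := by
  have h1 : (fun θ => s θ - s θ₀) =o[𝓝[S] θ₀] fun θ => θ - θ₀ := by
    simpa using hasDerivWithinAt_iff_isLittleO.1 h
  refine (Asymptotics.IsBigO.of_bound 1 (Eventually.of_forall fun θ => ?_)).trans_isLittleO h1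
  rw [one_mul, Real.norm_eq_abs]
  exact hs.norm_sub_le θ₀ θ

/-- If the derivative stays within a factor `κ` of `l`, so do the difference quotients. -/
theorem hasNearlyConstantSpeed_of_deriv {κ l p q : ℝ} (hc : Continuous s)
    (hd : ∀ x ∈ Ioo p q, DifferentiableAt ℝ s x)
    (hb : ∀ x ∈ Ioo p q, l ≤ κ * deriv s x ∧ deriv s x ≤ κ * l) :
    HasNearlyConstantSpeed s κ l p q := by
  intro θ φ hp hθφ hq
  rcases hθφ.eq_or_lt with rfl | hlt
  · simp
  obtain ⟨x, hx, hxe⟩ := exists_deriv_eq_slope s hlt hc.continuousOn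
    fun y hy => (hd y ⟨hp.trans_lt hy.1, hy.2.trans_le hq⟩).differentiableWithinAt
  obtain ⟨h1, h2⟩ := hb x ⟨hp.trans_lt hx.1, hx.2.trans_le hq⟩
  have hpos : 0 < φ - θ := sub_pos.2 hlt
  have he : s φ - s θ = deriv s x * (φ - θ) := by rw [hxe]; field_simp
  rw [he]
  constructor
  · nlinarith
  · nlinarith

theorem eventually_deriv_near {F : Filter ℝ} {κ l : ℝ} (hκ : 1 < κ) (hl : 0 < l)
    (h : Tendsto (deriv s) F (𝓝 l)) : ∀ᶠ x in F, l ≤ κ * deriv s x ∧ deriv s x ≤ κ * l := by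
  have h1 : l / κ < l := div_lt_self hl hκ
  have h2 : l < κ * l := by nlinarith
  filter_upwards [h.eventually (lt_mem_nhds h1), h.eventually (gt_mem_nhds h2)] with x hx hx'
  refine ⟨?_, hx'.le⟩
  rw [div_lt_iff₀ (by linarith)] at hx
  linarith

/-- A point of vanishing curvature radius, or a jump of the curvature radius, bounds the size of
invariant radius functions from below. -/
theorem IsSupportCurve.exists_radius_bound (hα : IsSupportCurve α) (hs : IsLengthFunction α s)
    (hc : Continuous s) {a b θ : ℝ} (hθ : θ ∈ Ioo a b)
    (h : (ContDiffOn ℝ 1 s (Ioo a b) ∧ deriv s θ = 0) ∨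
      (ContDiffOn ℝ 1 s (Ioo a b \ {θ}) ∧ (∀ x ∈ Ioo a b \ {θ}, 0 < deriv s x) ∧
        ∃ l r : ℝ, l ≠ r ∧ Tendsto (deriv s) (𝓝[<] θ) (𝓝 l) ∧
          Tendsto (deriv s) (𝓝[>] θ) (𝓝 r))) :
    ∃ ε > 0, ∀ R, IsInvariantRadius α R → ε ≤ R θ := by
  rcases h with ⟨hd, h0⟩ | ⟨hd, hpos, l, r, hlr, hl, hr⟩
  · have hdiff : DifferentiableAt ℝ s θ :=
      (hd.differentiableOn (by norm_num)).differentiableAt (isOpen_Ioo.mem_nhds hθ)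
    have h1 : HasDerivAt s 0 θ := h0 ▸ hdiff.hasDerivAt
    exact exists_le_of_right_deriv_zero hα (hs.isLittleO h1.hasDerivWithinAt)
  have hopen : IsOpen (Ioo a b \ {θ}) := isOpen_Ioo.sdiff isClosed_singleton
  have hdiff : ∀ x ∈ Ioo a b \ {θ}, DifferentiableAt ℝ s x := fun x hx =>
    (hd.differentiableOn (by norm_num)).differentiableAt (hopen.mem_nhds hx)
  have hL : Ioo a θ ⊆ Ioo a b \ {θ} := fun x hx =>
    ⟨⟨hx.1, hx.2.trans hθ.2⟩, ne_of_lt hx.2⟩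
  have hR : Ioo θ b ⊆ Ioo a b \ {θ} := fun x hx =>
    ⟨⟨hθ.1.trans hx.1, hx.2⟩, ne_of_gt hx.1⟩
  have hLn : Ioo a θ ∈ 𝓝[<] θ := Ioo_mem_nhdsLT hθ.1
  have hRn : Ioo θ b ∈ 𝓝[>] θ := Ioo_mem_nhdsGT hθ.2
  have hl0 : 0 ≤ l := ge_of_tendsto hl (by
    filter_upwards [hLn] with x hx using (hpos x (hL hx)).le)
  have hr0 : 0 ≤ r := ge_of_tendsto hr (by
    filter_upwards [hRn] with x hx using (hpos x (hR hx)).le)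
  -- A jump from or to zero is a one-sided zero of the curvature radius.
  rcases hl0.eq_or_lt with rfl | hl0
  · have h1 := hasDerivWithinAt_Iic_of_tendsto_deriv
      (fun x hx => (hdiff x (hL hx)).differentiableWithinAt) hc.continuousWithinAt hLn hl
    exact exists_le_of_left_deriv_zero hα (hs.isLittleO (h1.mono Iio_subset_Iic_self))
  rcases hr0.eq_or_lt with rfl | hr0
  · have h1 := hasDerivWithinAt_Ici_of_tendsto_deriv
      (fun x hx => (hdiff x (hR hx)).differentiableWithinAt) hc.continuousWithinAt hRn hr
    exact exists_le_of_right_deriv_zero hα (hs.isLittleO (h1.mono Ioi_subset_Ici_self))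
  refine exists_le_of_jump hα (half_pos hl0) (half_pos hr0) (fun h => hlr (by linarith))
    (hα.nearlyCircular_left hs fun κ hκ => ?_) (hα.nearlyCircular_right hs fun κ hκ => ?_)
  · obtain ⟨p, hp, hsub⟩ := (mem_nhdsLT_iff_exists_Ioo_subset' hθ.1).1
      (inter_mem hLn (eventually_deriv_near hκ hl0 hl))
    refine ⟨θ - p, sub_pos.2 hp, ?_⟩
    rw [sub_sub_cancel]
    exact hasNearlyConstantSpeed_of_deriv hc (fun x hx => hdiff x (hL (hsub hx).1))
      fun x hx => (hsub hx).2
  · obtain ⟨p, hp, hsub⟩ := (mem_nhdsGT_iff_exists_Ioo_subset' hθ.2).1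
      (inter_mem hRn (eventually_deriv_near hκ hr0 hr))
    refine ⟨p - θ, sub_pos.2 hp, ?_⟩
    rw [add_sub_cancel]
    exact hasNearlyConstantSpeed_of_deriv hc (fun x hx => hdiff x (hR (hsub hx).1))
      fun x hx => (hsub hx).2

/-- The point of tangency is a support curve as soon as it is continuous, which excludes segments
in the boundary. -/
theorem isSupportCurve_tangencyPoint {K : Set ℂ} (hK : IsCompact K) (hint : (interior K).Nonempty)
    (hc : Continuous (tangencyPoint (frontier K))) :
    IsSupportCurve (tangencyPoint (frontier K)) where
  continuous := hc
  periodic := tangencyPoint_periodic _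
  support θ φ := proj_le_proj_tangencyPoint hK (hK.isClosed.frontier_subset
    (tangencyPoint_mem_frontier hK (hint.mono interior_subset) φ)) θ
  width := tangencyPoint_width hK hint

end

/-! ### Tangent coordinates -/

section

variable {α : ℝ → ℂ}

/-- The complement of the convex body bounded by the curve `α`: the points that some supporting
line separates strictly from it. -/
def outside (α : ℝ → ℂ) : Set ℂ := {z | ∃ θ, proj (α θ) θ < proj z θ}

/-- Tangent coordinates on the exterior: `r e^{iθ}` is sent to the point of the supporting line
in direction `θ` at signed distance `σ r` from the point of tangency. They are used with
`σ = 1` and `σ = -1`. -/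
noncomputable def tangentMap (α : ℝ → ℂ) (σ : ℝ) (w : ℂ) : ℂ :=
  α w.arg + (σ : ℂ) * (Complex.I * w)

theorem I_mul_polar (r θ : ℝ) :
    Complex.I * ((r : ℂ) * Complex.exp (θ * Complex.I)) = r • dirVec θ := by
  rw [Complex.exp_mul_I, ← Complex.ofReal_cos, ← Complex.ofReal_sin]
  apply Complex.ext <;> simp [dirVec, Complex.cos_ofReal_re, Complex.sin_ofReal_re]

theorem apply_arg_polar (hp : Function.Periodic α (2 * Real.pi)) {r : ℝ} (hr : 0 < r) (θ : ℝ) :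
    α ((r : ℂ) * Complex.exp (θ * Complex.I)).arg = α θ := by
  rw [Complex.exp_mul_I, Complex.arg_mul_cos_add_sin_mul_I_eq_toIocMod hr, toIocMod]
  exact hp.sub_zsmul_eq _

theorem tangentMap_polar (hp : Function.Periodic α (2 * Real.pi)) {r : ℝ} (hr : 0 < r)
    (σ θ : ℝ) : tangentMap α σ ((r : ℂ) * Complex.exp (θ * Complex.I)) =
      α θ + (σ * r) • dirVec θ := by
  rw [tangentMap, apply_arg_polar hp hr, I_mul_polar, mul_smul]
  rfl

theorem exists_polar {w : ℂ} (hw : w ≠ 0) :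
    ∃ r θ : ℝ, 0 < r ∧ w = (r : ℂ) * Complex.exp (θ * Complex.I) :=
  ⟨‖w‖, w.arg, norm_pos_iff.2 hw, (Complex.norm_mul_exp_arg_mul_I w).symm⟩

theorem polar_ne_zero {r : ℝ} (hr : 0 < r) (θ : ℝ) :
    (r : ℂ) * Complex.exp (θ * Complex.I) ≠ 0 :=
  mul_ne_zero (Complex.ofReal_ne_zero.2 hr.ne') (Complex.exp_ne_zero _)

theorem cross_polar (r s θ φ : ℝ) : cross ((r : ℂ) * Complex.exp (θ * Complex.I))
    ((s : ℂ) * Complex.exp (φ * Complex.I)) = r * s * Real.sin (φ - θ) := by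
  rw [Complex.exp_mul_I, Complex.exp_mul_I, ← Complex.ofReal_cos, ← Complex.ofReal_sin,
    ← Complex.ofReal_cos, ← Complex.ofReal_sin, Real.sin_sub]
  simp only [cross, Complex.mul_re, Complex.mul_im, Complex.add_re, Complex.add_im,
    Complex.ofReal_re, Complex.ofReal_im, Complex.I_re, Complex.I_im]
  ring

namespace IsSupportCurve

theorem isClosed_compl_outside (α : ℝ → ℂ) : IsClosed (outside α)ᶜ := by
  have : (outside α)ᶜ = ⋂ θ, {z | proj z θ ≤ proj (α θ) θ} := by
    ext z
    rw [mem_iInter]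
    constructor
    · intro h θ
      by_contra! hlt
      exact h ⟨θ, not_le.1 hlt⟩
    · rintro h ⟨θ, hθ⟩
      exact absurd (h θ) (not_le.2 hθ)
  rw [this]
  exact isClosed_iInter fun θ => isClosed_le (continuous_proj_left θ) continuous_const

theorem apply_notMem_outside (hα : IsSupportCurve α) (θ : ℝ) : α θ ∉ outside α := by
  rintro ⟨φ, hφ⟩
  exact absurd (hα.support φ θ) (not_le.2 hφ)

theorem exists_norm_le (hα : IsSupportCurve α) : ∃ M, 0 < M ∧ ∀ θ, ‖α θ‖ ≤ M := by
  have hp : Function.Periodic α (2 * Real.pi) := hα.periodic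
  obtain ⟨M, hM⟩ := (isCompact_Icc (a := (0 : ℝ)) (b := 2 * Real.pi)).exists_bound_of_continuousOn
    hα.continuous.continuousOn
  refine ⟨max M 1, by positivity, fun θ => ?_⟩
  obtain ⟨y, hy, he⟩ := hp.exists_mem_Ico₀ Real.two_pi_pos θ
  rw [he]
  exact (hM y ⟨hy.1, hy.2.le⟩).trans (le_max_left _ _)

theorem continuousAt_tangentMap (hα : IsSupportCurve α) (σ : ℝ) {w : ℂ} (hw : w ≠ 0) :
    ContinuousAt (tangentMap α σ) w := by
  have hp : Function.Periodic α (2 * Real.pi) := hα.periodic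
  -- The argument is continuous with values in the circle, to which `α` descends.
  have hlift : Continuous (hp.lift : Real.Angle → ℂ) := hα.continuous.quotient_lift _
  have h1 : ContinuousAt (fun w : ℂ => α w.arg) w := by
    have : (fun w : ℂ => α w.arg) = fun w : ℂ => hp.lift (w.arg : Real.Angle) := by
      ext w; exact (hp.lift_coe _).symm
    rw [this]
    exact hlift.continuousAt.comp (Complex.continuousAt_arg_coe_angle hw)
  exact h1.add (by fun_prop)

/-- Through a point of the exterior there is only one tangent on either side. -/
theorem tangentMap_injOn (hα : IsSupportCurve α) {σ : ℝ} (hσ : σ = 1 ∨ σ = -1) :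
    InjOn (tangentMap α σ) {0}ᶜ := by
  intro w hw w' hw' he
  obtain ⟨r, θ, hr, rfl⟩ := exists_polar hw
  obtain ⟨r', θ', hr', rfl⟩ := exists_polar hw'
  have hp : Function.Periodic α (2 * Real.pi) := hα.periodic
  rw [tangentMap_polar hp hr, tangentMap_polar hp hr'] at he
  have e1 := congrArg (proj · θ) he
  have e2 := congrArg (proj · θ') he
  simp only [proj_add, proj_smul_dirVec, sub_self, Real.sin_zero, mul_zero, add_zero] at e1 e2
  have s1 := hα.support θ' θ
  have s2 := hα.support θ θ'
  have hneg : Real.sin (θ - θ') = - Real.sin (θ' - θ) := by rw [← Real.sin_neg, neg_sub]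
  rw [hneg] at e1
  have h1 : 0 ≤ σ * Real.sin (θ' - θ) := by
    have : 0 ≤ (σ * Real.sin (θ' - θ)) * r := by linarith
    exact nonneg_of_mul_nonneg_left this hr
  have h2 : 0 ≤ -(σ * Real.sin (θ' - θ)) := by
    have : 0 ≤ -(σ * Real.sin (θ' - θ)) * r' := by linarith
    exact nonneg_of_mul_nonneg_left this hr'
  have hσ0 : σ ≠ 0 := by rcases hσ with rfl | rfl <;> norm_num
  have hsin : Real.sin (θ' - θ) = 0 := by
    have : σ * Real.sin (θ' - θ) = 0 := le_antisymm (by linarith) h1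
    exact (mul_eq_zero.1 this).resolve_left hσ0
  obtain ⟨n, hn⟩ := Real.sin_eq_zero_iff.1 hsin
  rcases Int.even_or_odd' n with ⟨k, rfl | rfl⟩
  · have hθ : θ' = θ + k * (2 * Real.pi) := by push_cast at hn; linarith
    have hexp : Complex.exp (θ' * Complex.I) = Complex.exp (θ * Complex.I) := by
      rw [hθ]
      rw [Complex.exp_eq_exp_iff_exists_int]
      exact ⟨k, by push_cast; ring⟩
    have hα' : α θ' = α θ := by rw [hθ]; exact hp.int_mul k θ
    have hd : dirVec θ' = dirVec θ := by
      have := I_mul_polar 1 θ'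
      rw [hexp, I_mul_polar 1 θ, one_smul, one_smul] at this
      exact this.symm
    rw [hα', hd, add_right_inj] at he
    have hnz : dirVec θ ≠ 0 := by
      intro h
      have := norm_dirVec θ
      rw [h, norm_zero] at this
      norm_num at this
    have := mul_left_cancel₀ hσ0 (smul_left_injective ℝ hnz he)
    rw [hexp, this]
  · exfalso
    have hθ : θ' = (θ + Real.pi) + k * (2 * Real.pi) := by push_cast at hn; linarith
    have hα' : α θ' = α (θ + Real.pi) := by rw [hθ]; exact hp.int_mul k _
    have hpr : ∀ z, proj z θ' = - proj z θ := fun z => by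
      rw [← proj_add_pi, hθ]
      simp [proj, Real.cos_add_int_mul_two_pi, Real.sin_add_int_mul_two_pi]
    rw [hpr, hα', hpr, hsin] at e2
    have := hα.width θ
    linarith

/-- Points of a tangent line other than the point of tangency are in the exterior: they are separated
from the curve by supporting lines with slightly different directions. -/
theorem tangentMap_mem_outside (hα : IsSupportCurve α) {σ : ℝ} (hσ : σ = 1 ∨ σ = -1) {w : ℂ}
    (hw : w ≠ 0) : tangentMap α σ w ∈ outside α := by
  obtain ⟨r, θ, hr, rfl⟩ := exists_polar hw
  rw [tangentMap_polar hα.periodic hr]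
  rcases hσ with rfl | rfl
  · obtain ⟨φ, h1, h2, h3⟩ := hα.exists_fore_eq θ (half_pos hr)
    refine ⟨φ, ?_⟩
    have e := fore_mul_sin (α := α) h1 h2
    rw [h3, proj_sub] at e
    rw [proj_add, proj_smul_dirVec]
    have := mul_pos hr (sin_sub_pos h1 h2)
    linarith
  · obtain ⟨φ, h1, h2, h3⟩ := hα.exists_back_eq θ (half_pos hr)
    refine ⟨φ, ?_⟩
    have h1' : θ < φ + Real.pi := by linarith
    have e := back_mul_sin (α := α) h2 h1'
    rw [h3, proj_sub] at e
    rw [proj_add, proj_smul_dirVec, ← neg_sub θ φ, Real.sin_neg]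
    have := mul_pos hr (sin_sub_pos h2 h1')
    linarith

/-- Every exterior point lies on a tangent line: a supporting line separating it from the curve can
be turned, in either direction, until it meets the point. -/
theorem exists_tangentMap_eq (hα : IsSupportCurve α) {σ : ℝ} (hσ : σ = 1 ∨ σ = -1) {z : ℂ}
    (hz : z ∈ outside α) : ∃ w ≠ 0, tangentMap α σ w = z := by
  obtain ⟨θ, hθ⟩ := hz
  obtain ⟨g, hg⟩ : ∃ g : ℝ → ℝ, g = fun φ => proj (α φ) φ - proj z φ := ⟨_, rfl⟩
  have hgc : Continuous g := by
    have := hα.continuous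
    rw [hg]; unfold proj; fun_prop
  have hg0 : g θ < 0 := by rw [hg]; simpa using hθ
  have hgπ : 0 < g (θ + Real.pi) := by
    have := hα.width θ
    simp only [hg, proj_add_pi]
    linarith
  have hgπ' : 0 < g (θ - Real.pi) := by
    have e : g (θ - Real.pi) = g (θ + Real.pi) := by
      have h2 : θ + Real.pi = (θ - Real.pi) + 2 * Real.pi := by ring
      rw [hg, h2]
      simp only [hα.periodic, proj, Real.cos_add_two_pi, Real.sin_add_two_pi]
    rwa [e]
  have key : ∀ φ, g φ = 0 → ∃ ρ : ℝ, z = α φ + ρ • dirVec φ ∧ 0 < ρ * Real.sin (θ - φ) := by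
    intro φ hφ
    obtain ⟨ρ, hρ⟩ := exists_smul_dirVec (z := z - α φ) (θ := φ) (by
      rw [proj_sub]; simp only [hg] at hφ; linarith)
    have hz : z = α φ + ρ • dirVec φ := by rw [← hρ]; ring
    refine ⟨ρ, hz, ?_⟩
    have h1 := hθ
    rw [hz, proj_add, proj_smul_dirVec] at h1
    linarith [hα.support θ φ]
  rcases hσ with rfl | rfl
  · obtain ⟨φ, hφ, h0⟩ := intermediate_value_Ioo' (by linarith [Real.pi_pos])
      hgc.continuousOn (show (0 : ℝ) ∈ Ioo (g θ) (g (θ - Real.pi)) from ⟨hg0, hgπ'⟩)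
    obtain ⟨ρ, hz, hρ⟩ := key φ h0
    have hρ0 : 0 < ρ := pos_of_mul_pos_left hρ
      (sin_sub_pos hφ.2 (by linarith [hφ.1])).le
    exact ⟨_, polar_ne_zero hρ0 φ, by rw [tangentMap_polar hα.periodic hρ0, one_mul, hz]⟩
  · obtain ⟨φ, hφ, h0⟩ := intermediate_value_Ioo (by linarith [Real.pi_pos])
      hgc.continuousOn (show (0 : ℝ) ∈ Ioo (g θ) (g (θ + Real.pi)) from ⟨hg0, hgπ⟩)
    obtain ⟨ρ, hz, hρ⟩ := key φ h0
    rw [← neg_sub φ θ, Real.sin_neg, mul_neg, ← neg_mul] at hρ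
    have hρ0 : 0 < -ρ := pos_of_mul_pos_left hρ (sin_sub_pos hφ.1 hφ.2).le
    exact ⟨_, polar_ne_zero hρ0 φ, by rw [tangentMap_polar hα.periodic hρ0, hz]; congr 2; ring⟩

end IsSupportCurve

open Classical in
/-- The inverse of the tangent coordinates, extended by `0` to the convex body. It collapses the
body to a point. -/
noncomputable def collapse (α : ℝ → ℂ) (σ : ℝ) (z : ℂ) : ℂ :=
  if h : ∃ w ≠ 0, tangentMap α σ w = z then h.choose else 0

open Classical in
/-- The dual billiards map in the tangent coordinates with `σ = -1`, fixing the origin; for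
`σ = 1` it is the map itself and for `σ = -1` its inverse. -/
noncomputable def billiard (α : ℝ → ℂ) (σ : ℝ) (w : ℂ) : ℂ :=
  if w = 0 then 0 else collapse α (-σ) (tangentMap α σ w)

namespace IsSupportCurve

variable {σ : ℝ}

theorem collapse_of_mem (hα : IsSupportCurve α) (hσ : σ = 1 ∨ σ = -1) {z : ℂ}
    (hz : z ∈ outside α) : collapse α σ z ≠ 0 ∧ tangentMap α σ (collapse α σ z) = z := by
  have h := hα.exists_tangentMap_eq hσ hz
  rw [collapse, dif_pos h]
  exact h.choose_spec

theorem collapse_of_notMem (hα : IsSupportCurve α) (hσ : σ = 1 ∨ σ = -1) {z : ℂ}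
    (hz : z ∉ outside α) : collapse α σ z = 0 := by
  rw [collapse, dif_neg]
  rintro ⟨w, hw, rfl⟩
  exact hz (hα.tangentMap_mem_outside hσ hw)

theorem collapse_eq_zero_iff (hα : IsSupportCurve α) (hσ : σ = 1 ∨ σ = -1) {z : ℂ} :
    collapse α σ z = 0 ↔ z ∉ outside α :=
  ⟨fun h hz => (hα.collapse_of_mem hσ hz).1 h, hα.collapse_of_notMem hσ⟩

theorem collapse_tangentMap (hα : IsSupportCurve α) (hσ : σ = 1 ∨ σ = -1) {w : ℂ} (hw : w ≠ 0) :
    collapse α σ (tangentMap α σ w) = w := by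
  obtain ⟨h1, h2⟩ := hα.collapse_of_mem hσ (hα.tangentMap_mem_outside hσ hw)
  exact hα.tangentMap_injOn hσ h1 hw h2

theorem norm_tangentMap_sub (hσ : σ = 1 ∨ σ = -1) (w : ℂ) :
    ‖tangentMap α σ w - α w.arg‖ = ‖w‖ := by
  rw [tangentMap, add_sub_cancel_left, norm_mul, norm_mul]
  rcases hσ with rfl | rfl <;> simp

/-- The norm of the tangent coordinates bounds the distance from the body. -/
theorem exists_norm_sub_collapse (hα : IsSupportCurve α) (hσ : σ = 1 ∨ σ = -1) (z : ℂ) :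
    ∃ k ∉ outside α, ‖z - k‖ = ‖collapse α σ z‖ := by
  by_cases hz : z ∈ outside α
  · obtain ⟨-, h⟩ := hα.collapse_of_mem hσ hz
    refine ⟨_, hα.apply_notMem_outside (collapse α σ z).arg, ?_⟩
    have := norm_tangentMap_sub (α := α) hσ (collapse α σ z)
    rwa [h] at this
  · exact ⟨z, hz, by rw [hα.collapse_of_notMem hσ hz, sub_self]⟩

/-- Continuity follows from compactness: `collapse` is locally bounded and its graph is closed. -/
theorem continuous_collapse (hα : IsSupportCurve α) (hσ : σ = 1 ∨ σ = -1) :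
    Continuous (collapse α σ) := by
  obtain ⟨M, hM0, hM⟩ := hα.exists_norm_le
  have hbound : ∀ z, ‖collapse α σ z‖ ≤ ‖z‖ + M := by
    intro z
    by_cases hz : z ∈ outside α
    · obtain ⟨-, h⟩ := hα.collapse_of_mem hσ hz
      have h1 := norm_tangentMap_sub (α := α) hσ (collapse α σ z)
      rw [h] at h1
      rw [← h1]
      exact (norm_sub_le _ _).trans (by linarith [hM (collapse α σ z).arg])
    · rw [hα.collapse_of_notMem hσ hz, norm_zero]
      positivity
  refine continuous_iff_continuousAt.2 fun z => ?_
  refine tendsto_of_seq_tendsto fun u hu => tendsto_of_subseq_tendsto fun ns hns => ?_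
  have hu' : Tendsto (fun n => u (ns n)) atTop (𝓝 z) := hu.comp hns
  obtain ⟨B, hB⟩ := hu'.norm.bddAbove_range
  have hmem : ∀ n, collapse α σ (u (ns n)) ∈ Metric.closedBall (0 : ℂ) (B + M) := fun n => by
    rw [mem_closedBall_zero_iff]
    exact (hbound _).trans (by linarith [hB ⟨n, rfl⟩])
  obtain ⟨w, -, ms, hms, hw⟩ := (isCompact_closedBall (0 : ℂ) (B + M)).tendsto_subseq hmem
  refine ⟨ms, ?_⟩
  have hz : Tendsto (fun n => u (ns (ms n))) atTop (𝓝 z) := hu'.comp hms.tendsto_atTop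
  have hw : Tendsto (fun n => collapse α σ (u (ns (ms n)))) atTop (𝓝 w) := hw
  suffices collapse α σ z = w by rw [this]; exact hw
  by_cases hw0 : w = 0
  · rw [hw0, hα.collapse_eq_zero_iff hσ]
    choose k hk hkn using fun n => hα.exists_norm_sub_collapse hσ (u (ns (ms n)))
    have h0 : Tendsto (fun n => u (ns (ms n)) - k n) atTop (𝓝 0) := by
      rw [tendsto_zero_iff_norm_tendsto_zero]
      simp_rw [hkn]
      simpa [hw0] using hw.norm
    have hkz : Tendsto k atTop (𝓝 z) := by simpa using hz.sub h0
    exact (isClosed_compl_outside α).mem_of_tendsto hkz (Eventually.of_forall hk)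
  · have h1 := (hα.continuousAt_tangentMap σ hw0).tendsto.comp hw
    have h2 : ∀ᶠ n in atTop, tangentMap α σ (collapse α σ (u (ns (ms n)))) = u (ns (ms n)) := by
      filter_upwards [hw.eventually_ne hw0] with n hn
      by_cases hz : u (ns (ms n)) ∈ outside α
      · exact (hα.collapse_of_mem hσ hz).2
      · exact absurd (hα.collapse_of_notMem hσ hz) hn
    have h3 : tangentMap α σ w = z := tendsto_nhds_unique (h1.congr' h2) hz
    rw [← h3, hα.collapse_tangentMap hσ hw0]

theorem neg_sign (hσ : σ = 1 ∨ σ = -1) : -σ = 1 ∨ -σ = -1 := by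
  rcases hσ with rfl | rfl <;> simp

theorem continuous_billiard (hα : IsSupportCurve α) (hσ : σ = 1 ∨ σ = -1) :
    Continuous (billiard α σ) := by
  have hc := hα.continuous_collapse (neg_sign hσ)
  refine continuous_iff_continuousAt.2 fun w => ?_
  by_cases hw : w = 0
  · subst hw
    obtain ⟨M, hM0, hM⟩ := hα.exists_norm_le
    have huc := (isCompact_closedBall (0 : ℂ) (M + 1)).uniformContinuousOn_of_continuous
      hc.continuousOn
    rw [Metric.continuousAt_iff]
    intro ε hε
    obtain ⟨δ, hδ, h⟩ := Metric.uniformContinuousOn_iff.1 huc ε hε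
    refine ⟨min δ 1, by positivity, fun {w} hw => ?_⟩
    rw [dist_zero_right] at hw
    have e0 : billiard α σ 0 = 0 := if_pos rfl
    rw [e0]
    by_cases hw0 : w = 0
    · rw [hw0, e0, dist_self]; exact hε
    have e1 : billiard α σ w = collapse α (-σ) (tangentMap α σ w) := if_neg hw0
    have hn := norm_tangentMap_sub (α := α) hσ w
    have h1 := h (tangentMap α σ w) (by
      rw [mem_closedBall_zero_iff]
      have h2 : tangentMap α σ w = α w.arg + (tangentMap α σ w - α w.arg) := by ring
      rw [h2]
      refine (norm_add_le _ _).trans ?_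
      rw [hn]
      linarith [hM w.arg, hw.le.trans (min_le_right _ _)]) (α w.arg) (by
      rw [mem_closedBall_zero_iff]; linarith [hM w.arg]) (by
      rw [dist_eq_norm, hn]; exact hw.trans_le (min_le_left _ _))
    rw [hα.collapse_of_notMem (neg_sign hσ) (hα.apply_notMem_outside _)] at h1
    rwa [e1]
  · have he : billiard α σ =ᶠ[𝓝 w] fun w => collapse α (-σ) (tangentMap α σ w) := by
      filter_upwards [isOpen_ne.mem_nhds hw] with v hv using if_neg hv
    exact (hc.continuousAt.comp (hα.continuousAt_tangentMap σ hw)).congr_of_eventuallyEq he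

theorem billiard_billiard (hα : IsSupportCurve α) (hσ : σ = 1 ∨ σ = -1) (w : ℂ) :
    billiard α (-σ) (billiard α σ w) = w := by
  by_cases hw : w = 0
  · subst hw; simp [billiard]
  obtain ⟨h1, h2⟩ := hα.collapse_of_mem (neg_sign hσ) (hα.tangentMap_mem_outside hσ hw)
  have e1 : billiard α σ w = collapse α (-σ) (tangentMap α σ w) := if_neg hw
  rw [e1, billiard, if_neg h1, h2, neg_neg, hα.collapse_tangentMap hσ hw]

/-- The dual billiards map in tangent coordinates, as a homeomorphism of the plane. -/
noncomputable def billiardHomeo (hα : IsSupportCurve α) : ℂ ≃ₜ ℂ where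
  toFun := billiard α 1
  invFun := billiard α (-1)
  left_inv := hα.billiard_billiard (Or.inl rfl)
  right_inv w := by simpa using hα.billiard_billiard (σ := -1) (Or.inr rfl) w
  continuous_toFun := hα.continuous_billiard (Or.inl rfl)
  continuous_invFun := hα.continuous_billiard (Or.inr rfl)

theorem billiardHomeo_zero (hα : IsSupportCurve α) : hα.billiardHomeo 0 = 0 := if_pos rfl

theorem billiardHomeo_apply (hα : IsSupportCurve α) {w : ℂ} (hw : w ≠ 0) :
    hα.billiardHomeo w = collapse α (-1) (tangentMap α 1 w) := if_neg hw

/-- The dual billiards map in polar coordinates: the intersection point of the tangent lines at `θ`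
and `φ` is a point of the orbit. -/
theorem billiardHomeo_polar (hα : IsSupportCurve α) {θ φ : ℝ} (h1 : θ < φ)
    (h2 : φ < θ + Real.pi) (hne : α φ ≠ α θ) :
    hα.billiardHomeo ((fore α θ φ : ℂ) * Complex.exp (θ * Complex.I)) =
      (back α θ φ : ℂ) * Complex.exp (φ * Complex.I) := by
  have hX := hα.fore_pos_of_ne h1 h2 hne
  have hY := hα.back_pos_of_ne h1 h2 hne
  rw [hα.billiardHomeo_apply (polar_ne_zero hX θ), tangentMap_polar hα.periodic hX, one_mul]
  have e : α θ + fore α θ φ • dirVec θ = α φ + (-1 * back α θ φ) • dirVec φ := by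
    have := sub_eq_fore_add_back (α := α) h1 h2
    rw [neg_one_mul, neg_smul]
    linear_combination -this
  rw [e, ← tangentMap_polar hα.periodic hY, hα.collapse_tangentMap (Or.inr rfl) (polar_ne_zero hY φ)]

theorem ne_of_fore_pos {θ φ : ℝ} (h : 0 < fore α θ φ) : α φ ≠ α θ := by
  intro he
  simp [fore, he, proj] at h

theorem ne_of_back_pos {θ φ : ℝ} (h : 0 < back α θ φ) : α φ ≠ α θ := by
  intro he
  simp [back, he, proj] at h

/-- The dual billiards map twists rays counterclockwise. -/
theorem billiardHomeo_twist (hα : IsSupportCurve α) {w : ℂ} (hw : w ≠ 0) {l : ℝ} (hl : 1 < l) :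
    0 < cross (hα.billiardHomeo w) (hα.billiardHomeo ((l : ℂ) * w)) := by
  obtain ⟨r, θ, hr, rfl⟩ := exists_polar hw
  have hlr : 0 < l * r := by positivity
  obtain ⟨φ, h1, h2, h3⟩ := hα.exists_fore_eq θ hr
  obtain ⟨ψ, k1, k2, k3⟩ := hα.exists_fore_eq θ hlr
  have hne := ne_of_fore_pos (h3.symm ▸ hr)
  have kne := ne_of_fore_pos (k3.symm ▸ hlr)
  have hφψ : φ < ψ := by
    by_contra! hle
    have := hα.fore_mono k1 hle h2
    rw [h3, k3] at this
    nlinarith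
  have e1 := hα.billiardHomeo_polar h1 h2 hne
  have e2 := hα.billiardHomeo_polar k1 k2 kne
  rw [h3] at e1
  rw [k3, Complex.ofReal_mul, mul_assoc] at e2
  rw [e1, e2, cross_polar]
  exact mul_pos (mul_pos (hα.back_pos_of_ne h1 h2 hne) (hα.back_pos_of_ne k1 k2 kne))
    (sin_sub_pos hφψ (by linarith))

/-- The inverse of the dual billiards map twists rays clockwise. -/
theorem billiardHomeo_symm_twist (hα : IsSupportCurve α) {w : ℂ} (hw : w ≠ 0) {l : ℝ}
    (hl : 1 < l) :
    cross (hα.billiardHomeo.symm w) (hα.billiardHomeo.symm ((l : ℂ) * w)) < 0 := by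
  obtain ⟨r, φ, hr, rfl⟩ := exists_polar hw
  have hlr : 0 < l * r := by positivity
  obtain ⟨θ, h1, h2, h3⟩ := hα.exists_back_eq φ hr
  obtain ⟨ψ, k1, k2, k3⟩ := hα.exists_back_eq φ hlr
  have h1' : φ < θ + Real.pi := by linarith
  have k1' : φ < ψ + Real.pi := by linarith
  have hne := ne_of_back_pos (h3.symm ▸ hr)
  have kne := ne_of_back_pos (k3.symm ▸ hlr)
  have hψθ : ψ < θ := by
    by_contra! hle
    have := hα.back_anti hle k2 h1'
    rw [h3, k3] at this
    nlinarith
  have e1 := hα.billiardHomeo_polar h2 h1' hne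
  have e2 := hα.billiardHomeo_polar k2 k1' kne
  rw [h3, ← Homeomorph.eq_symm_apply] at e1
  rw [k3, Complex.ofReal_mul, mul_assoc, ← Homeomorph.eq_symm_apply] at e2
  rw [← e1, ← e2, cross_polar, ← neg_sub θ ψ, Real.sin_neg, mul_neg, neg_lt_zero]
  exact mul_pos (mul_pos (hα.fore_pos_of_ne h2 h1' hne) (hα.fore_pos_of_ne k2 k1' kne))
    (sin_sub_pos hψθ (by linarith))

end IsSupportCurve

end

/-! ### Tangent coordinates preserve area -/

section

variable {α : ℝ → ℂ}

/-- The image of a null set under a map that is Lipschitz on it is a null set. -/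
theorem volume_image_eq_zero {f : ℂ → ℂ} {C : NNReal} {A : Set ℂ} (hf : LipschitzOnWith C f A)
    (hA : volume A = 0) : volume (f '' A) = 0 := by
  have h1 : μH[(Module.finrank ℝ ℂ : ℕ)] A = 0 :=
    Measure.absolutelyContinuous_isAddHaarMeasure (μH[(Module.finrank ℝ ℂ : ℕ)] : Measure ℂ) volume hA
  have h2 := hf.hausdorffMeasure_image_le (d := (Module.finrank ℝ ℂ : ℕ)) (by positivity)
  rw [h1, mul_zero, nonpos_iff_eq_zero] at h2
  exact Measure.absolutelyContinuous_isAddHaarMeasure volume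
    (μH[(Module.finrank ℝ ℂ : ℕ)] : Measure ℂ) h2

theorem det_im_smul_add_mul (a c : ℂ) :
    (Complex.imCLM.smulRight a + c • (1 : ℂ →L[ℝ] ℂ)).det = Complex.normSq c + cross c a := by
  rw [ContinuousLinearMap.det, ← LinearMap.det_toMatrix Complex.basisOneI, Matrix.det_fin_two]
  simp [LinearMap.toMatrix_apply, Complex.basisOneI, Complex.normSq_apply, cross]
  ring

/-- Where it exists, the derivative of a curve parametrized by its normal direction is tangent to
the supporting line. -/
theorem exists_deriv_eq_smul (hsupp : ∀ θ φ, proj (α φ) θ ≤ proj (α θ) θ) {θ : ℝ} {a : ℂ}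
    (ha : HasDerivAt α a θ) : ∃ ρ : ℝ, a = ρ • dirVec θ := by
  refine exists_smul_dirVec ?_
  have hre : HasDerivAt (fun φ => (α φ).re) a.re θ := 
    Complex.reCLM.hasFDerivAt.comp_hasDerivAt θ ha
  have him : HasDerivAt (fun φ => (α φ).im) a.im θ := 
    Complex.imCLM.hasFDerivAt.comp_hasDerivAt θ ha
  have hd : HasDerivAt (fun φ => proj (α φ) θ) (proj a θ) θ :=
    (hre.mul_const _).add (him.mul_const _)
  exact IsLocalMax.hasDerivAt_eq_zero (Eventually.of_forall fun φ => hsupp θ φ) hd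

/-- The tangent coordinates in the logarithmic chart. -/
noncomputable def logTangentMap (α : ℝ → ℂ) (σ : ℝ) (ζ : ℂ) : ℂ :=
  α ζ.im + (σ : ℂ) * (Complex.I * Complex.exp ζ)

theorem hasFDerivAt_logTangentMap {σ : ℝ} {ζ a : ℂ} (ha : HasDerivAt α a ζ.im) :
    HasFDerivAt (logTangentMap α σ) (Complex.imCLM.smulRight a +
      ((σ : ℂ) * (Complex.I * Complex.exp ζ)) • (1 : ℂ →L[ℝ] ℂ)) ζ := by
  have h1 : HasFDerivAt (fun ζ : ℂ => α ζ.im) (Complex.imCLM.smulRight a) ζ := by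
    have ha' : HasFDerivAt α (ContinuousLinearMap.toSpanSingleton ℝ a) (Complex.imCLM ζ) :=
      ha.hasFDerivAt
    refine (ha'.comp ζ Complex.imCLM.hasFDerivAt).congr_fderiv ?_
    ext
    simp
  have h2 : HasDerivAt (fun ζ : ℂ => (σ : ℂ) * (Complex.I * Complex.exp ζ))
      ((σ : ℂ) * (Complex.I * Complex.exp ζ)) ζ :=
    ((Complex.hasDerivAt_exp ζ).const_mul _).const_mul _
  have h3 := h2.hasFDerivAt.restrictScalars ℝ
  refine h1.add (h3.congr_fderiv ?_)
  ext
  simp [mul_comm]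

/-- The Jacobian of the tangent coordinates does not depend on the curve, because the curve moves
along the tangent direction. -/
theorem det_logTangentMap (hsupp : ∀ θ φ, proj (α φ) θ ≤ proj (α θ) θ) {σ : ℝ}
    (hσ : σ = 1 ∨ σ = -1) {ζ a : ℂ} (ha : HasDerivAt α a ζ.im) :
    (Complex.imCLM.smulRight a +
      ((σ : ℂ) * (Complex.I * Complex.exp ζ)) • (1 : ℂ →L[ℝ] ℂ)).det =
      Real.exp ζ.re ^ 2 := by
  obtain ⟨ρ, rfl⟩ := exists_deriv_eq_smul hsupp ha
  have he : Complex.I * Complex.exp ζ = Real.exp ζ.re • dirVec ζ.im := by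
    rw [← I_mul_polar, Complex.ofReal_exp, ← Complex.exp_add, Complex.re_add_im]
  rw [det_im_smul_add_mul, he, map_mul, Complex.normSq_ofReal, Complex.normSq_eq_norm_sq (_ • _),
    norm_smul, norm_dirVec, Real.norm_of_nonneg (Real.exp_pos _).le]
  have hσ2 : σ * σ = 1 := by rcases hσ with rfl | rfl <;> norm_num
  have hcr : cross ((σ : ℂ) * Real.exp ζ.re • dirVec ζ.im) (ρ • dirVec ζ.im) = 0 := by
    simp [cross]
    ring
  rw [hcr, hσ2]
  ring

theorem volume_im_preimage_eq_zero {S : Set ℝ} (hS : volume S = 0) :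
    volume {ζ : ℂ | ζ.im ∈ S} = 0 := by
  have h := (Measure.quasiMeasurePreserving_snd (μ := (volume : Measure ℝ))
    (ν := (volume : Measure ℝ))).comp Complex.volume_preserving_equiv_real_prod.quasiMeasurePreserving
  exact h.preimage_null hS

/-- In the logarithmic chart the tangent coordinates are Lipschitz on every left half-plane. -/
theorem volume_logTangentMap_image_eq_zero {C : NNReal} (hL : LipschitzWith C α) {σ : ℝ}
    {A : Set ℂ} (hA : volume A = 0) : volume (logTangentMap α σ '' A) = 0 := by
  have hU : A = ⋃ n : ℕ, A ∩ {ζ | ζ.re ≤ n} := by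
    rw [← inter_iUnion]
    refine (inter_eq_left.2 fun ζ _ => mem_iUnion.2 ?_).symm
    exact exists_nat_ge ζ.re
  rw [hU, image_iUnion]
  refine measure_iUnion_null fun n => ?_
  refine volume_image_eq_zero (C := C * 1 + Real.toNNReal (|σ| * Real.exp n)) ?_
    (measure_mono_null inter_subset_left hA)
  refine LipschitzOnWith.mono ?_ inter_subset_right
  refine LipschitzOnWith.add ?_ ?_
  · have him : LipschitzWith 1 Complex.im := LipschitzWith.of_dist_le_mul fun z w => by
      rw [NNReal.coe_one, one_mul, Real.dist_eq, dist_eq_norm, ← Complex.sub_im]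
      exact Complex.abs_im_le_norm _
    exact (hL.comp him).lipschitzOnWith
  · have hconv : Convex ℝ {ζ : ℂ | ζ.re ≤ (n : ℝ)} := convex_halfSpace_re_le _
    refine hconv.lipschitzOnWith_of_nnnorm_hasDerivWithin_le (𝕜 := ℂ)
      (f' := fun ζ => (σ : ℂ) * (Complex.I * Complex.exp ζ)) (fun ζ _ =>
      (((Complex.hasDerivAt_exp ζ).const_mul _).const_mul _).hasDerivWithinAt) fun ζ hζ => ?_
    have hζ : ζ.re ≤ (n : ℝ) := hζ
    rw [← NNReal.coe_le_coe, coe_nnnorm, Real.coe_toNNReal _ (by positivity), norm_mul, norm_mul,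
      Complex.norm_I, one_mul, Complex.norm_exp, Complex.norm_real, Real.norm_eq_abs]
    gcongr

/-- The area of the image does not depend on the curve. The change of variables applies over the
angles where the curve is differentiable, and the others form a null set. -/
theorem volume_logTangentMap_image {C : NNReal} (hL : LipschitzWith C α)
    (hsupp : ∀ θ φ, proj (α φ) θ ≤ proj (α θ) θ) {σ : ℝ} (hσ : σ = 1 ∨ σ = -1) {B : Set ℂ}
    (hB : MeasurableSet B) (hinj : InjOn (logTangentMap α σ) B) :
    volume (logTangentMap α σ '' B) = ∫⁻ ζ in B, ENNReal.ofReal (Real.exp ζ.re ^ 2) := by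
  have hDm : MeasurableSet {θ | DifferentiableAt ℝ α θ} := measurableSet_of_differentiableAt ℝ α
  have hD0 : volume {θ | DifferentiableAt ℝ α θ}ᶜ = 0 := hL.ae_differentiableAt_real
  obtain ⟨D, hD⟩ : ∃ D : Set ℂ, D = {ζ : ℂ | DifferentiableAt ℝ α ζ.im} := ⟨_, rfl⟩
  have hDmeas : MeasurableSet D := hD ▸ Complex.measurable_im hDm
  have hDnull : volume Dᶜ = 0 := by
    rw [hD]; exact volume_im_preimage_eq_zero hD0
  have hae : (B ∩ D : Set ℂ) =ᵐ[volume] B :=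
    inter_ae_eq_left_of_ae_eq_univ (ae_eq_univ.2 hDnull)
  have himage : (logTangentMap α σ '' (B ∩ D) : Set ℂ) =ᵐ[volume] logTangentMap α σ '' B := by
    have hsplit : logTangentMap α σ '' B =
        logTangentMap α σ '' (B ∩ D) ∪ logTangentMap α σ '' (B ∩ Dᶜ) := by
      rw [← image_union, inter_union_compl]
    rw [hsplit]
    exact (union_ae_eq_left_of_ae_eq_empty (ae_eq_empty.2
      (volume_logTangentMap_image_eq_zero hL (measure_mono_null inter_subset_right hDnull)))).symm
  rw [← measure_congr himage, ← setLIntegral_congr hae]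
  have hder : ∀ ζ ∈ B ∩ D, HasDerivAt α (deriv α ζ.im) ζ.im := fun ζ hζ => by
    have h := hζ.2
    rw [hD] at h
    exact DifferentiableAt.hasDerivAt h
  rw [← lintegral_abs_det_fderiv_eq_addHaar_image volume (hB.inter hDmeas)
    (fun ζ hζ => (hasFDerivAt_logTangentMap (σ := σ) (hder ζ hζ)).hasFDerivWithinAt)
    (hinj.mono inter_subset_left)]
  refine setLIntegral_congr_fun (hB.inter hDmeas) fun ζ hζ => ?_
  rw [det_logTangentMap hsupp hσ (hder ζ hζ), abs_of_nonneg (by positivity)]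

namespace IsSupportCurve

theorem logTangentMap_eq (hα : IsSupportCurve α) (σ : ℝ) (ζ : ℂ) :
    logTangentMap α σ ζ = tangentMap α σ (Complex.exp ζ) := by
  have h : Complex.exp ζ = (Real.exp ζ.re : ℂ) * Complex.exp (ζ.im * Complex.I) := by
    rw [Complex.ofReal_exp, ← Complex.exp_add, Complex.re_add_im]
  rw [tangentMap, logTangentMap]
  congr 1
  rw [h, apply_arg_polar hα.periodic (Real.exp_pos _)]

/-- The tangent coordinates preserve area. -/
theorem volume_tangentMap_image (hα : IsSupportCurve α) {C : NNReal} (hL : LipschitzWith C α)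
    {σ : ℝ} (hσ : σ = 1 ∨ σ = -1) {B : Set ℂ} (hB : MeasurableSet B) (h0 : (0 : ℂ) ∉ B) :
    volume (tangentMap α σ '' B) = volume B := by
  obtain ⟨S, hS⟩ : ∃ S : Set ℂ, S = {ζ : ℂ | ζ.im ∈ Ioc (-Real.pi) Real.pi} ∩ Complex.exp ⁻¹' B :=
    ⟨_, rfl⟩
  have hSm : MeasurableSet S := by
    rw [hS]
    exact (Complex.measurable_im measurableSet_Ioc).inter (Complex.measurable_exp hB)
  have himg : Complex.exp '' S = B := by
    rw [hS]
    ext w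
    constructor
    · rintro ⟨ζ, hζ, rfl⟩
      exact hζ.2
    · intro hw
      have hw0 : w ≠ 0 := fun h => h0 (h ▸ hw)
      refine ⟨Complex.log w, ⟨⟨Complex.neg_pi_lt_log_im w, Complex.log_im_le_pi w⟩, ?_⟩,
        Complex.exp_log hw0⟩
      rw [mem_preimage, Complex.exp_log hw0]
      exact hw
  have hinj : InjOn Complex.exp S := by
    intro ζ hζ ζ' hζ' he
    rw [hS] at hζ hζ'
    rw [← Complex.log_exp hζ.1.1 hζ.1.2, ← Complex.log_exp hζ'.1.1 hζ'.1.2, he]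
  have e1 : logTangentMap α σ '' S = tangentMap α σ '' B := by
    rw [← himg, image_image]
    exact image_congr fun ζ _ => hα.logTangentMap_eq σ ζ
  have i1 : InjOn (logTangentMap α σ) S := by
    intro ζ hζ ζ' hζ' he
    rw [hα.logTangentMap_eq, hα.logTangentMap_eq] at he
    exact hinj hζ hζ' (hα.tangentMap_injOn hσ (Complex.exp_ne_zero ζ) (Complex.exp_ne_zero ζ') he)
  -- The curve reduced to the origin gives the rotation by a right angle.
  obtain ⟨c, hc⟩ : ∃ c : Circle, (c : ℂ) = Complex.I :=
    ⟨⟨Complex.I, by simp [Submonoid.unitSphere]⟩, rfl⟩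
  have e2 : logTangentMap (fun _ => 0) 1 '' S = rotation c '' B := by
    rw [← himg, image_image]
    refine image_congr fun ζ _ => ?_
    rw [rotation_apply, hc]
    simp [logTangentMap]
  have i2 : InjOn (logTangentMap (fun _ => 0) 1) S := by
    intro ζ hζ ζ' hζ' he
    have he' : Complex.exp ζ = Complex.exp ζ' := by simpa [logTangentMap] using he
    exact hinj hζ hζ' he'
  rw [← e1, volume_logTangentMap_image hL hα.support hσ hSm i1,
    ← volume_logTangentMap_image (C := 0) (LipschitzWith.const 0) (fun _ _ => le_rfl) (Or.inl rfl)
      hSm i2, e2]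
  rw [LinearIsometryEquiv.image_eq_preimage_symm]
  exact (rotation c).symm.measurePreserving.measure_preimage hB.nullMeasurableSet

/-- The dual billiards map preserves area. -/
theorem volume_billiardHomeo_preimage (hα : IsSupportCurve α) {C : NNReal}
    (hL : LipschitzWith C α) {A : Set ℂ} (hA : IsOpen A) :
    volume (hα.billiardHomeo ⁻¹' A) = volume A := by
  have hf : ∀ w ≠ 0, tangentMap α (-1) (hα.billiardHomeo w) = tangentMap α 1 w := fun w hw => by
    rw [hα.billiardHomeo_apply hw]
    exact (hα.collapse_of_mem (Or.inr rfl) (hα.tangentMap_mem_outside (Or.inl rfl) hw)).2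
  have hne : ∀ w, hα.billiardHomeo w = 0 ↔ w = 0 := fun w => by
    rw [← hα.billiardHomeo.injective.eq_iff (a := w), hα.billiardHomeo_zero]
  have e : tangentMap α 1 '' (hα.billiardHomeo ⁻¹' A \ {0}) = tangentMap α (-1) '' (A \ {0}) := by
    ext z
    constructor
    · rintro ⟨w, ⟨hw, hw0⟩, rfl⟩
      exact ⟨_, ⟨hw, fun h => hw0 ((hne w).1 h)⟩, hf w hw0⟩
    · rintro ⟨w, ⟨hw, hw0⟩, rfl⟩
      have h1 : hα.billiardHomeo.symm w ≠ 0 := fun h => hw0 (by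
        have := (hne _).2 h
        rwa [Homeomorph.apply_symm_apply] at this)
      refine ⟨hα.billiardHomeo.symm w, ⟨?_, h1⟩, ?_⟩
      · rwa [mem_preimage, Homeomorph.apply_symm_apply]
      · rw [← hf _ h1, Homeomorph.apply_symm_apply]
  have hm1 : MeasurableSet (hα.billiardHomeo ⁻¹' A \ {0}) :=
    (hA.preimage hα.billiardHomeo.continuous).measurableSet.diff (measurableSet_singleton 0)
  have hm2 : MeasurableSet (A \ {0}) := hA.measurableSet.diff (measurableSet_singleton 0)
  rw [← measure_sdiff_null (s := hα.billiardHomeo ⁻¹' A) (measure_singleton (0 : ℂ)),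
    ← measure_sdiff_null (s := A) (measure_singleton (0 : ℂ)),
    ← hα.volume_tangentMap_image hL (Or.inl rfl) hm1 (fun h => h.2 rfl), e,
    hα.volume_tangentMap_image hL (Or.inr rfl) hm2 (fun h => h.2 rfl)]

end IsSupportCurve

end

/-! ### From invariant circles to invariant radius functions -/

section

variable {α : ℝ → ℂ}

/-- The component of the origin in the complement of a continuum, if it is bounded. -/
theorem isInnerDomain_connectedComponentIn {Ω : Set ℂ} (hc : IsClosed Ω) (hconn : IsPreconnected Ω)
    (h0 : (0 : ℂ) ∉ Ω) (hb : Bornology.IsBounded (connectedComponentIn Ωᶜ 0)) :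
    IsInnerDomain Ω (connectedComponentIn Ωᶜ 0) where
  preconnected_bdry := hconn
  closed_bdry := hc
  isOpen := hc.isOpen_compl.connectedComponentIn
  preconnected := isPreconnected_connectedComponentIn
  zero_mem := mem_connectedComponentIn h0
  subset_compl := connectedComponentIn_subset _ _
  frontier_subset x hx := by
    by_contra hxΩ
    have hopen : ∀ y, IsOpen (connectedComponentIn Ωᶜ y) := fun y =>
      hc.isOpen_compl.connectedComponentIn
    obtain ⟨y, hy, hy'⟩ := mem_closure_iff.1 hx.1 _ (hopen x) (mem_connectedComponentIn hxΩ)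
    refine hx.2 ?_
    rw [(hopen 0).interior_eq, connectedComponentIn_eq hy', ← connectedComponentIn_eq hy]
    exact mem_connectedComponentIn hxΩ
  bounded := hb

theorem image_connectedComponentIn_compl {Ω : Set ℂ} (f : ℂ ≃ₜ ℂ) (h0 : (0 : ℂ) ∉ Ω)
    (hf0 : f 0 = 0) (hf : f '' Ω = Ω) :
    f '' connectedComponentIn Ωᶜ 0 = connectedComponentIn Ωᶜ 0 := by
  rw [f.image_connectedComponentIn (by exact h0), hf0, image_compl_eq f.bijective, hf]

/-- An open bounded set that is star-shaped about the origin, in polar coordinates. -/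
theorem exists_radius {V : Set ℂ} (hV : IsOpen V) (h0 : (0 : ℂ) ∈ V) (hstar : V ⊆ starKernel V)
    {ε : ℝ} (hε : V ⊆ Metric.ball 0 ε) : ∃ R : ℝ → ℝ, (∀ θ, R θ ≤ ε) ∧
      ∀ θ t : ℝ, 0 ≤ t → ((t : ℂ) * Complex.exp (θ * Complex.I) ∈ V ↔ t < R θ) := by
  have hle : ∀ θ : ℝ, ∀ t ∈ {t : ℝ | 0 ≤ t ∧ (t : ℂ) * Complex.exp (θ * Complex.I) ∈ V}, t ≤ ε := by
    rintro θ t ⟨ht, htV⟩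
    have := hε htV
    rw [mem_ball_zero_iff, norm_mul, Complex.norm_exp_ofReal_mul_I, mul_one, Complex.norm_real,
      Real.norm_of_nonneg ht] at this
    exact this.le
  have hne : ∀ θ : ℝ, {t : ℝ | 0 ≤ t ∧ (t : ℂ) * Complex.exp (θ * Complex.I) ∈ V}.Nonempty :=
    fun θ => ⟨0, le_rfl, by simpa using h0⟩
  refine ⟨fun θ => sSup {t : ℝ | 0 ≤ t ∧ (t : ℂ) * Complex.exp (θ * Complex.I) ∈ V},
    fun θ => csSup_le (hne θ) (hle θ), fun θ t ht => ⟨fun htV => ?_, fun hlt => ?_⟩⟩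
  · have hcont : ContinuousAt (fun t : ℝ => (t : ℂ) * Complex.exp (θ * Complex.I)) t := by fun_prop
    have hev : ∀ᶠ u : ℝ in 𝓝 t, (u : ℂ) * Complex.exp (θ * Complex.I) ∈ V :=
      hcont.eventually_mem (hV.mem_nhds htV)
    obtain ⟨u, hu, htu⟩ := ((hev.filter_mono nhdsWithin_le_nhds).and
      (self_mem_nhdsWithin : Ioi t ∈ 𝓝[>] t)).exists
    have htu : t < u := htu
    exact htu.trans_le (le_csSup ⟨ε, hle θ⟩ ⟨ht.trans htu.le, hu⟩)
  · obtain ⟨u, ⟨-, huV⟩, htu⟩ := exists_lt_of_lt_csSup (hne θ) hlt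
    have hu : 0 < u := ht.trans_lt htu
    have := hstar huV (t / u) ⟨by positivity, (div_le_one hu).2 htu.le⟩
    have he : ((t / u : ℝ) : ℂ) * ((u : ℂ) * Complex.exp (θ * Complex.I)) =
        (t : ℂ) * Complex.exp (θ * Complex.I) := by
      rw [← mul_assoc, ← Complex.ofReal_mul, div_mul_cancel₀ _ hu.ne']
    rwa [he] at this

/-- By Birkhoff's theorem the component of the origin in the complement of an invariant continuum
is given by an invariant radius function. -/
theorem IsSupportCurve.exists_isInvariantRadius (hα : IsSupportCurve α) {C : NNReal}
    (hL : LipschitzWith C α) {Ω : Set ℂ} (hc : IsClosed Ω) (hconn : IsPreconnected Ω)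
    (h0 : (0 : ℂ) ∉ Ω) (hf : hα.billiardHomeo '' Ω = Ω) {ε : ℝ}
    (hε : connectedComponentIn Ωᶜ 0 ⊆ Metric.ball 0 ε) :
    ∃ R, IsInvariantRadius α R ∧ ∀ θ, R θ ≤ ε := by
  have hV := isInnerDomain_connectedComponentIn hc hconn h0 (Metric.isBounded_ball.subset hε)
  have hfV := image_connectedComponentIn_compl hα.billiardHomeo h0 hα.billiardHomeo_zero hf
  obtain ⟨V, hVe⟩ : ∃ V, V = connectedComponentIn Ωᶜ 0 := ⟨_, rfl⟩
  rw [← hVe] at hV hfV hε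
  have hstar := hV.subset_starKernel hα.billiardHomeo hfV hα.billiardHomeo_zero
    (fun A hA => hα.volume_billiardHomeo_preimage hL hA)
    (fun w hw l hl => hα.billiardHomeo_twist hw hl)
    (fun w hw l hl => hα.billiardHomeo_symm_twist hw hl)
  obtain ⟨R, hRε, hR⟩ := exists_radius hV.isOpen hV.zero_mem hstar hε
  refine ⟨R, ⟨fun θ => (hR θ 0 le_rfl).1 (by simpa using hV.zero_mem), fun θ φ h1 h2 => ?_⟩, hRε⟩
  rw [← hR θ _ (hα.fore_nonneg h1 h2), ← hR φ _ (hα.back_nonneg h1 h2)]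
  by_cases hne : α φ = α θ
  · have hz := hV.zero_mem
    simp [fore, back, hne, proj, hz]
  · rw [← hα.billiardHomeo_polar h1 h2 hne]
    nth_rewrite 2 [← hfV]
    exact hα.billiardHomeo.injective.mem_set_image.symm

/-- If the origin and a point `p` beyond `A` lie in the same component of the complement of `A`, then
`A` carries a branch of the logarithm, since `z / (z - p)` has one, and so has `z - p`. -/
theorem exists_log_of_connectedComponentIn {A : Set ℂ} (hA : IsCompact A) (h0 : (0 : ℂ) ∉ A)
    {ε : ℝ} (hAε : A ⊆ Metric.ball 0 ε) (hε : ¬ connectedComponentIn Aᶜ 0 ⊆ Metric.ball 0 ε) :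
    ∃ l : ℂ → ℂ, ContinuousOn l A ∧ ∀ z ∈ A, Complex.exp (l z) = z := by
  obtain ⟨p, hp, hpε⟩ := not_subset.1 hε
  rw [mem_ball_zero_iff, not_lt] at hpε
  have hVo : IsOpen (connectedComponentIn Aᶜ 0) := hA.isClosed.isOpen_compl.connectedComponentIn
  have hz : (0 : ℂ) ∈ connectedComponentIn Aᶜ 0 := mem_connectedComponentIn h0
  have hpath : IsPathConnected (connectedComponentIn Aᶜ 0) :=
    hVo.isConnected_iff_isPathConnected.1 ⟨⟨0, hz⟩, isPreconnected_connectedComponentIn⟩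
  obtain ⟨γ, hγ⟩ := hpath.joinedIn 0 hz p hp
  have hγA : A ⊆ (range γ)ᶜ := by
    rintro z hzA ⟨t, rfl⟩
    exact connectedComponentIn_subset _ _ (hγ t) hzA
  obtain ⟨d, hd, hdA⟩ := hA.exists_thickening_subset_open
    (isCompact_range γ.continuous).isClosed.isOpen_compl hγA
  obtain ⟨L, hLc, hL⟩ := exists_log_div (isPreconnected_range γ.continuous) hd
    (A := A) (fun z hz q hq => by
      by_contra! hlt
      exact hdA (Metric.mem_thickening_iff.2 ⟨z, hz, by rwa [dist_comm]⟩) hq)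
    ⟨0, γ.source⟩ ⟨1, γ.target⟩
  have hsmall : ∀ z ∈ A, ‖z‖ < ‖p‖ := fun z hz =>
    (mem_ball_zero_iff.1 (hAε hz)).trans_le hpε
  rcases A.eq_empty_or_nonempty with rfl | ⟨a, ha⟩
  · exact ⟨fun z => z, continuousOn_empty _, by simp⟩
  have hp0 : p ≠ 0 := norm_pos_iff.1 ((norm_nonneg a).trans_lt (hsmall a ha))
  have hslit : ∀ z ∈ A, 1 - z / p ∈ Complex.slitPlane := fun z hz => by
    refine Complex.mem_slitPlane_iff.2 (Or.inl ?_)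
    have h1 : ‖z / p‖ < 1 := by
      rw [norm_div, div_lt_one (norm_pos_iff.2 hp0)]
      exact hsmall z hz
    have h2 := (Complex.re_le_norm (z / p)).trans_lt h1
    simp only [Complex.sub_re, Complex.one_re]
    linarith
  refine ⟨fun z => L z + (Complex.log (-p) + Complex.log (1 - z / p)), ?_, fun z hz => ?_⟩
  · exact hLc.add (continuousOn_const.add (ContinuousOn.clog (by fun_prop) hslit))
  · have hzp : z - p ≠ 0 := fun h => by
      have := hsmall z hz
      rw [sub_eq_zero.1 h] at this
      exact lt_irrefl _ this
    rw [Complex.exp_add, Complex.exp_add, hL z hz, Complex.exp_log (neg_ne_zero.2 hp0),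
      Complex.exp_log (Complex.slitPlane_ne_zero (hslit z hz))]
    field_simp
    ring

namespace IsSupportCurve

/-- A loop in the exterior whose image in tangent coordinates has a logarithm is contractible. -/
theorem nullhomotopic_of_log (hα : IsSupportCurve α) (c : C(Circle, outside α)) {l : ℂ → ℂ}
    (hl : ContinuousOn l (range fun t => collapse α (-1) (c t : ℂ)))
    (hle : ∀ z ∈ range fun t => collapse α (-1) (c t : ℂ), Complex.exp (l z) = z) :
    c.Nullhomotopic := by
  have hσ : (-1 : ℝ) = 1 ∨ (-1 : ℝ) = -1 := Or.inr rfl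
  have hmem : ∀ ζ : ℂ, tangentMap α (-1) (Complex.exp ζ) ∈ outside α := fun ζ =>
    hα.tangentMap_mem_outside hσ (Complex.exp_ne_zero ζ)
  have hT : Continuous fun ζ : ℂ => tangentMap α (-1) (Complex.exp ζ) :=
    continuous_iff_continuousAt.2 fun ζ =>
      (hα.continuousAt_tangentMap (-1) (Complex.exp_ne_zero ζ)).comp (f := Complex.exp)
        Complex.continuous_exp.continuousAt
  have hm : Continuous fun t : Circle => l (collapse α (-1) (c t : ℂ)) :=
    hl.comp_continuous ((hα.continuous_collapse hσ).comp (continuous_subtype_val.comp c.continuous))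
      fun t => ⟨t, rfl⟩
  refine ⟨⟨tangentMap α (-1) (Complex.exp 0), hmem 0⟩, ⟨⟨⟨fun p => ⟨tangentMap α (-1)
    (Complex.exp ((1 - ((p.1 : ℝ) : ℂ)) * l (collapse α (-1) (c p.2 : ℂ)))), hmem _⟩, ?_⟩,
    fun t => ?_, fun t => ?_⟩⟩⟩
  · refine Continuous.subtype_mk (hT.comp ?_) _
    have := hm.comp (continuous_snd (X := unitInterval))
    refine Continuous.mul ?_ this
    fun_prop
  · refine Subtype.ext ?_
    have h1 : Complex.exp (l (collapse α (-1) (c t : ℂ))) = collapse α (-1) (c t : ℂ) :=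
      hle _ ⟨t, rfl⟩
    simp only [Icc.coe_zero, Complex.ofReal_zero, sub_zero, one_mul, h1]
    exact (hα.collapse_of_mem hσ (c t).2).2
  · refine Subtype.ext ?_
    simp

/-- `collapse` conjugates the dual billiards map to `billiardHomeo`. -/
theorem billiardHomeo_collapse {Γ : Set ℂ} (hα : IsSupportCurve (tangencyPoint Γ)) {z : ℂ}
    (hz : z ∈ outside (tangencyPoint Γ)) :
    hα.billiardHomeo (collapse (tangencyPoint Γ) (-1) z) =
      collapse (tangencyPoint Γ) (-1) (dualBilliardsMap Γ z) := by
  have hσ : (-1 : ℝ) = 1 ∨ (-1 : ℝ) = -1 := Or.inr rfl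
  obtain ⟨hw0, hw⟩ := hα.collapse_of_mem hσ hz
  have hex : ∃ θ, IsTangentAngle Γ z θ := by
    obtain ⟨r, θ, hr, he⟩ := exists_polar hw0
    rw [he, tangentMap_polar hα.periodic hr] at hw
    refine ⟨θ, r, hr, ?_⟩
    rw [← hw, neg_one_mul, neg_smul]
    ring
  obtain ⟨r, hr, he⟩ := Classical.epsilon_spec hex
  obtain ⟨θ, hθ⟩ : ∃ θ, θ = Classical.epsilon (IsTangentAngle Γ z) := ⟨_, rfl⟩
  rw [← hθ] at he
  have h1 : z = tangentMap (tangencyPoint Γ) (-1) ((r : ℂ) * Complex.exp (θ * Complex.I)) := by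
    rw [tangentMap_polar hα.periodic hr, neg_one_mul, neg_smul, ← he]
    ring
  have h2 : dualBilliardsMap Γ z =
      tangentMap (tangencyPoint Γ) 1 ((r : ℂ) * Complex.exp (θ * Complex.I)) := by
    rw [tangentMap_polar hα.periodic hr, one_mul, ← he, dualBilliardsMap, ← hθ]
    ring
  rw [h2, ← hα.billiardHomeo_apply (polar_ne_zero hr θ)]
  congr 1
  nth_rewrite 1 [h1]
  exact hα.collapse_tangentMap hσ (polar_ne_zero hr θ)

/-- An essential invariant circle near the curve bounds a star-shaped domain in tangent
coordinates. -/
theorem exists_radius_of_essential {Γ : Set ℂ} (hα : IsSupportCurve (tangencyPoint Γ))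
    {C : NNReal} (hL : LipschitzWith C (tangencyPoint Γ)) {Ω : Set ℂ} {ε : ℝ}
    (hΩ : ∀ z ∈ Ω, ‖collapse (tangencyPoint Γ) (-1) z‖ < ε)
    (hess : IsEssentialCircle (outside (tangencyPoint Γ)) Ω) (hinv : dualBilliardsMap Γ '' Ω = Ω) :
    ∃ R, IsInvariantRadius (tangencyPoint Γ) R ∧ ∀ θ, R θ ≤ ε := by
  have hσ : (-1 : ℝ) = 1 ∨ (-1 : ℝ) = -1 := Or.inr rfl
  obtain ⟨c, -, hc, hnull⟩ := hess
  have hcont : Continuous fun t : Circle => collapse (tangencyPoint Γ) (-1) (c t : ℂ) :=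
    (hα.continuous_collapse hσ).comp (continuous_subtype_val.comp c.continuous)
  obtain ⟨A, hA⟩ : ∃ A, A = range fun t : Circle => collapse (tangencyPoint Γ) (-1) (c t : ℂ) :=
    ⟨_, rfl⟩
  have hAΩ : A = collapse (tangencyPoint Γ) (-1) '' Ω := by
    rw [hA, hc, ← range_comp]; rfl
  have hΩU : ∀ z ∈ Ω, z ∈ outside (tangencyPoint Γ) := by
    rw [hc]
    rintro _ ⟨t, rfl⟩
    exact (c t).2
  have hAc : IsCompact A := hA ▸ isCompact_range hcont
  have hAconn : IsPreconnected A := hA ▸ isPreconnected_range hcont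
  have hA0 : (0 : ℂ) ∉ A := by
    rw [hAΩ]
    rintro ⟨z, hz, hz0⟩
    exact (hα.collapse_of_mem hσ (hΩU z hz)).1 hz0
  have hAε : A ⊆ Metric.ball 0 ε := by
    rw [hAΩ]
    rintro _ ⟨z, hz, rfl⟩
    exact mem_ball_zero_iff.2 (hΩ z hz)
  have hfA : hα.billiardHomeo '' A = A := by
    have h1 : hα.billiardHomeo '' A =
        collapse (tangencyPoint Γ) (-1) '' (dualBilliardsMap Γ '' Ω) := by
      rw [hAΩ, image_image, image_image]
      exact image_congr fun z hz => hα.billiardHomeo_collapse (hΩU z hz)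
    rw [h1, hinv, hAΩ]
  refine hα.exists_isInvariantRadius hL hAc.isClosed hAconn hA0 hfA ?_
  by_contra hcon
  obtain ⟨l, hl, hle⟩ := exists_log_of_connectedComponentIn hAc hA0 hAε hcon
  rw [hA] at hl hle
  exact hnull (hα.nullhomotopic_of_log c hl hle)

end IsSupportCurve

end

end DualBilliards

theorem theorem4p3 (Γ : Set ℂ) (hΓ : DualBilliards.IsConvexCurve Γ)
    (hs : ∃ C : NNReal, LipschitzWith C (DualBilliards.arclength Γ))
    (a b : ℝ) (hab : a < b) (hJ : b ≤ a + 2 * Real.pi)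
    (h :
      -- (a) `s` is `C¹` on `J = (a, b)`, `ρ > 0` at the endpoints, `ρ` vanishes somewhere in `J`
      (ContDiffOn ℝ 1 (DualBilliards.arclength Γ) (Set.Ioo a b) ∧
        (∃ r : ℝ, 0 < r ∧ HasDerivWithinAt (DualBilliards.arclength Γ) r (Set.Ici a) a) ∧
        (∃ r : ℝ, 0 < r ∧ HasDerivWithinAt (DualBilliards.arclength Γ) r (Set.Iic b) b) ∧
        ∃ θ ∈ Set.Ioo a b, DualBilliards.radiusOfCurvature Γ θ = 0) ∨
      -- (b) `s` is `C¹` and `ρ > 0` on `J` minus a point, where `ρ` has a jump discontinuity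
      (∃ θ ∈ Set.Ioo a b,
        ContDiffOn ℝ 1 (DualBilliards.arclength Γ) (Set.Ioo a b \ {θ}) ∧
        (∀ x ∈ Set.Ioo a b \ {θ}, 0 < DualBilliards.radiusOfCurvature Γ x) ∧
        ∃ l r : ℝ, l ≠ r ∧
          Filter.Tendsto (DualBilliards.radiusOfCurvature Γ) (nhdsWithin θ (Set.Iio θ)) (nhds l) ∧
          Filter.Tendsto (DualBilliards.radiusOfCurvature Γ) (nhdsWithin θ (Set.Ioi θ)) (nhds r))) :
    ∃ N : Set ℂ, IsOpen N ∧ Γ ⊆ N ∧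
      ∀ Ω : Set ℂ, Ω ⊆ N →
        DualBilliards.IsEssentialCircle (DualBilliards.exteriorRegion Γ) Ω →
        DualBilliards.dualBilliardsMap Γ '' Ω ≠ Ω := by
  obtain ⟨K, hK, hconv, hint, rfl⟩ := hΓ
  obtain ⟨C, hC⟩ := hs
  have hne : K.Nonempty := hint.mono interior_subset
  have hlen : DualBilliards.IsLengthFunction (DualBilliards.tangencyPoint (frontier K))
      (DualBilliards.arclength (frontier K)) :=
    DualBilliards.isLengthFunction_variation fun θ φ =>
      DualBilliards.proj_le_proj_tangencyPoint hK (hK.isClosed.frontier_subset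
        (DualBilliards.tangencyPoint_mem_frontier hK hne φ)) θ
  have hL := hlen.lipschitzWith hC
  have hα := DualBilliards.isSupportCurve_tangencyPoint hK hint hL.continuous
  obtain ⟨θ₀, ε, hε, hbound⟩ : ∃ θ₀, ∃ ε > 0, ∀ R,
      DualBilliards.IsInvariantRadius (DualBilliards.tangencyPoint (frontier K)) R →
        ε ≤ R θ₀ := by
    rcases h with ⟨hd, -, -, θ, hθ, h0⟩ | ⟨θ, hθ, h'⟩
    · exact ⟨θ, hα.exists_radius_bound hlen hC.continuous hθ (Or.inl ⟨hd, h0⟩)⟩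
    · exact ⟨θ, hα.exists_radius_bound hlen hC.continuous hθ (Or.inr h')⟩
  have hout : ∀ z, z ∈ DualBilliards.outside (DualBilliards.tangencyPoint (frontier K)) ↔ z ∉ K :=
    fun z => (DualBilliards.notMem_iff_exists_lt_proj hK hconv hne).symm
  have hU : DualBilliards.exteriorRegion (frontier K) =
      DualBilliards.outside (DualBilliards.tangencyPoint (frontier K)) := by
    rw [DualBilliards.exteriorRegion_frontier hK hconv hne]
    ext z
    exact (hout z).symm
  have hσ : (-1 : ℝ) = 1 ∨ (-1 : ℝ) = -1 := Or.inr rfl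
  -- An invariant circle in this neighbourhood has radius at most `ε / 2` in tangent coordinates.
  refine ⟨{z | ‖DualBilliards.collapse (DualBilliards.tangencyPoint (frontier K)) (-1) z‖ < ε / 2},
    isOpen_lt (hα.continuous_collapse hσ).norm continuous_const, fun z hz => ?_,
    fun Ω hΩ hess hinv => ?_⟩
  · have hz0 := hα.collapse_of_notMem hσ
      (fun h => (hout z).1 h (hK.isClosed.frontier_subset hz))
    show ‖DualBilliards.collapse (DualBilliards.tangencyPoint (frontier K)) (-1) z‖ < ε / 2
    rw [hz0, norm_zero]
    exact half_pos hε
  · rw [hU] at hess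
    obtain ⟨R, hR, hRε⟩ := hα.exists_radius_of_essential hL (fun z hz => hΩ hz) hess hinv
    linarith [hbound R hR, hRε θ₀]
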